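/- Conventions. Entropies are in bits, and for $x\in\mathbb R^n$, $q\in\mathbb N$, $[x]_q=\lfloor qx\rfloor/q$ componentwise. For a random vector $V$ and a random vector $W$ the (conditional) Rényi information dimensions are $d(V)=\lim_{q\to\infty}H([V]_q)/\log_2 q$ and $d(V\mid W)=\lim_{q\to\infty}H([V]_q\mid W)/\log_2 q$, whenever these limits exist. A real random variable is called nonsingular if its law is $\delta p_c+(1-\delta)p_d$ with $p_c$ absolutely continuous, $p_d$ discrete and $\delta\in[0,1]$; all nonsingular variables are assumed to have finite second moment, and their discrete part $p_d$ finite entropy. $\mathcal L$ is the class of random vectors distributed as $AZ$, where $A$ is a real matrix and $Z=(Z_1,\dots,Z_k)$ has independent nonsingular entries. $H_N$, $N=2^n$, is the Hadamard matrix defined by $H_1=(1)$ and $H_{2N}=\begin{pmatrix}H_N&H_N\\H_N&-H_N\end{pmatrix}$; a partial Hadamard matrix with $N$ columns is a submatrix consisting of a set of rows of $H_N$. Let $(X_i,Y_i)_{i\ge1}$ be i.i.d. pairs of real random variables. A family of matrices $\Phi^x_N\in\mathbb R^{m^x_N\times N}$, $\Phi^y_N\in\mathbb R^{m^y_N\times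 N}$, with $N$ ranging over an infinite set of positive integers, is $\epsilon$-REP with measurement rate $(\rho_x,\rho_y)$ if for every such $N$ $$\limsup_{q\to\infty}\frac{H([X_1^N]_q,[Y_1^N]_q\mid\Phi^x_NX_1^N,\Phi^y_NY_1^N)}{H([X_1^N]_q,[Y_1^N]_q)}\le\epsilon$$ (a quotient $0/0$ being read as $0$), and $\limsup_{N\to\infty}m^x_N/N\le\rho_x$, $\limsup_{N\to\infty}m^y_N/N\le\rho_y$. Theorem. Let $(X_i,Y_i)_{i\ge1}$ be i.i.d. with $(X_1,Y_1)\in\mathcal L$. Then the limits $d(X_1,Y_1)$, $d(X_1\mid Y_1)$ and $d(Y_1\mid X_1)$ exist and are finite, and for all $\rho_x,\rho_y\ge0$ satisfying $$\rho_x\ge d(X_1\mid Y_1),\qquad \rho_y\ge d(Y_1\mid X_1),\qquad \rho_x+\rho_y\ge d(X_1,Y_1)$$ and every $\epsilon>0$ there is a family $\{\Phi^x_N,\Phi^y_N\}$ of partial Hadamard matrices, indexed by all $N=2^n$, $n\ge0$, that is $\epsilon$-REP with measurement rate $(\rho_x,\rho_y)$. -/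

import Mathlib

open MeasureTheory ProbabilityTheory Filter Topology
open scoped ENNReal NNReal

noncomputable section

namespace RenyiCompression

/-- The entropy in bits, `∑ₛ -μ{s} log₂ μ{s}`, of the point masses of `μ`, with values in `[0, ∞]`.
For a discrete probability measure this is its Shannon entropy. -/
def atomEntropy {α : Type*} [MeasurableSpace α] (μ : Measure α) : ℝ≥0∞ :=
  ∑' s : α, ENNReal.ofReal (Real.negMulLog (μ.real {s}) / Real.log 2)

/-- The entropy `H(V)` in bits of a discrete random element `V`. -/
def entropy {Ω α : Type*} [MeasurableSpace Ω] [MeasurableSpace α]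
    (P : Measure Ω) (V : Ω → α) : ℝ≥0∞ :=
  atomEntropy (P.map V)

/-- The conditional entropy `H(V | W) = 𝔼_W H(V | W = w)` in bits of a discrete random element `V`
given an arbitrary random element `W`, through the regular conditional law of `V` given `W`. -/
def condEntropy {Ω α β : Type*} [MeasurableSpace Ω] [MeasurableSpace α] [MeasurableSpace β]
    [StandardBorelSpace α] [Nonempty α]
    (P : Measure Ω) [IsFiniteMeasure P] (V : Ω → α) (W : Ω → β) : ℝ≥0∞ :=
  ∫⁻ w, atomEntropy (condDistrib V W P w) ∂(P.map W)

/-- The componentwise uniform quantization `[x]_q = ⌊q x⌋ / q`. -/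
def quant {ι : Type*} (q : ℕ) (x : ι → ℝ) : ι → ℝ :=
  fun i => (⌊(q : ℝ) * x i⌋ : ℝ) / (q : ℝ)

/-- `d(V) = d`: the limit `lim_{q → ∞} H([V]_q) / log₂ q` exists and equals `d`. -/
def HasRID {Ω ι : Type*} [MeasurableSpace Ω]
    (P : Measure Ω) (V : Ω → ι → ℝ) (d : ℝ≥0) : Prop :=
  Tendsto (fun q : ℕ => entropy P (fun ω => quant q (V ω)) / ENNReal.ofReal (Real.logb 2 q))
    atTop (𝓝 (d : ℝ≥0∞))

/-- `d(V | W) = d`: the limit `lim_{q → ∞} H([V]_q | W) / log₂ q` exists and equals `d`. -/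
def HasCondRID {Ω ι κ : Type*} [Countable ι] [MeasurableSpace Ω]
    (P : Measure Ω) [IsFiniteMeasure P] (V : Ω → ι → ℝ) (W : Ω → κ → ℝ) (d : ℝ≥0) : Prop :=
  Tendsto (fun q : ℕ =>
      condEntropy P (fun ω => quant q (V ω)) W / ENNReal.ofReal (Real.logb 2 q))
    atTop (𝓝 (d : ℝ≥0∞))

/-- The one-dimensional building blocks: probability laws `ν = δ p_c + (1 - δ) p_d` on `ℝ` with
`p_c` absolutely continuous and `p_d` discrete (no singular part), with finite second moment, and
whose discrete part has finite entropy.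
(`atomEntropy ν = (1 - δ) H(p_d) - (1 - δ) log₂ (1 - δ)` is finite iff `H(p_d)` is, or `δ = 1`.) -/
structure IsNonsingularLaw (ν : Measure ℝ) : Prop where
  prob : IsProbabilityMeasure ν
  nonsingular : ∃ S : Set ℝ, S.Countable ∧ ν.restrict Sᶜ ≪ volume
  secondMoment : MemLp (fun x : ℝ => x) 2 ν
  discreteEntropy : atomEntropy ν ≠ ∞

/-- The space `𝓛_n`: `V` is distributed as `A Z` for a real matrix `A` and a finite family
`Z = (Z₁, …, Z_k)` of independent nonsingular random variables, `Z_j` having law `ν j`.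
Only the law of `V` matters, so that `Z` need not live on the same probability space. -/
def MemL {Ω : Type*} [MeasurableSpace Ω] {n : ℕ} (P : Measure Ω) (V : Ω → Fin n → ℝ) : Prop :=
  ∃ (k : ℕ) (A : Matrix (Fin n) (Fin k) ℝ) (ν : Fin k → Measure ℝ),
    (∀ j, IsNonsingularLaw (ν j)) ∧
      P.map V = (Measure.pi ν).map (fun z => A.mulVec z)

/-- A two-terminal memoryless source: the pairs `(X i, Y i)`, `i ∈ ℕ`, are i.i.d. -/
structure IsMemorylessSource {Ω : Type*} [MeasurableSpace Ω] (P : Measure Ω)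
    (X Y : ℕ → Ω → ℝ) : Prop where
  measurable_fst : ∀ i, Measurable (X i)
  measurable_snd : ∀ i, Measurable (Y i)
  indep : iIndepFun (fun i ω => (X i ω, Y i ω)) P
  identDistrib : ∀ i, IdentDistrib (fun ω => (X i ω, Y i ω)) (fun ω => (X 0 ω, Y 0 ω)) P P

/-- The block consisting of the first `N` variables of a sequence, as a random vector. -/
def block {Ω : Type*} (X : ℕ → Ω → ℝ) (N : ℕ) (ω : Ω) : Fin N → ℝ :=
  fun i => X i ω

/-- The Hadamard matrix of order `2 ^ n`: `H_1 = (1)` and `H_{2N} = (H_N, H_N; H_N, -H_N)`. -/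
def hadamard : (n : ℕ) → Matrix (Fin (2 ^ n)) (Fin (2 ^ n)) ℝ
  | 0 => fun _ _ => 1
  | n + 1 =>
    let e : Fin (2 ^ n) ⊕ Fin (2 ^ n) ≃ Fin (2 ^ (n + 1)) :=
      finSumFinEquiv.trans (finCongr (by rw [pow_succ, mul_two]))
    Matrix.reindex e e
      (Matrix.fromBlocks (hadamard n) (hadamard n) (hadamard n) (-hadamard n))

/-- `Φ` consists of `m` distinct rows of the Hadamard matrix of order `2 ^ n`, in their order. -/
def IsPartialHadamard {n m : ℕ} (Φ : Matrix (Fin m) (Fin (2 ^ n)) ℝ) : Prop :=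
  ∃ r : Fin m ↪o Fin (2 ^ n), Φ = (hadamard n).submatrix r id

/-- The family of distributed measurement matrices `(Φx n, Φy n)`, of dimensions `mx n × N n` and
`my n × N n` for block lengths `N 0 < N 1 < ⋯`, is `ε`-REP for the source `(X, Y)` with the
measurement rate `(ρx, ρy)`. -/
structure IsREP {Ω : Type*} [MeasurableSpace Ω] (P : Measure Ω) [IsFiniteMeasure P]
    (X Y : ℕ → Ω → ℝ) (ε : ℝ) (ρx ρy : ℝ≥0) (N mx my : ℕ → ℕ)
    (Φx : ∀ n, Matrix (Fin (mx n)) (Fin (N n)) ℝ)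
    (Φy : ∀ n, Matrix (Fin (my n)) (Fin (N n)) ℝ) : Prop where
  strictMono : StrictMono N
  entropy_ratio : ∀ n,
    limsup (fun q : ℕ =>
      condEntropy P
          (fun ω => (quant q (block X (N n) ω), quant q (block Y (N n) ω)))
          (fun ω => ((Φx n).mulVec (block X (N n) ω), (Φy n).mulVec (block Y (N n) ω))) /
        entropy P (fun ω => (quant q (block X (N n) ω), quant q (block Y (N n) ω))))
      atTop ≤ ENNReal.ofReal ε
  rate_fst : limsup (fun n => (mx n : ℝ≥0∞) / (N n : ℝ≥0∞)) atTop ≤ (ρx : ℝ≥0∞)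
  rate_snd : limsup (fun n => (my n : ℝ≥0∞) / (N n : ℝ≥0∞)) atTop ≤ (ρy : ℝ≥0∞)

end RenyiCompression

end

/-! Write the source as a linear image `A Z`. Label each coordinate of `Z` by its value when that
value lies in a countable exceptional set, and by `0` otherwise. Given the label, the coordinates
with nonzero label are known and the others are jointly absolutely continuous. Hence, given the
label and a linear measurement `F Z`, the vector `B Z` ranges over a translate of a subspace, the
image under `B` of the vectors of `ker F` supported on the free coordinates. Quantizing it at scale
`1/q` costs `log₂ q` bits per dimension up to lower order. The label has finite entropy and so costs
`O(1)`. Therefore `d(BZ | FZ)` is the expected dimension of this random subspace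
(`tendsto_condEntropy_floorVec`): the upper bound is an explicit code, the lower bound is absolute
continuity of conditional laws together with Fatou. Compression thus becomes a question about
expected ranks for i.i.d. letters from a finite alphabet, the sets of free coordinates.

For the rank question, process the Hadamard rows of both terminals in some order and call a row
innovative if the earlier ones do not determine it. Doubling the block replaces a row by a sum and a
difference of two independent copies. The sum is innovative iff one of the copies is, the difference
iff both are. The probabilities of innovation obey `x ↦ 2x - x²` and `x ↦ x²`, the recursion of the
erasure channel: the mean per terminal is preserved and the values polarize to `0` and `1`. Keeping
the rows with values near `1` costs a rate equal to the mean and leaves few dimensions open.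
Processing one terminal before the other gives the corner points of the Slepian–Wolf region, and
orders interpolating between the two corners reach the points in between (`exists_rows`).

If `d(X,Y) > 0`, numerator and denominator of the REP quotient both grow like `log q`, and ranks
decide. If `d(X,Y) = 0`, both terminals are discrete with finite entropy, and ranks say nothing. A
vanishing fraction of rows then suffices, because almost all conditional row entropies tend to `0`
(`tendsto_card_rowEntropy`). The reason is that adding an independent real variable of definite
entropy raises the entropy by a definite amount (`exists_entropy_gain`): otherwise the law would be
nearly invariant under a nonzero shift, which would produce too many large atoms. Hence row
entropies cannot stay in a compact subset of `(0, ∞)`, and Markov's inequality excludes large ones.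
Infinite alphabets are truncated, with a tail of small entropy. -/

noncomputable section

set_option linter.unusedSectionVars false

/-! ### Entropy of discrete variables as expected code length -/

namespace RenyiCompression

/-- `-log₂ p` for `p ∈ [0, 1]`, with values in `[0, ∞]`. -/
def infoContent (p : ℝ≥0∞) : ℝ≥0∞ :=
  if p = 0 then ∞ else ENNReal.ofReal (-Real.log p.toReal / Real.log 2)

/-- `-p log₂ p`. -/
def entTerm (p : ℝ≥0∞) : ℝ≥0∞ := ENNReal.ofReal (Real.negMulLog p.toReal / Real.log 2)

lemma log_two_pos : 0 < Real.log 2 := Real.log_pos one_lt_two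

lemma measurable_infoContent : Measurable infoContent := by
  unfold infoContent
  refine Measurable.ite (measurableSet_singleton 0) measurable_const ?_
  fun_prop

lemma measurable_entTerm : Measurable entTerm := by
  unfold entTerm
  refine ENNReal.measurable_ofReal.comp (Measurable.div_const ?_ _)
  exact Real.continuous_negMulLog.measurable.comp ENNReal.measurable_toReal

lemma mul_infoContent {p : ℝ≥0∞} (hp : p ≤ 1) : p * infoContent p = entTerm p := by
  unfold infoContent entTerm
  split_ifs with h
  · simp [h]
  · have hf : p ≠ ∞ := ne_top_of_le_ne_top ENNReal.one_ne_top hp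
    conv_lhs => rw [← ENNReal.ofReal_toReal hf]
    rw [ENNReal.toReal_ofReal ENNReal.toReal_nonneg, ← ENNReal.ofReal_mul ENNReal.toReal_nonneg,
      Real.negMulLog]
    congr 1; ring

lemma infoContent_zero : infoContent 0 = ∞ := by simp [infoContent]

lemma infoContent_one : infoContent 1 = 0 := by simp [infoContent]

lemma entTerm_zero : entTerm 0 = 0 := by simp [entTerm]

lemma infoContent_mul {x y : ℝ≥0∞} (hx : x ≤ 1) (hy : y ≤ 1) :
    infoContent (x * y) = infoContent x + infoContent y := by
  unfold infoContent
  by_cases h1 : x = 0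
  · simp [h1]
  by_cases h2 : y = 0
  · simp [h2]
  have hx1 : x ≠ ∞ := ne_top_of_le_ne_top ENNReal.one_ne_top hx
  have hy1 : y ≠ ∞ := ne_top_of_le_ne_top ENNReal.one_ne_top hy
  have hx0 : 0 < x.toReal := ENNReal.toReal_pos h1 hx1
  have hy0 : 0 < y.toReal := ENNReal.toReal_pos h2 hy1
  have hxl : Real.log x.toReal ≤ 0 := Real.log_nonpos hx0.le (by
    simpa using ENNReal.toReal_mono ENNReal.one_ne_top hx)
  have hyl : Real.log y.toReal ≤ 0 := Real.log_nonpos hy0.le (by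
    simpa using ENNReal.toReal_mono ENNReal.one_ne_top hy)
  rw [if_neg (mul_ne_zero h1 h2), if_neg h1, if_neg h2, ← ENNReal.ofReal_add
    (div_nonneg (by linarith) log_two_pos.le) (div_nonneg (by linarith) log_two_pos.le),
    ENNReal.toReal_mul, Real.log_mul hx0.ne' hy0.ne']
  congr 1; ring

lemma infoContent_anti {x y : ℝ≥0∞} (hxy : x ≤ y) (hy : y ≤ 1) :
    infoContent y ≤ infoContent x := by
  unfold infoContent
  by_cases h1 : x = 0
  · simp [h1]
  have hy1 : y ≠ ∞ := ne_top_of_le_ne_top ENNReal.one_ne_top hy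
  have hx1 : x ≠ ∞ := ne_top_of_le_ne_top hy1 hxy
  have h2 : y ≠ 0 := fun h => h1 (le_antisymm (h ▸ hxy) zero_le)
  rw [if_neg h1, if_neg h2]
  refine ENNReal.ofReal_le_ofReal (div_le_div_of_nonneg_right ?_ log_two_pos.le)
  exact neg_le_neg (Real.log_le_log (ENNReal.toReal_pos h1 hx1) (ENNReal.toReal_mono hy1 hxy))

lemma infoContent_prod {ι : Type*} (s : Finset ι) (f : ι → ℝ≥0∞) (hf : ∀ i ∈ s, f i ≤ 1) :
    infoContent (∏ i ∈ s, f i) = ∑ i ∈ s, infoContent (f i) := by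
  classical
  induction s using Finset.induction_on with
  | empty => simp [infoContent_one]
  | insert a s ha ih =>
    rw [Finset.prod_insert ha, Finset.sum_insert ha, infoContent_mul (hf a (by simp)) ?_,
      ih fun i hi => hf i (by simp [hi])]
    exact Finset.prod_le_one' fun i hi => hf i (by simp [hi])

/-- The Gibbs inequality for a single term. -/
lemma entTerm_add_le {x y : ℝ≥0∞} (hx : x ≤ 1) (hy : y ≤ 1) :
    entTerm x + x * ENNReal.ofReal (1 / Real.log 2) ≤
      x * infoContent y + y * ENNReal.ofReal (1 / Real.log 2) := by
  by_cases h1 : x = 0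
  · simp [h1, entTerm_zero]
  by_cases h2 : y = 0
  · simp [h2, infoContent_zero, ENNReal.mul_top h1]
  have hx1 : x ≠ ∞ := ne_top_of_le_ne_top ENNReal.one_ne_top hx
  have hy1 : y ≠ ∞ := ne_top_of_le_ne_top ENNReal.one_ne_top hy
  have hx0 : 0 < x.toReal := ENNReal.toReal_pos h1 hx1
  have hy0 : 0 < y.toReal := ENNReal.toReal_pos h2 hy1
  have hy2 : y.toReal ≤ 1 := by simpa using ENNReal.toReal_mono ENNReal.one_ne_top hy
  have hx2 : x.toReal ≤ 1 := by simpa using ENNReal.toReal_mono ENNReal.one_ne_top hx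
  have hyl : Real.log y.toReal ≤ 0 := Real.log_nonpos hy0.le hy2
  have key : Real.negMulLog x.toReal + x.toReal ≤
      x.toReal * (-Real.log y.toReal) + y.toReal := by
    have := Real.log_le_sub_one_of_pos (div_pos hy0 hx0)
    rw [Real.log_div hy0.ne' hx0.ne'] at this
    have h3 := mul_le_mul_of_nonneg_left this hx0.le
    have h4 : x.toReal * (y.toReal / x.toReal - 1) = y.toReal - x.toReal := by field_simp
    rw [h4] at h3
    unfold Real.negMulLog
    linarith
  unfold entTerm infoContent
  rw [if_neg h2]
  conv_lhs => enter [2, 1]; rw [← ENNReal.ofReal_toReal hx1]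
  conv_rhs => enter [1, 1]; rw [← ENNReal.ofReal_toReal hx1]
  conv_rhs => enter [2, 1]; rw [← ENNReal.ofReal_toReal hy1]
  have hl := log_two_pos
  rw [← ENNReal.ofReal_mul hx0.le, ← ENNReal.ofReal_mul hx0.le, ← ENNReal.ofReal_mul hy0.le,
    ← ENNReal.ofReal_add (div_nonneg (Real.negMulLog_nonneg hx0.le hx2) hl.le) (by positivity),
    ← ENNReal.ofReal_add (mul_nonneg hx0.le (div_nonneg (by linarith) hl.le)) (by positivity)]
  refine ENNReal.ofReal_le_ofReal ?_
  have := div_le_div_of_nonneg_right key hl.le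
  calc _ = (Real.negMulLog x.toReal + x.toReal) / Real.log 2 := by ring
    _ ≤ _ := this
    _ = _ := by ring

lemma entTerm_ne_top (p : ℝ≥0∞) : entTerm p ≠ ∞ := ENNReal.ofReal_ne_top

lemma atomEntropy_eq {α : Type*} [MeasurableSpace α] (μ : Measure α) :
    atomEntropy μ = ∑' s, entTerm (μ {s}) := rfl

/-- Gibbs' inequality for a countable alphabet. -/
lemma atomEntropy_le_tsum {α : Type*} [MeasurableSpace α] [Countable α]
    [MeasurableSingletonClass α] (μ : Measure α) [IsProbabilityMeasure μ] (y : α → ℝ≥0∞)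
    (hy : ∑' a, y a ≤ 1) : atomEntropy μ ≤ ∑' a, μ {a} * infoContent (y a) := by
  set c := ENNReal.ofReal (1 / Real.log 2)
  have h1 : ∑' a, μ {a} = 1 := by
    have := lintegral_countable' (μ := μ) (fun _ => (1 : ℝ≥0∞))
    simpa using this.symm
  -- Summing the single-term inequality leaves the total masses `1` and `∑ y ≤ 1`, weighted by `c`.
  -- Both are kept on the side of addition, since subtraction in `[0, ∞]` is lossy; the finite `c`
  -- is cancelled at the end.
  have h : atomEntropy μ + 1 * c ≤ (∑' a, μ {a} * infoContent (y a)) + 1 * c := by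
    calc atomEntropy μ + 1 * c = ∑' a, (entTerm (μ {a}) + μ {a} * c) := by
          rw [ENNReal.tsum_add, ENNReal.tsum_mul_right, h1, atomEntropy_eq]
      _ ≤ ∑' a, (μ {a} * infoContent (y a) + y a * c) :=
          ENNReal.tsum_le_tsum fun a => entTerm_add_le prob_le_one
            ((ENNReal.le_tsum a).trans hy)
      _ ≤ _ := by
          rw [ENNReal.tsum_add, ENNReal.tsum_mul_right]
          gcongr
  exact (ENNReal.add_le_add_iff_right (by simp [c])).1 h

section Cond

variable {Ω α β : Type*} [MeasurableSpace Ω] [MeasurableSpace α] [MeasurableSpace β]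
  {P : Measure Ω} [IsProbabilityMeasure P]

section

variable [StandardBorelSpace α] [Nonempty α]

lemma lintegral_comp_condDistrib {V : Ω → α} {W : Ω → β} (hV : Measurable V) (hW : Measurable W)
    {G : β × α → ℝ≥0∞} (hG : Measurable G) :
    ∫⁻ ω, G (W ω, V ω) ∂P = ∫⁻ ω, ∫⁻ a, G (W ω, a) ∂(condDistrib V W P (W ω)) ∂P := by
  have h := compProd_map_condDistrib (mβ := inferInstance) (X := W) (μ := P) hV.aemeasurable
  have h1 : ∫⁻ ω, G (W ω, V ω) ∂P = ∫⁻ x, G x ∂(P.map fun ω => (W ω, V ω)) := by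
    rw [lintegral_map hG (hW.prodMk hV)]
  rw [h1, ← h, Measure.lintegral_compProd hG,
    lintegral_map (Measurable.lintegral_kernel_prod_right' hG) hW]

lemma condEntropy_eq_lintegral_atomEntropy {V : Ω → α} {W : Ω → β} [Countable α]
    [MeasurableSingletonClass α] (hW : Measurable W) :
    condEntropy P V W = ∫⁻ ω, atomEntropy (condDistrib V W P (W ω)) ∂P := by
  unfold condEntropy
  rw [lintegral_map _ hW]
  refine Measurable.tsum fun a => ?_
  exact measurable_entTerm.comp (Kernel.measurable_coe _ (measurableSet_singleton a))

/-- The conditional entropy only depends on the joint law. -/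
lemma condEntropy_congr_law {Ω' : Type*} [MeasurableSpace Ω'] {P' : Measure Ω'}
    [IsProbabilityMeasure P'] {V : Ω → α} {W : Ω → β} {V' : Ω' → α} {W' : Ω' → β}
    (hV : AEMeasurable V P) (hV' : AEMeasurable V' P')
    (h : P.map (fun ω => (W ω, V ω)) = P'.map (fun ω => (W' ω, V' ω))) :
    condEntropy P V W = condEntropy P' V' W' := by
  unfold condEntropy
  have h1 : condDistrib V W P = condDistrib V' W' P' := by
    rw [condDistrib, condDistrib]; congr 1
  have h2 : P.map W = P'.map W' := by
    rw [← Measure.fst_map_prodMk₀ hV, ← Measure.fst_map_prodMk₀ hV', h]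
  rw [h1, h2]

end

variable [Countable α] [MeasurableSingletonClass α] [Nonempty α]

lemma measurable_condDistrib_pair (V : Ω → α) (W : Ω → β) :
    Measurable fun x : β × α => condDistrib V W P x.1 {x.2} :=
  measurable_from_prod_countable_left fun a =>
    Kernel.measurable_coe _ (measurableSet_singleton a)

/-- The conditional entropy is the expected ideal code length. -/
lemma condEntropy_eq_lintegral_infoContent {V : Ω → α} {W : Ω → β} (hV : Measurable V)
    (hW : Measurable W) :
    condEntropy P V W = ∫⁻ ω, infoContent (condDistrib V W P (W ω) {V ω}) ∂P := by
  rw [lintegral_comp_condDistrib hV hW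
    (G := fun x => infoContent (condDistrib V W P x.1 {x.2}))
    (measurable_infoContent.comp (measurable_condDistrib_pair V W)),
    condEntropy_eq_lintegral_atomEntropy hW]
  refine lintegral_congr fun ω => ?_
  rw [lintegral_countable', atomEntropy_eq]
  refine tsum_congr fun a => ?_
  rw [mul_comm, mul_infoContent prob_le_one]

lemma entropy_eq_lintegral_infoContent {V : Ω → α} (hV : Measurable V) :
    entropy P V = ∫⁻ ω, infoContent (P.map V {V ω}) ∂P := by
  have : IsProbabilityMeasure (P.map V) := Measure.isProbabilityMeasure_map hV.aemeasurable
  rw [entropy, ← lintegral_map (f := fun a => infoContent (P.map V {a})) _ hV,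
    lintegral_countable', atomEntropy_eq]
  · refine tsum_congr fun a => ?_
    rw [mul_comm, mul_infoContent prob_le_one]
  · exact measurable_of_countable _

/-- Coding with any subprobability kernel bounds the conditional entropy. -/
lemma condEntropy_le_lintegral {V : Ω → α} {W : Ω → β} (hV : Measurable V) (hW : Measurable W)
    (y : β × α → ℝ≥0∞) (hy : Measurable y) (hy1 : ∀ w, ∑' a, y (w, a) ≤ 1) :
    condEntropy P V W ≤ ∫⁻ ω, infoContent (y (W ω, V ω)) ∂P := by
  rw [lintegral_comp_condDistrib hV hW (G := fun x => infoContent (y x))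
    (measurable_infoContent.comp hy), condEntropy_eq_lintegral_atomEntropy hW]
  refine lintegral_mono fun ω => ?_
  simp only
  rw [lintegral_countable']
  refine (atomEntropy_le_tsum _ (fun a => y (W ω, a)) (hy1 _)).trans_eq ?_
  exact tsum_congr fun a => mul_comm _ _

lemma tsum_measure_singleton (μ : Measure α) [IsProbabilityMeasure μ] : ∑' a, μ {a} = 1 := by
  have := lintegral_countable' (μ := μ) (fun _ => (1 : ℝ≥0∞))
  simpa using this.symm

/-- Conditioning on less information increases the entropy. -/
lemma condEntropy_le_comp {γ : Type*} [MeasurableSpace γ] {V : Ω → α} {W : Ω → β}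
    (hV : Measurable V) (hW : Measurable W) {φ : β → γ} (hφ : Measurable φ) :
    condEntropy P V W ≤ condEntropy P V (fun ω => φ (W ω)) := by
  rw [condEntropy_eq_lintegral_infoContent (W := fun ω => φ (W ω)) hV (hφ.comp hW)]
  refine condEntropy_le_lintegral hV hW
    (fun x => condDistrib V (fun ω => φ (W ω)) P (φ x.1) {x.2}) ?_ fun w => ?_
  · exact (measurable_condDistrib_pair V _).comp
      ((hφ.comp measurable_fst).prodMk measurable_snd)
  · exact (tsum_measure_singleton (condDistrib V (fun ω => φ (W ω)) P (φ w))).le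

lemma condEntropy_le_entropy {V : Ω → α} {W : Ω → β} (hV : Measurable V) (hW : Measurable W) :
    condEntropy P V W ≤ entropy P V := by
  have : IsProbabilityMeasure (P.map V) := Measure.isProbabilityMeasure_map hV.aemeasurable
  rw [entropy_eq_lintegral_infoContent hV]
  refine condEntropy_le_lintegral hV hW (fun x => P.map V {x.2}) ?_ fun w => ?_
  · exact (measurable_of_countable (fun a => P.map V {a})).comp measurable_snd
  · exact (tsum_measure_singleton (P.map V)).le

lemma condEntropy_const_right {V : Ω → α} (hV : Measurable V) (b : β) :
    condEntropy P V (fun _ => b) = entropy P V := by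
  have h := condDistrib_comp_map (X := fun _ : Ω => b) (Y := V) (μ := P) (by fun_prop)
    hV.aemeasurable
  have hm : P.map (fun _ : Ω => b) = Measure.dirac b := by simp
  rw [hm, Measure.dirac_bind (Kernel.measurable _)] at h
  rw [condEntropy_eq_lintegral_atomEntropy measurable_const, entropy, ← h]
  simp

variable {α' : Type*} [MeasurableSpace α']

/-- A function of `V` has less entropy. -/
lemma condEntropy_comp_le [Countable α'] [MeasurableSingletonClass α'] [Nonempty α']
    {V : Ω → α} {W : Ω → β}
    (hV : Measurable V) (hW : Measurable W) (g : α → α') :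
    condEntropy P (fun ω => g (V ω)) W ≤ condEntropy P V W := by
  have hg : Measurable g := measurable_of_countable g
  rw [condEntropy_eq_lintegral_infoContent hV hW,
    condEntropy_eq_lintegral_infoContent (V := fun ω => g (V ω)) (hg.comp hV) hW]
  have h := condDistrib_comp (mβ := inferInstance) (μ := P) W hV.aemeasurable hg
  have h' := ae_of_ae_map hW.aemeasurable h
  refine lintegral_mono_ae ?_
  filter_upwards [h'] with ω hω
  refine infoContent_anti ?_ prob_le_one
  have : condDistrib (fun ω => g (V ω)) W P (W ω) {g (V ω)} =
      condDistrib V W P (W ω) (g ⁻¹' {g (V ω)}) := by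
    change condDistrib (g ∘ V) W P (W ω) _ = _
    rw [hω, Kernel.map_apply' _ hg _ (measurableSet_singleton _)]
  rw [this]
  exact measure_mono (by simp)

lemma atomEntropy_map_injective [MeasurableSingletonClass α'] (μ : Measure α) {g : α → α'}
    (hg : Function.Injective g) : atomEntropy (μ.map g) = atomEntropy μ := by
  have hm : Measurable g := measurable_of_countable g
  rw [atomEntropy_eq, atomEntropy_eq]
  have h : ∀ a, entTerm (μ {a}) = entTerm (μ.map g {g a}) := fun a => by
    rw [Measure.map_apply hm (measurableSet_singleton _)]
    congr 2
    ext x; simp [hg.eq_iff]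
  simp_rw [h]
  refine (hg.tsum_eq (f := fun s => entTerm (μ.map g {s})) fun s hs => ?_).symm
  by_contra hne
  refine hs ?_
  have : g ⁻¹' {s} = ∅ := by
    ext x; simp only [Set.mem_preimage, Set.mem_singleton_iff, Set.mem_empty_iff_false, iff_false]
    exact fun h => hne ⟨x, h⟩
  simp only
  rw [Measure.map_apply hm (measurableSet_singleton _), this]
  simp [entTerm_zero]

lemma entropy_comp_injective [MeasurableSingletonClass α'] {V : Ω → α} (hV : Measurable V)
    {g : α → α'} (hg : Function.Injective g) :
    entropy P (fun ω => g (V ω)) = entropy P V := by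
  have hm : Measurable g := measurable_of_countable g
  unfold entropy
  rw [← atomEntropy_map_injective (P.map V) hg, Measure.map_map hm hV]
  rfl

lemma condEntropy_comp_injective [StandardBorelSpace α'] [Nonempty α'] {V : Ω → α} {W : Ω → β}
    (hV : Measurable V) {g : α → α'} (hg : Function.Injective g) :
    condEntropy P (fun ω => g (V ω)) W = condEntropy P V W := by
  have hm : Measurable g := measurable_of_countable g
  unfold condEntropy
  refine lintegral_congr_ae ?_
  filter_upwards [condDistrib_comp (μ := P) W hV.aemeasurable hm] with w hw
  change atomEntropy (condDistrib (g ∘ V) W P w) = _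
  rw [hw, Kernel.map_apply _ hm, atomEntropy_map_injective _ hg]

variable {δ : Type*} [MeasurableSpace δ] [Countable δ] [MeasurableSingletonClass δ] [Nonempty δ]

/-- Uniqueness of disintegration: composing either kernel with the law of `W` gives the joint law of
`(W, D, V)`. Evaluated at points, this factorization is the chain rule. -/
lemma condDistrib_prodMk_ae_eq {D : Ω → δ} {V : Ω → α} {W : Ω → β} (hD : Measurable D)
    (hV : Measurable V) (hW : Measurable W) :
    condDistrib (fun ω => (D ω, V ω)) W P =ᵐ[P.map W]
      (condDistrib D W P) ⊗ₖ (condDistrib V (fun ω => (W ω, D ω)) P) := by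
  refine condDistrib_ae_eq_of_measure_eq_compProd W (hD.prodMk hV).aemeasurable ?_
  have h1 := compProd_map_condDistrib (mβ := inferInstance) (X := W) (μ := P) hD.aemeasurable
  have h2 := compProd_map_condDistrib (mβ := inferInstance) (X := fun ω => (W ω, D ω)) (μ := P) hV.aemeasurable
  rw [← h1] at h2
  rw [← Measure.compProd_assoc', h2, Measure.map_map (by fun_prop) (by fun_prop)]
  rfl

/-- The chain rule. -/
lemma condEntropy_prodMk {D : Ω → δ} {V : Ω → α} {W : Ω → β} (hD : Measurable D)
    (hV : Measurable V) (hW : Measurable W) :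
    condEntropy P (fun ω => (D ω, V ω)) W =
      condEntropy P D W + condEntropy P V (fun ω => (W ω, D ω)) := by
  rw [condEntropy_eq_lintegral_infoContent (hD.prodMk hV) hW,
    condEntropy_eq_lintegral_infoContent hD hW,
    condEntropy_eq_lintegral_infoContent hV (hW.prodMk hD), ← lintegral_add_left]
  · have h := ae_of_ae_map hW.aemeasurable (condDistrib_prodMk_ae_eq (P := P) hD hV hW)
    refine lintegral_congr_ae ?_
    filter_upwards [h] with ω hω
    rw [hω, ← Set.singleton_prod_singleton, Kernel.compProd_apply_prod
      (measurableSet_singleton _) (measurableSet_singleton _), lintegral_singleton, mul_comm,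
      infoContent_mul prob_le_one prob_le_one]
  · exact measurable_infoContent.comp ((measurable_condDistrib_pair D W).comp (hW.prodMk hD))

/-- Applied with `D` the label of a mixed vector: revealing a variable of finite entropy changes a
conditional entropy by `O(1)`, which disappears after division by `log₂ q`. -/
lemma condEntropy_le_add {D : Ω → δ} {V : Ω → α} {W : Ω → β} (hD : Measurable D)
    (hV : Measurable V) (hW : Measurable W) :
    condEntropy P V W ≤ entropy P D + condEntropy P V (fun ω => (W ω, D ω)) := by
  calc condEntropy P V W ≤ condEntropy P (fun ω => (D ω, V ω)) W :=
        condEntropy_comp_le (hD.prodMk hV) hW Prod.snd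
    _ = _ := condEntropy_prodMk hD hV hW
    _ ≤ _ := by gcongr; exact condEntropy_le_entropy hD hW

lemma condEntropy_prodMk_le {D : Ω → δ} {V : Ω → α} {W : Ω → β} (hD : Measurable D)
    (hV : Measurable V) (hW : Measurable W) :
    condEntropy P (fun ω => (D ω, V ω)) W ≤ condEntropy P D W + condEntropy P V W := by
  rw [condEntropy_prodMk hD hV hW]
  gcongr
  exact condEntropy_le_comp hV (hW.prodMk hD) measurable_fst

end Cond

end RenyiCompression

/-! ### Residual subspaces, and entropy of quantized absolutely continuous laws -/

namespace RenyiCompression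

section LinearAlgebra

variable {ι κ E : Type*} [Fintype ι] [Fintype κ] [AddCommGroup E] [Module ℝ E]

/-- Some set of coordinates restricts to a linear isomorphism on a given subspace. -/
lemma exists_coordinates (Q : Submodule ℝ (ι → ℝ)) :
    ∃ J : Finset ι, J.card = Module.finrank ℝ Q ∧
      (∀ u ∈ Q, (∀ j ∈ J, u j = 0) → u = 0) ∧
      ∀ t : J → ℝ, ∃ u ∈ Q, ∀ j : J, u j = t j := by
  classical
  let p : Finset ι → Prop := fun J => ∀ u ∈ Q, (∀ j ∈ J, u j = 0) → u = 0
  have hne : (Finset.univ.filter p).Nonempty :=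
    ⟨Finset.univ, by simp only [Finset.mem_filter, Finset.mem_univ, true_and]
                     exact fun u _ h => funext fun j => h j (Finset.mem_univ j)⟩
  -- Take a smallest set of coordinates that separates the points of `Q`. Minimality gives, for each
  -- `j ∈ J`, a vector of `Q` that vanishes on the rest of `J` but not at `j`. These vectors form a
  -- dual basis.
  obtain ⟨J, hJ, hmin⟩ := Finset.exists_min_image _ Finset.card hne
  have hJp : p J := (Finset.mem_filter.1 hJ).2
  have hv : ∀ j : J, ∃ v ∈ Q, v j = 1 ∧ ∀ i ∈ J, i ≠ j → v i = 0 := by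
    intro j
    have hn : ¬ p (J.erase j) := fun h => by
      have := hmin (J.erase j) (by simp [h])
      have := Finset.card_erase_lt_of_mem j.2
      omega
    simp only [p, not_forall] at hn
    obtain ⟨v, hvQ, hv0, hne⟩ := hn
    have hvj : v j ≠ 0 := fun h => hne (hJp v hvQ fun i hi => by
      by_cases hij : i = j
      · rw [hij, h]
      · exact hv0 i (Finset.mem_erase.2 ⟨hij, hi⟩))
    refine ⟨(v j)⁻¹ • v, Q.smul_mem _ hvQ, by simp [hvj], fun i hi hij => ?_⟩
    simp [hv0 i (Finset.mem_erase.2 ⟨hij, hi⟩)]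
  choose v hvQ hv1 hv0 using hv
  have hsurj : ∀ t : J → ℝ, ∃ u ∈ Q, ∀ j : J, u j = t j := by
    intro t
    refine ⟨∑ j, t j • v j, Q.sum_mem fun j _ => Q.smul_mem _ (hvQ j), fun j => ?_⟩
    rw [Finset.sum_apply, Finset.sum_eq_single j]
    · simp [hv1]
    · intro i _ hij
      simp [hv0 i j j.2 (fun h => hij (Subtype.ext h.symm))]
    · simp
  refine ⟨J, ?_, hJp, hsurj⟩
  let g : Q →ₗ[ℝ] (J → ℝ) := (LinearMap.funLeft ℝ ℝ (Subtype.val : J → ι)).comp Q.subtype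
  have hg : Function.Bijective g := by
    constructor
    · rw [← LinearMap.ker_eq_bot, LinearMap.ker_eq_bot']
      intro u hu
      refine Subtype.ext (hJp u u.2 fun j hj => ?_)
      exact congrFun hu ⟨j, hj⟩
    · intro t
      obtain ⟨u, hu, hut⟩ := hsurj t
      exact ⟨⟨u, hu⟩, funext hut⟩
  have := (LinearEquiv.ofBijective g hg).finrank_eq
  rw [this]; simp

lemma exists_factor {V V₁ V₂ : Type*} [AddCommGroup V] [Module ℝ V] [AddCommGroup V₁]
    [Module ℝ V₁] [AddCommGroup V₂] [Module ℝ V₂] (f : V →ₗ[ℝ] V₁) (g : V →ₗ[ℝ] V₂)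
    (h : LinearMap.ker f ≤ LinearMap.ker g) : ∃ k : V₁ →ₗ[ℝ] V₂, ∀ x, k (f x) = g x := by
  obtain ⟨s, hs⟩ := f.rangeRestrict.exists_rightInverse_of_surjective f.range_rangeRestrict
  obtain ⟨k, hk⟩ := LinearMap.exists_extend (g.comp s)
  refine ⟨k, fun x => ?_⟩
  have h1 : k (f x) = g (s (f.rangeRestrict x)) := LinearMap.congr_fun hk (f.rangeRestrict x)
  have h2 : s (f.rangeRestrict x) - x ∈ LinearMap.ker f := by
    rw [LinearMap.mem_ker, map_sub, sub_eq_zero]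
    exact congrArg Subtype.val (LinearMap.congr_fun hs (f.rangeRestrict x))
  have h3 := h h2
  rw [LinearMap.mem_ker, map_sub, sub_eq_zero] at h3
  rw [h1, h3]

variable [DecidableEq κ]

/-- Extension by zero of a vector indexed by `C`. -/
def extendZero (C : Finset κ) : (C → ℝ) →ₗ[ℝ] (κ → ℝ) where
  toFun x j := if h : j ∈ C then x ⟨j, h⟩ else 0
  map_add' x y := by ext j; by_cases h : j ∈ C <;> simp [h]
  map_smul' a x := by ext j; by_cases h : j ∈ C <;> simp [h]

/-- The vectors `B z`, where `z` is supported in `C` and `F z = 0`. -/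
def residual (B : (κ → ℝ) →ₗ[ℝ] (ι → ℝ)) (F : (κ → ℝ) →ₗ[ℝ] E) (C : Finset κ) :
    Submodule ℝ (ι → ℝ) :=
  (LinearMap.ker (F.comp (extendZero C))).map (B.comp (extendZero C))

/-- A vector killed by `F` and by the coordinates in `J` has zero image under `B`, so `B` factors
through this pair. Linearity of the decoder matters: it turns rounding errors in `J` into bounded
errors everywhere. -/
lemma exists_reconstruction (B : (κ → ℝ) →ₗ[ℝ] (ι → ℝ)) (F : (κ → ℝ) →ₗ[ℝ] E) (C : Finset κ)
    {J : Finset ι} (hJ : ∀ u ∈ residual B F C, (∀ j ∈ J, u j = 0) → u = 0) :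
    ∃ k : (J → ℝ) × E →ₗ[ℝ] (ι → ℝ), ∀ x : C → ℝ,
      B (extendZero C x) = k (fun j => B (extendZero C x) j, F (extendZero C x)) := by
  let f : (C → ℝ) →ₗ[ℝ] (J → ℝ) × E :=
    ((LinearMap.funLeft ℝ ℝ (Subtype.val : J → ι)).comp (B.comp (extendZero C))).prod
      (F.comp (extendZero C))
  obtain ⟨k, hk⟩ := exists_factor f (B.comp (extendZero C)) (fun x hx => by
    have hx' := LinearMap.mem_ker.1 hx
    refine hJ _ ⟨x, ?_, rfl⟩ fun j hj => ?_
    · exact congrArg Prod.snd hx'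
    · exact congrFun (congrArg Prod.fst hx') ⟨j, hj⟩)
  exact ⟨k, fun x => (hk x).symm⟩

/-- Correct a preimage of the measurement by an element of `ker F` to reach any prescribed
`J`-coordinates. Surjectivity lets the `J`-coordinates stay absolutely continuous after conditioning
on the measurement. -/
lemma surjective_measurement (B : (κ → ℝ) →ₗ[ℝ] (ι → ℝ)) (F : (κ → ℝ) →ₗ[ℝ] E) (C : Finset κ)
    {J : Finset ι} (hJ : ∀ t : J → ℝ, ∃ u ∈ residual B F C, ∀ j : J, u j = t j) :
    Function.Surjective ((F.comp (extendZero C)).rangeRestrict.prod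
      ((LinearMap.funLeft ℝ ℝ (Subtype.val : J → ι)).comp (B.comp (extendZero C)))) := by
  rintro ⟨w, t⟩
  obtain ⟨x, hx⟩ := (F.comp (extendZero C)).surjective_rangeRestrict w
  obtain ⟨u, ⟨y, hy, rfl⟩, hut⟩ := hJ (fun j => t j - B (extendZero C x) j)
  refine ⟨x + y, Prod.ext ?_ (funext fun j => ?_)⟩
  · have : (F.comp (extendZero C)).rangeRestrict y = 0 := Subtype.ext hy
    change (F.comp (extendZero C)).rangeRestrict (x + y) = w
    rw [map_add, this, hx, add_zero]
  · have := hut j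
    simp only [LinearMap.comp_apply] at this
    change B (extendZero C (x + y)) j = t j
    rw [map_add, map_add, Pi.add_apply, this]
    ring

end LinearAlgebra

section Cells

variable {ι : Type*}

/-- The integer vector `⌊q x⌋`. -/
def floorVec (q : ℕ) (x : ι → ℝ) : ι → ℤ := fun i => ⌊(q : ℝ) * x i⌋

lemma measurable_floorVec (q : ℕ) : Measurable (floorVec (ι := ι) q) := by
  unfold floorVec
  exact measurable_pi_lambda _ fun i =>
    Int.measurable_floor.comp ((measurable_pi_apply i).const_mul _)

variable [Fintype ι]

lemma volume_floorVec_preimage {q : ℕ} (hq : 0 < q) (v : ι → ℤ) :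
    volume (floorVec q ⁻¹' {v}) = ((q : ℝ≥0∞)⁻¹) ^ Fintype.card ι := by
  have hq' : (0 : ℝ) < q := by exact_mod_cast hq
  have : floorVec q ⁻¹' {v} =
      Set.univ.pi fun i => Set.Ico ((v i : ℝ) / q) (((v i : ℝ) + 1) / q) := by
    ext x
    simp only [floorVec, Set.mem_preimage, Set.mem_singleton_iff, funext_iff, Int.floor_eq_iff,
      Set.mem_univ_pi, Set.mem_Ico, div_le_iff₀ hq', lt_div_iff₀ hq', mul_comm (q : ℝ)]
  rw [this, volume_pi_pi]
  simp_rw [Real.volume_Ico]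
  have h : ∀ i : ι, ((v i : ℝ) + 1) / q - (v i : ℝ) / q = (q : ℝ)⁻¹ := fun i => by
    field_simp; ring
  simp_rw [h]
  rw [Finset.prod_const, Finset.card_univ, ENNReal.ofReal_inv_of_pos hq', ENNReal.ofReal_natCast]

/-- The points whose quantization cell has mass larger than `c`. -/
def heavySet (μ : Measure (ι → ℝ)) (q : ℕ) (c : ℝ≥0∞) : Set (ι → ℝ) :=
  {x | c < μ (floorVec q ⁻¹' {floorVec q x})}

lemma measurableSet_heavySet (μ : Measure (ι → ℝ)) (q : ℕ) (c : ℝ≥0∞) :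
    MeasurableSet (heavySet μ q c) := by
  have : heavySet μ q c = floorVec q ⁻¹' {v | c < μ (floorVec q ⁻¹' {v})} := rfl
  rw [this]
  exact measurable_floorVec q (Set.to_countable _).measurableSet

/-- Fewer than `1/c` cells can have mass above `c`, and each has volume `q⁻ᵈ`. -/
lemma volume_heavySet_le (μ : Measure (ι → ℝ)) [IsProbabilityMeasure μ] {q : ℕ} (hq : 0 < q)
    {c : ℝ≥0∞} (hc : c ≠ 0) (hc' : c ≠ ∞) :
    volume (heavySet μ q c) ≤ c⁻¹ * ((q : ℝ≥0∞)⁻¹) ^ Fintype.card ι := by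
  have h : ∀ ν : Measure (ι → ℝ), ν (heavySet μ q c) =
      ∑' v : ι → ℤ, if c < μ (floorVec q ⁻¹' {v}) then ν (floorVec q ⁻¹' {v}) else 0 := by
    intro ν
    have h1 : heavySet μ q c = floorVec q ⁻¹' {v | c < μ (floorVec q ⁻¹' {v})} := rfl
    rw [h1, ← Measure.map_apply (measurable_floorVec q) (Set.to_countable _).measurableSet,
      ← Measure.tsum_indicator_apply_singleton _ _ (Set.to_countable _).measurableSet]
    refine tsum_congr fun v => ?_
    rw [Set.indicator_apply, Measure.map_apply (measurable_floorVec q)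
      (measurableSet_singleton _)]
    rfl
  have hone : ∑' v : ι → ℤ, μ (floorVec q ⁻¹' {v}) = 1 := by
    have : IsProbabilityMeasure (μ.map (floorVec q)) :=
      Measure.isProbabilityMeasure_map (measurable_floorVec q).aemeasurable
    rw [← tsum_measure_singleton (μ.map (floorVec q))]
    refine tsum_congr fun v => ?_
    rw [Measure.map_apply (measurable_floorVec q) (measurableSet_singleton _)]
  rw [h]
  calc _ ≤ ∑' v : ι → ℤ, μ (floorVec q ⁻¹' {v}) * (c⁻¹ * ((q : ℝ≥0∞)⁻¹) ^ Fintype.card ι) := by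
        refine ENNReal.tsum_le_tsum fun v => ?_
        split_ifs with hv
        · rw [volume_floorVec_preimage hq, ← mul_assoc]
          refine le_mul_of_one_le_left zero_le ?_
          rw [← div_eq_mul_inv, ENNReal.le_div_iff_mul_le (Or.inl hc) (Or.inl hc'), one_mul]
          exact hv.le
        · exact zero_le
    _ = _ := by rw [ENNReal.tsum_mul_right, hone, one_mul]

/-- The entropy of `⌊q u⌋` when `u` has law `m`. -/
def quantEntropy (q : ℕ) (m : Measure (ι → ℝ)) : ℝ≥0∞ := atomEntropy (m.map (floorVec q))

lemma quantEntropy_eq (q : ℕ) (m : Measure (ι → ℝ)) [IsProbabilityMeasure m] :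
    quantEntropy q m = ∫⁻ u, infoContent (m (floorVec q ⁻¹' {floorVec q u})) ∂m := by
  have := entropy_eq_lintegral_infoContent (P := m) (measurable_floorVec (ι := ι) q)
  rw [entropy] at this
  rw [quantEntropy, this]
  refine lintegral_congr fun u => ?_
  rw [Measure.map_apply (measurable_floorVec q) (measurableSet_singleton _)]

lemma infoContent_rpow {q : ℕ} (hq : 1 ≤ q) {t : ℝ} (ht : 0 ≤ t) :
    infoContent ((q : ℝ≥0∞) ^ (-t)) = ENNReal.ofReal t * ENNReal.ofReal (Real.logb 2 q) := by
  have hq0 : (0 : ℝ) < q := by exact_mod_cast hq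
  have hne : (q : ℝ≥0∞) ^ (-t) ≠ 0 := by
    simp only [ne_eq, ENNReal.rpow_eq_zero_iff]
    simp; omega
  rw [infoContent, if_neg hne, ← ENNReal.toReal_rpow, ENNReal.toReal_natCast,
    Real.log_rpow hq0, ← ENNReal.ofReal_mul ht, Real.logb]
  congr 1; ring

lemma tendsto_log_atTop :
    Tendsto (fun q : ℕ => ENNReal.ofReal (Real.logb 2 q)) atTop (𝓝 ∞) :=
  ENNReal.tendsto_ofReal_nhds_top.2
    ((Real.tendsto_logb_atTop one_lt_two).comp tendsto_natCast_atTop_atTop)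

/-- The lower bound `d ≥ |J|` for laws whose marginal on `J` is absolutely continuous. -/
lemma card_le_liminf_quantEntropy (m : Measure (ι → ℝ)) [IsProbabilityMeasure m] (J : Finset ι)
    (hJ : m.map (fun u (j : J) => u j) ≪ volume) :
    (J.card : ℝ≥0∞) ≤
      liminf (fun q : ℕ => quantEntropy q m / ENNReal.ofReal (Real.logb 2 q)) atTop := by
  set π : (ι → ℝ) → (J → ℝ) := fun u j => u j with hπ
  have hπm : Measurable π := by fun_prop
  set μ := m.map π with hμ
  have : IsProbabilityMeasure μ := Measure.isProbabilityMeasure_map hπm.aemeasurable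
  -- For `t < |J|`, the cells of mass above `q⁻ᵗ` have total volume at most `q^(t - |J|)`, which
  -- tends to `0`, so by absolute continuity their mass tends to `0`. Every other cell costs at
  -- least `t log₂ q` bits.
  refine le_of_forall_lt_imp_le_of_dense fun t ht => ?_
  lift t to ℝ≥0 using ne_top_of_lt ht
  have htJ : (t : ℝ) < J.card := by exact_mod_cast ht
  -- heavy cells have vanishing mass
  have hvol : Tendsto (fun q : ℕ => volume (heavySet μ q ((q : ℝ≥0∞) ^ (-(t : ℝ))))) atTop
      (𝓝 0) := by
    have h1 : Tendsto (fun q : ℕ => (q : ℝ≥0∞) ^ (-((J.card : ℝ) - t))) atTop (𝓝 0) := by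
      have := (ENNReal.tendsto_rpow_at_top (sub_pos.2 htJ)).comp ENNReal.tendsto_nat_nhds_top
      have h2 := tendsto_inv_iff.2 this
      simp only [ENNReal.inv_top] at h2
      exact h2.congr fun q => (ENNReal.rpow_neg _ _).symm
    refine tendsto_of_tendsto_of_tendsto_of_le_of_le' tendsto_const_nhds h1
      (Eventually.of_forall fun _ => zero_le) ?_
    filter_upwards [eventually_ge_atTop 1] with q hq
    refine (volume_heavySet_le μ hq (by simp [ENNReal.rpow_eq_zero_iff])
      (by simp [ENNReal.rpow_eq_top_iff]; omega)).trans_eq ?_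
    have hq0 : (q : ℝ≥0∞) ≠ 0 := by simp; omega
    rw [ENNReal.rpow_neg, inv_inv, ← ENNReal.rpow_natCast, ENNReal.inv_rpow, ← ENNReal.rpow_neg,
      ← ENNReal.rpow_add _ _ hq0 (ENNReal.natCast_ne_top q), Fintype.card_coe]
    congr 1; ring
  have hheavy : Tendsto (fun q : ℕ => μ (heavySet μ q ((q : ℝ≥0∞) ^ (-(t : ℝ))))) atTop
      (𝓝 0) := by
    have hd := Measure.withDensity_rnDeriv_eq μ volume hJ
    have h2 := tendsto_setLIntegral_zero (μ := volume) (f := μ.rnDeriv volume)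
      (Measure.lintegral_rnDeriv_lt_top μ volume).ne hvol
    refine h2.congr fun q => ?_
    conv_rhs => rw [← hd]
    rw [withDensity_apply _ (measurableSet_heavySet _ _ _), hd]
  have hlow : ∀ᶠ q : ℕ in atTop, (1 - μ (heavySet μ q ((q : ℝ≥0∞) ^ (-(t : ℝ))))) * t ≤
      quantEntropy q m / ENNReal.ofReal (Real.logb 2 q) := by
    filter_upwards [eventually_ge_atTop 2] with q hq
    have hlog : 0 < Real.logb 2 q := Real.logb_pos one_lt_two (by exact_mod_cast hq)
    rw [ENNReal.le_div_iff_mul_le (Or.inl (by simpa using hlog)) (Or.inl ENNReal.ofReal_ne_top),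
      quantEntropy_eq]
    set Hv := heavySet μ q ((q : ℝ≥0∞) ^ (-(t : ℝ))) with hHv
    have hmeas : MeasurableSet Hv := measurableSet_heavySet _ _ _
    calc (1 - μ Hv) * t * ENNReal.ofReal (Real.logb 2 q)
        = ∫⁻ _ in π ⁻¹' Hvᶜ, infoContent ((q : ℝ≥0∞) ^ (-(t : ℝ))) ∂m := by
          rw [setLIntegral_const, infoContent_rpow (by omega) t.coe_nonneg, mul_assoc, mul_comm,
            ← prob_compl_eq_one_sub hmeas, hμ, Measure.map_apply hπm hmeas.compl,
            ENNReal.ofReal_coe_nnreal]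
      _ ≤ ∫⁻ u in π ⁻¹' Hvᶜ, infoContent (m (floorVec q ⁻¹' {floorVec q u})) ∂m := by
          refine setLIntegral_mono' (hπm hmeas.compl) fun u hu => ?_
          have hu' : μ (floorVec q ⁻¹' {floorVec q (π u)}) ≤ (q : ℝ≥0∞) ^ (-(t : ℝ)) := by
            simpa [heavySet, Hv] using hu
          rw [hμ, Measure.map_apply hπm (measurable_floorVec q (measurableSet_singleton _))] at hu'
          refine infoContent_anti (le_trans (measure_mono ?_) hu') ?_
          -- The cell of `u` projects into the cell of its `J`-coordinates, so its mass is no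
          -- larger.
          · intro x hx
            have hx' : floorVec q x = floorVec q u := hx
            exact funext fun j => congrFun hx' j
          · rw [ENNReal.rpow_neg]
            refine ENNReal.inv_le_one.2 ?_
            rw [← ENNReal.one_rpow (t : ℝ)]
            exact ENNReal.rpow_le_rpow (by exact_mod_cast (by omega : 1 ≤ q)) t.coe_nonneg
      _ ≤ _ := setLIntegral_le_lintegral _ _
  have hlim : Tendsto (fun q : ℕ => (1 - μ (heavySet μ q ((q : ℝ≥0∞) ^ (-(t : ℝ))))) * (t : ℝ≥0∞))
      atTop (𝓝 t) := by
    have h1 := ENNReal.Tendsto.sub (tendsto_const_nhds (x := (1 : ℝ≥0∞))) hheavy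
      (Or.inl ENNReal.one_ne_top)
    have := ENNReal.Tendsto.mul_const (b := (t : ℝ≥0∞)) h1 (Or.inr ENNReal.coe_ne_top)
    simpa using this
  exact hlim.liminf_eq.symm.le.trans (liminf_le_liminf hlow)

end Cells

end RenyiCompression

/-! ### Codes for integer vectors -/

namespace RenyiCompression

section IntegerCode

/-- The normalizing constant of the two-sided geometric distribution. -/
def geomConst : ℝ≥0∞ := ∑' n : ℤ, (2⁻¹ : ℝ≥0∞) ^ n.natAbs

lemma geomConst_ne_zero : geomConst ≠ 0 := by
  intro h
  have := ENNReal.tsum_eq_zero.1 h 0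
  simp at this

lemma geomConst_ne_top : geomConst ≠ ∞ := by
  have h : ∑' n : ℕ, (2⁻¹ : ℝ≥0∞) ^ n ≠ ∞ := by
    rw [ENNReal.tsum_geometric]; simp
  have h2 : geomConst ≤ ∑' n : ℕ, (2⁻¹ : ℝ≥0∞) ^ n + ∑' n : ℕ, (2⁻¹ : ℝ≥0∞) ^ n := by
    unfold geomConst
    rw [← Equiv.intEquivNatSumNat.symm.tsum_eq,
      Summable.tsum_sum ENNReal.summable ENNReal.summable]
    refine add_le_add (ENNReal.tsum_le_tsum fun n => ?_) (ENNReal.tsum_le_tsum fun n => ?_)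
    · simp [Equiv.intEquivNatSumNat]
    · simp only [Equiv.intEquivNatSumNat, Equiv.coe_fn_symm_mk, Sum.elim_inr, Int.natAbs_negSucc]
      exact pow_le_pow_of_le_one zero_le (by simp) (Nat.le_succ n)
  exact ne_top_of_le_ne_top (ENNReal.add_ne_top.2 ⟨h, h⟩) h2

lemma geomConst_ge_one : 1 ≤ geomConst := by
  refine le_trans ?_ (ENNReal.le_tsum (0 : ℤ))
  simp

/-- A code for the integers `⌊q u⌋`: a two-sided geometric distribution for `⌊u⌋`, and the uniform
distribution on the `q` remainders. -/
def intCode (q : ℕ) (m : ℤ) : ℝ≥0∞ := (q : ℝ≥0∞)⁻¹ * ((2⁻¹ : ℝ≥0∞) ^ (m / q).natAbs * geomConst⁻¹)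

/-- Quotient and remainder identify `ℤ` with `ℤ × Fin q`; the `q` equal remainders cancel the factor
`1/q`, and a geometric sum is left. -/
lemma tsum_intCode {q : ℕ} (hq : q ≠ 0) : ∑' m, intCode q m = 1 := by
  have : NeZero q := ⟨hq⟩
  rw [← (Int.divModEquiv q).symm.tsum_eq]
  have h : ∀ x : ℤ × Fin q, intCode q ((Int.divModEquiv q).symm x) =
      (q : ℝ≥0∞)⁻¹ * ((2⁻¹ : ℝ≥0∞) ^ x.1.natAbs * geomConst⁻¹) := by
    rintro ⟨n, r⟩
    have : ((Int.divModEquiv q).symm (n, r)) / (q : ℤ) = n := by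
      have := congrArg Prod.fst ((Int.divModEquiv q).apply_symm_apply (n, r))
      exact this
    rw [intCode, this]
  simp_rw [h]
  rw [ENNReal.tsum_prod (f := fun (n : ℤ) (_ : Fin q) =>
    (q : ℝ≥0∞)⁻¹ * ((2⁻¹ : ℝ≥0∞) ^ n.natAbs * geomConst⁻¹))]
  simp only [tsum_fintype, Finset.sum_const, Finset.card_univ, Fintype.card_fin, nsmul_eq_mul]
  have h2 : ∀ a : ℤ, (q : ℝ≥0∞) * ((q : ℝ≥0∞)⁻¹ * ((2⁻¹ : ℝ≥0∞) ^ a.natAbs * geomConst⁻¹)) =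
      (2⁻¹ : ℝ≥0∞) ^ a.natAbs * geomConst⁻¹ := fun a => by
    rw [← mul_assoc, ENNReal.mul_inv_cancel (by simpa using hq) (ENNReal.natCast_ne_top q),
      one_mul]
  simp_rw [h2]
  rw [ENNReal.tsum_mul_right]
  exact ENNReal.mul_inv_cancel geomConst_ne_zero geomConst_ne_top

/-- The sum is the total mass of a product of probability measures. -/
lemma tsum_prod_intCode {q : ℕ} (hq : q ≠ 0) {J : Type*} [Fintype J] :
    ∑' t : J → ℤ, ∏ j, intCode q (t j) = 1 := by
  let p : PMF ℤ := ⟨intCode q, by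
    have := ENNReal.summable.hasSum (f := intCode q)
    rwa [tsum_intCode hq] at this⟩
  rw [← tsum_measure_singleton (Measure.pi fun _ : J => p.toMeasure)]
  refine tsum_congr fun t => ?_
  rw [Measure.pi_singleton]
  refine Finset.prod_congr rfl fun j _ => ?_
  rw [PMF.toMeasure_apply_singleton _ _ (measurableSet_singleton _)]
  rfl

lemma intCode_le_one {q : ℕ} (hq : q ≠ 0) (m : ℤ) : intCode q m ≤ 1 :=
  (ENNReal.le_tsum m).trans_eq (tsum_intCode hq)

lemma infoContent_inv_natCast (q : ℕ) :
    infoContent ((q : ℝ≥0∞)⁻¹) = ENNReal.ofReal (Real.logb 2 q) := by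
  rw [infoContent, if_neg (by simp), ENNReal.toReal_inv, ENNReal.toReal_natCast, Real.log_inv,
    neg_neg]
  rfl

lemma infoContent_half_pow (n : ℕ) : infoContent ((2⁻¹ : ℝ≥0∞) ^ n) = n := by
  have h : infoContent (2⁻¹ : ℝ≥0∞) = 1 := by
    have := infoContent_inv_natCast 2
    simpa using this
  induction n with
  | zero => simp [infoContent_one]
  | succ n ih =>
    rw [pow_succ, infoContent_mul (pow_le_one' (by simp) n) (by simp), ih, h]
    push_cast; rfl

/-- One coordinate costs `log₂ q` plus an overhead linear in `|⌊m/q⌋|`. For `m = ⌊q u⌋` that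
quotient is `⌊u⌋`, so the overhead does not depend on `q` and is integrable. -/
lemma infoContent_intCode {q : ℕ} (hq : q ≠ 0) (m : ℤ) :
    infoContent (intCode q m) = ENNReal.ofReal (Real.logb 2 q) +
      (((m / q).natAbs : ℕ) + infoContent geomConst⁻¹) := by
  have h1 : (q : ℝ≥0∞)⁻¹ ≤ 1 := ENNReal.inv_le_one.2 (by exact_mod_cast Nat.one_le_iff_ne_zero.2 hq)
  have h2 : (2⁻¹ : ℝ≥0∞) ^ (m / q).natAbs ≤ 1 := pow_le_one' (by simp) _
  have h3 : geomConst⁻¹ ≤ 1 := ENNReal.inv_le_one.2 geomConst_ge_one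
  rw [intCode, infoContent_mul h1 (mul_le_one' h2 h3), infoContent_mul h2 h3,
    infoContent_inv_natCast q, infoContent_half_pow]

lemma infoContent_ne_top {p : ℝ≥0∞} (hp : p ≠ 0) : infoContent p ≠ ∞ := by
  rw [infoContent, if_neg hp]; exact ENNReal.ofReal_ne_top

variable {ι : Type*} [Fintype ι]

/-- Integer vectors whose coordinates are determined up to `M` by those in `J` can be coded by
coding the coordinates in `J` and an offset. -/
lemma tsum_offsetCode_le {q : ℕ} (hq : q ≠ 0) (J : Finset ι) (pred : (J → ℤ) → ι → ℝ) (M : ℕ) :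
    ∑' v : ι → ℤ, (open Classical in if ∀ i, |(v i : ℝ) - pred (fun j => v j) i| ≤ M then
      (((2 * M + 3) ^ Fintype.card ι : ℕ) : ℝ≥0∞)⁻¹ * ∏ j : J, intCode q (v j) else 0) ≤ 1 := by
  classical
  set K : ℕ := (2 * M + 3) ^ Fintype.card ι with hK
  set G : Set (ι → ℤ) := {v | ∀ i, |(v i : ℝ) - pred (fun j => v j) i| ≤ M}
  -- Rounding the prediction to an integer costs at most one more unit, so the offsets lie in
  -- `[-(M+1), M+1]`. That is `2M + 3` values, the base of the power `K`.
  let T := ↥(Finset.Icc (-(M + 1 : ℤ)) (M + 1))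
  let f : (J → ℤ) × (ι → T) → ℝ≥0∞ := fun x => (K : ℝ≥0∞)⁻¹ * ∏ j, intCode q (x.1 j)
  let e : G → (J → ℤ) × (ι → T) := fun v => (fun j => v.1 j, fun i =>
    ⟨v.1 i - ⌊pred (fun j => v.1 j) i⌋, by
      have h := abs_le.1 (v.2 i)
      have h1 := Int.floor_le (pred (fun j => v.1 j) i)
      have h2 := Int.lt_floor_add_one (pred (fun j => v.1 j) i)
      rw [Finset.mem_Icc]
      constructor
      · have : (-(M + 1 : ℤ) : ℝ) ≤ ((v.1 i - ⌊pred (fun j => v.1 j) i⌋ : ℤ) : ℝ) := by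
          push_cast; linarith [h.1]
        exact_mod_cast this
      · have : ((v.1 i - ⌊pred (fun j => v.1 j) i⌋ : ℤ) : ℝ) ≤ ((M + 1 : ℤ) : ℝ) := by
          push_cast; linarith [h.2]
        exact_mod_cast this⟩)
  have he : Function.Injective e := by
    intro v w h
    have h1 : (fun j : J => v.1 j) = fun j : J => w.1 j := congrArg Prod.fst h
    refine Subtype.ext (funext fun i => ?_)
    have h2 := congrArg Subtype.val (congrFun (congrArg Prod.snd h) i)
    simp only [e, h1] at h2
    linarith
  calc _ = ∑' v : G, f (e v) := by
        rw [tsum_subtype G (fun v => (K : ℝ≥0∞)⁻¹ * ∏ j : J, intCode q (v j))]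
        refine tsum_congr fun v => ?_
        rw [Set.indicator_apply]
        rfl
    _ ≤ ∑' x, f x := ENNReal.tsum_comp_le_tsum_of_injective he f
    _ = 1 := by
        rw [ENNReal.tsum_prod (f := fun t o => f (t, o))]
        have hT : Fintype.card (ι → T) = K := by
          rw [Fintype.card_fun, Fintype.card_coe, Int.card_Icc, hK]
          congr 1; omega
        have : ∀ t : J → ℤ, ∑' o : ι → T, f (t, o) = ∏ j, intCode q (t j) := fun t => by
          simp only [f]
          rw [tsum_fintype, Finset.sum_const, Finset.card_univ, hT, nsmul_eq_mul, ← mul_assoc,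
            ENNReal.mul_inv_cancel (by simp [hK]) (ENNReal.natCast_ne_top K), one_mul]
        simp_rw [this]
        exact tsum_prod_intCode hq

end IntegerCode

end RenyiCompression

/-! ### Mixed vectors and the upper bound for the information dimension -/

namespace RenyiCompression

/-- The set of indices at which `d` vanishes. -/
def zeroSet {κ : Type*} [Fintype κ] (d : κ → ℕ) : Finset κ := Finset.univ.filter fun j => d j = 0

/-- A random vector `Z` with a discrete label `D` of finite entropy: the label determines the
coordinates `Z j` with `D j ≠ 0`, and the others are jointly absolutely continuous given `D`. -/
structure IsMixedVector {Ω κ : Type*} [MeasurableSpace Ω] [Fintype κ] (P : Measure Ω)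
    (Z : Ω → κ → ℝ) (D : Ω → κ → ℕ) (dec : κ → ℕ → ℝ) : Prop where
  measurable_vec : Measurable Z
  measurable_label : Measurable D
  integrable : ∀ j, Integrable (fun ω => Z ω j) P
  entropy_label : entropy P D ≠ ∞
  decode : ∀ᵐ ω ∂P, ∀ j, D ω j ≠ 0 → Z ω j = dec j (D ω j)
  absolutelyContinuous : ∀ d : κ → ℕ,
    (P.restrict (D ⁻¹' {d})).map (fun ω (j : zeroSet d) => Z ω j) ≪ volume

section RID

variable {Ω κ ι E : Type*} [MeasurableSpace Ω] [Fintype κ] [DecidableEq κ] [Fintype ι]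
  [NormedAddCommGroup E] [NormedSpace ℝ E] [FiniteDimensional ℝ E] [MeasurableSpace E]
  [BorelSpace E] {P : Measure Ω} [IsProbabilityMeasure P]
  {Z : Ω → κ → ℝ} {D : Ω → κ → ℕ} {dec : κ → ℕ → ℝ}

lemma extendZero_apply (C : Finset κ) (x : C → ℝ) (j : κ) :
    extendZero C x j = if h : j ∈ C then x ⟨j, h⟩ else 0 := rfl

/-- The discrete part of `Z`, as a function of the label. -/
def discretePart (dec : κ → ℕ → ℝ) (d : κ → ℕ) (j : κ) : ℝ := if d j = 0 then 0 else dec j (d j)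

lemma eq_discretePart_add {d : κ → ℕ} {z : κ → ℝ} (h : ∀ j, d j ≠ 0 → z j = dec j (d j)) :
    z = discretePart dec d + extendZero (zeroSet d) (fun j => z j) := by
  ext j
  by_cases hj : d j = 0
  · rw [Pi.add_apply, extendZero_apply, dif_pos (by simp [zeroSet, hj]), discretePart, if_pos hj,
      zero_add]
  · rw [Pi.add_apply, extendZero_apply, dif_neg (by simp [zeroSet, hj]), discretePart, if_neg hj,
      add_zero, h j hj]

lemma measurable_linearMap {V V' : Type*} [NormedAddCommGroup V] [NormedSpace ℝ V]
    [FiniteDimensional ℝ V] [MeasurableSpace V] [BorelSpace V]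
    [NormedAddCommGroup V'] [NormedSpace ℝ V'] [MeasurableSpace V'] [BorelSpace V']
    (f : V →ₗ[ℝ] V') : Measurable f :=
  f.continuous_of_finiteDimensional.measurable

lemma integrable_linearMap (h : IsMixedVector P Z D dec) (B : (κ → ℝ) →ₗ[ℝ] (ι → ℝ)) (i : ι) :
    Integrable (fun ω => B (Z ω) i) P := by
  have : (fun ω => B (Z ω) i) = fun ω => ∑ j, Z ω j * B (Pi.single j 1) i := by
    ext ω
    conv_lhs => rw [B.pi_apply_eq_sum_univ (Z ω)]
    rw [Finset.sum_apply]
    refine Finset.sum_congr rfl fun j _ => ?_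
    have : (fun l => if j = l then (1 : ℝ) else 0) = Pi.single j 1 := by
      ext l; simp [Pi.single_apply, eq_comm]
    rw [this]; rfl
  rw [this]
  exact integrable_finsetSum _ fun j _ => (h.integrable j).mul_const _

/-- There is one decoder for each of the finitely many sets `C`, so one constant bounds the
amplification of rounding errors. The extra `1` leaves room for the rounding of the predicted
coordinate itself. -/
lemma exists_uniform_bound (J : Finset κ → Finset ι)
    (k : (C : Finset κ) → (J C → ℝ) × E →ₗ[ℝ] (ι → ℝ)) :
    ∃ M : ℕ, ∀ (C : Finset κ) (t : J C → ℝ), (∀ j, |t j| ≤ 1) →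
      ∀ i, |k C (t, 0) i| + 1 ≤ M := by
  have h1 : ∀ C : Finset κ, ∃ M : ℕ, ∀ t : J C → ℝ, (∀ j, |t j| ≤ 1) →
      ∀ i, |k C (t, 0) i| + 1 ≤ M := by
    intro C
    let f := LinearMap.toContinuousLinearMap ((k C).comp (LinearMap.inl ℝ (J C → ℝ) E))
    refine ⟨⌈‖f‖ + 1⌉₊, fun t ht i => le_trans ?_ (Nat.le_ceil _)⟩
    have h2 : ‖t‖ ≤ 1 := (pi_norm_le_iff_of_nonneg zero_le_one).2 ht
    have h3 := (norm_le_pi_norm (f t) i).trans ((f.le_opNorm t).trans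
      (mul_le_of_le_one_right (norm_nonneg _) h2))
    have h4 : |k C (t, 0) i| ≤ ‖f‖ := h3
    linarith
  choose M hM using h1
  refine ⟨Finset.univ.sup M, fun C t ht i => (hM C t ht i).trans ?_⟩
  exact_mod_cast Finset.le_sup (Finset.mem_univ C)

/-- The prediction of `q u`, given the coordinates `m` in `J` of `⌊q u⌋`, the value `w` of the
measurements and the discrete part. -/
def predict (B : (κ → ℝ) →ₗ[ℝ] (ι → ℝ)) (F : (κ → ℝ) →ₗ[ℝ] E) {J : Finset ι}
    (k : (J → ℝ) × E →ₗ[ℝ] (ι → ℝ)) (q : ℕ) (z₀ : κ → ℝ) (w : E) (m : J → ℤ) (i : ι) : ℝ :=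
  q * (B z₀ i + k (fun j => (m j : ℝ) / q - B z₀ j, w - F z₀) i)

/-- By linearity the prediction misses `q B z` by the decoder's image of the fractional parts of the
`J`-coordinates, which lie in `[0, 1)`. Taking the floor adds less than one. -/
lemma abs_floorVec_sub_predict_le {B : (κ → ℝ) →ₗ[ℝ] (ι → ℝ)} {F : (κ → ℝ) →ₗ[ℝ] E}
    {C : Finset κ} {J : Finset ι} {k : (J → ℝ) × E →ₗ[ℝ] (ι → ℝ)}
    (hk : ∀ x : C → ℝ,
      B (extendZero C x) = k (fun j => B (extendZero C x) j, F (extendZero C x)))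
    {M : ℕ} (hM : ∀ t : J → ℝ, (∀ j, |t j| ≤ 1) → ∀ i, |k (t, 0) i| + 1 ≤ M)
    {q : ℕ} (hq : q ≠ 0) {z z₀ : κ → ℝ} {x : C → ℝ} (hz : z = z₀ + extendZero C x) (i : ι) :
    |((floorVec q (B z) i : ℤ) : ℝ) -
      predict B F k q z₀ (F z) (fun j => floorVec q (B z) j) i| ≤ M := by
  have hq0 : (0 : ℝ) < q := by exact_mod_cast Nat.pos_of_ne_zero hq
  have hb : ∀ i, B (extendZero C x) i = B z i - B z₀ i := fun i => by
    rw [hz, map_add, Pi.add_apply]; ring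
  have hf : F (extendZero C x) = F z - F z₀ := by rw [hz, map_add]; abel
  let t : J → ℝ := fun j => q * B z j - floorVec q (B z) j
  have ht : ∀ j, |t j| ≤ 1 := fun j => by
    have h1 := Int.floor_le ((q : ℝ) * B z j)
    have h2 := Int.lt_floor_add_one ((q : ℝ) * B z j)
    rw [abs_le]
    constructor <;> simp only [t, floorVec] <;> linarith
  have hkx := congrFun (hk x) i
  -- True data are quantized data plus `1/q` times the fractional parts `t`. The measurement is
  -- exact, so its error component is `0`.
  have hsplit : ((fun j : J => B (extendZero C x) j, F (extendZero C x)) :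
      (J → ℝ) × E) = (fun j : J => (floorVec q (B z) j : ℝ) / q - B z₀ j,
        F z - F z₀) + (q : ℝ)⁻¹ • (t, 0) := by
    refine Prod.ext (funext fun j => ?_) (by simp [hf])
    simp only [hb, t, Prod.fst_add, Prod.smul_fst, Pi.add_apply, Pi.smul_apply, smul_eq_mul]
    field_simp; ring
  rw [hsplit, map_add, map_smul, Pi.add_apply, Pi.smul_apply, smul_eq_mul, hb] at hkx
  have hp : predict B F k q z₀ (F z) (fun j => floorVec q (B z) j) i =
      q * B z i - k (t, 0) i := by
    have h3 : (q : ℝ) * ((q : ℝ)⁻¹ * k (t, 0) i) = k (t, 0) i := by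
      field_simp
    have h4 := congrArg (fun r => (q : ℝ) * r) hkx
    simp only [mul_add, mul_sub, h3] at h4
    simp only [predict, mul_add]
    linarith
  rw [hp]
  have h1 := Int.floor_le ((q : ℝ) * B z i)
  have h2 := Int.lt_floor_add_one ((q : ℝ) * B z i)
  have h3 := hM t ht i
  have h4 := abs_le.1 (le_refl |k (t, 0) i|)
  rw [abs_le]
  constructor <;> simp only [floorVec] <;> linarith [h4.1, h4.2]

open Classical in
/-- The code that describes `⌊q B Z⌋` given `F Z` and the label, by the coordinates in `J` and
bounded offsets from the prediction. -/
def residualCode (B : (κ → ℝ) →ₗ[ℝ] (ι → ℝ)) (F : (κ → ℝ) →ₗ[ℝ] E) (dec : κ → ℕ → ℝ)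
    (J : Finset κ → Finset ι) (k : (C : Finset κ) → (J C → ℝ) × E →ₗ[ℝ] (ι → ℝ)) (M q : ℕ)
    (x : (E × (κ → ℕ)) × (ι → ℤ)) : ℝ≥0∞ :=
  if ∀ i, |(x.2 i : ℝ) - predict B F (k (zeroSet x.1.2)) q (discretePart dec x.1.2) x.1.1
      (fun j => x.2 j) i| ≤ M then
    (((2 * M + 3) ^ Fintype.card ι : ℕ) : ℝ≥0∞)⁻¹ *
      ∏ j : J (zeroSet x.1.2), intCode q (x.2 j) else 0

lemma measurable_residualCode (B : (κ → ℝ) →ₗ[ℝ] (ι → ℝ)) (F : (κ → ℝ) →ₗ[ℝ] E)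
    (dec : κ → ℕ → ℝ) (J : Finset κ → Finset ι)
    (k : (C : Finset κ) → (J C → ℝ) × E →ₗ[ℝ] (ι → ℝ)) (M q : ℕ) :
    Measurable (residualCode B F dec J k M q) := by
  classical
  refine measurable_from_prod_countable_left fun v => ?_
  refine measurable_from_prod_countable_left fun d => ?_
  have hp : ∀ i, Measurable fun w : E =>
      predict B F (k (zeroSet d)) q (discretePart dec d) w (fun j => v j) i := fun i => by
    refine Measurable.const_mul (measurable_const.add ?_) _
    exact (measurable_pi_apply i).comp ((measurable_linearMap (k (zeroSet d))).comp
      (measurable_const.prodMk (measurable_id.sub measurable_const)))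
  have hs : MeasurableSet {w : E | ∀ i, |(v i : ℝ) - predict B F (k (zeroSet d)) q
      (discretePart dec d) w (fun j => v j) i| ≤ M} := by
    rw [Set.ofPred_forall]
    exact MeasurableSet.iInter fun i =>
      measurableSet_le (measurable_const.sub (hp i)).abs measurable_const
  exact Measurable.ite hs (measurable_const (a := (((2 * M + 3) ^ Fintype.card ι : ℕ) : ℝ≥0∞)⁻¹ *
      ∏ j : J (zeroSet d), intCode q (v j))) (measurable_const (a := 0))

lemma tsum_residualCode_le (B : (κ → ℝ) →ₗ[ℝ] (ι → ℝ)) (F : (κ → ℝ) →ₗ[ℝ] E)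
    (dec : κ → ℕ → ℝ) (J : Finset κ → Finset ι)
    (k : (C : Finset κ) → (J C → ℝ) × E →ₗ[ℝ] (ι → ℝ)) (M : ℕ) {q : ℕ} (hq : q ≠ 0)
    (w : E × (κ → ℕ)) : ∑' v, residualCode B F dec J k M q (w, v) ≤ 1 :=
  tsum_offsetCode_le hq (J (zeroSet w.2))
    (predict B F (k (zeroSet w.2)) q (discretePart dec w.2) w.1) M

/-- The length of the code, when the data satisfy the constraint. -/
lemma infoContent_residualCode_le {B : (κ → ℝ) →ₗ[ℝ] (ι → ℝ)} {F : (κ → ℝ) →ₗ[ℝ] E}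
    {J : Finset κ → Finset ι} {k : (C : Finset κ) → (J C → ℝ) × E →ₗ[ℝ] (ι → ℝ)} {M : ℕ}
    (hk : ∀ (C : Finset κ) (x : C → ℝ),
      B (extendZero C x) = k C (fun j => B (extendZero C x) j, F (extendZero C x)))
    (hM : ∀ (C : Finset κ) (t : J C → ℝ), (∀ j, |t j| ≤ 1) → ∀ i, |k C (t, 0) i| + 1 ≤ M)
    {q : ℕ} (hq : q ≠ 0) {d : κ → ℕ} {z : κ → ℝ} (hz : ∀ j, d j ≠ 0 → z j = dec j (d j)) :
    infoContent (residualCode B F dec J k M q ((F z, d), floorVec q (B z))) ≤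
      ((J (zeroSet d)).card : ℝ≥0∞) * ENNReal.ofReal (Real.logb 2 q) +
        (infoContent ((((2 * M + 3) ^ Fintype.card ι : ℕ) : ℝ≥0∞)⁻¹) +
          ∑ i, (ENNReal.ofReal (|B z i| + 1) + infoContent geomConst⁻¹)) := by
  have hcond := fun i => abs_floorVec_sub_predict_le (hk (zeroSet d)) (hM (zeroSet d)) hq
    (eq_discretePart_add hz) i
  have hK : (((2 * M + 3) ^ Fintype.card ι : ℕ) : ℝ≥0∞)⁻¹ ≤ 1 := by
    rw [ENNReal.inv_le_one]
    exact_mod_cast Nat.one_le_pow _ _ (by omega)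
  -- `⌊⌊q x⌋ / q⌋ = ⌊x⌋`: this removes `q` from the overhead.
  have hdiv : ∀ i, floorVec q (B z) i / (q : ℤ) = ⌊B z i⌋ := fun i => by
    rw [floorVec, ← Int.floor_div_natCast]
    congr 1
    have : (q : ℝ) ≠ 0 := by exact_mod_cast hq
    field_simp
  have hterm : ∀ i, (((floorVec q (B z) i / (q : ℤ)).natAbs : ℕ) : ℝ≥0∞) ≤
      ENNReal.ofReal (|B z i| + 1) := fun i => by
    rw [hdiv, ← ENNReal.ofReal_natCast]
    refine ENNReal.ofReal_le_ofReal ?_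
    rw [Nat.cast_natAbs, Int.cast_abs]
    have h1 := Int.floor_le (B z i)
    have h2 := Int.lt_floor_add_one (B z i)
    have h3 := abs_le.1 (le_refl |B z i|)
    rw [abs_le]
    constructor <;> linarith [h3.1, h3.2]
  have hsum : ∑ j : J (zeroSet d), infoContent (intCode q (floorVec q (B z) j)) ≤
      ((J (zeroSet d)).card : ℝ≥0∞) * ENNReal.ofReal (Real.logb 2 q) +
        ∑ i, (ENNReal.ofReal (|B z i| + 1) + infoContent geomConst⁻¹) := by
    simp_rw [infoContent_intCode hq]
    rw [Finset.sum_add_distrib, Finset.sum_const, Finset.card_univ, Fintype.card_coe,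
      nsmul_eq_mul]
    refine add_le_add le_rfl ?_
    -- Charging the overhead for all coordinates, not only those in `J`, makes it independent of the
    -- label.
    rw [Finset.sum_coe_sort (J (zeroSet d))
      (fun j => (((floorVec q (B z) j / (q : ℤ)).natAbs : ℕ) : ℝ≥0∞) + infoContent geomConst⁻¹)]
    exact (Finset.sum_le_sum fun i _ => add_le_add (hterm i) le_rfl).trans
      (Finset.sum_le_sum_of_subset (Finset.subset_univ _))
  rw [residualCode, if_pos hcond, infoContent_mul hK (Finset.prod_le_one' fun j _ =>
    intCode_le_one hq _), infoContent_prod _ _ fun j _ => intCode_le_one hq _, add_left_comm]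
  exact add_le_add le_rfl hsum

lemma measurable_finrank_residual (h : IsMixedVector P Z D dec) (B : (κ → ℝ) →ₗ[ℝ] (ι → ℝ))
    (F : (κ → ℝ) →ₗ[ℝ] E) :
    Measurable fun ω => (Module.finrank ℝ (residual B F (zeroSet (D ω))) : ℝ≥0∞) := by
  have : Measurable fun d : κ → ℕ => (Module.finrank ℝ (residual B F (zeroSet d)) : ℝ≥0∞) :=
    measurable_of_countable _
  exact this.comp h.measurable_label

lemma measurable_offsetBound (h : IsMixedVector P Z D dec) (B : (κ → ℝ) →ₗ[ℝ] (ι → ℝ)) (i : ι) :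
    Measurable fun ω => ENNReal.ofReal (|B (Z ω) i| + 1) + infoContent geomConst⁻¹ := by
  have : Measurable fun ω => B (Z ω) i :=
    (measurable_pi_apply i).comp ((measurable_linearMap B).comp h.measurable_vec)
  exact (ENNReal.measurable_ofReal.comp (this.abs.add_const 1)).add_const _

/-- The upper bound `H(⌊q B Z⌋ | F Z, D) ≤ 𝔼[rank] log₂ q + O(1)`. -/
lemma exists_condEntropy_label_le (h : IsMixedVector P Z D dec) (B : (κ → ℝ) →ₗ[ℝ] (ι → ℝ))
    (F : (κ → ℝ) →ₗ[ℝ] E) :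
    ∃ c : ℝ≥0∞, c ≠ ∞ ∧ ∀ q : ℕ, q ≠ 0 →
      condEntropy P (fun ω => floorVec q (B (Z ω))) (fun ω => (F (Z ω), D ω)) ≤
        (∫⁻ ω, (Module.finrank ℝ (residual B F (zeroSet (D ω))) : ℝ≥0∞) ∂P) *
          ENNReal.ofReal (Real.logb 2 q) + c := by
  have hZ := h.measurable_vec
  have hD := h.measurable_label
  have hBZ : Measurable fun ω => B (Z ω) := (measurable_linearMap B).comp hZ
  have hFZ : Measurable fun ω => F (Z ω) := (measurable_linearMap F).comp hZ
  choose J hJcard hJinj _ using fun C : Finset κ => exists_coordinates (residual B F C)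
  choose k hk using fun C : Finset κ => exists_reconstruction B F C (hJinj C)
  -- the quantization error is amplified by a bounded factor
  have hM := exists_uniform_bound J k
  obtain ⟨M, hM⟩ := hM
  have hc₀ : infoContent ((((2 * M + 3) ^ Fintype.card ι : ℕ) : ℝ≥0∞)⁻¹) ≠ ∞ :=
    infoContent_ne_top (ENNReal.inv_ne_zero.2 (ENNReal.natCast_ne_top _))
  have hc₁ : infoContent geomConst⁻¹ ≠ ∞ :=
    infoContent_ne_top (ENNReal.inv_ne_zero.2 geomConst_ne_top)
  generalize hc : infoContent ((((2 * M + 3) ^ Fintype.card ι : ℕ) : ℝ≥0∞)⁻¹) = c₀ at hc₀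
  refine ⟨c₀ + ∑ i, ∫⁻ ω, (ENNReal.ofReal (|B (Z ω) i| + 1) + infoContent geomConst⁻¹) ∂P, ?_,
    fun q hq => ?_⟩
  · refine ENNReal.add_ne_top.2 ⟨hc₀, ENNReal.sum_ne_top.2 fun i _ => ?_⟩
    rw [lintegral_add_right _ measurable_const]
    refine ENNReal.add_ne_top.2 ⟨?_, by simp [hc₁]⟩
    have hint : Integrable (fun ω => |B (Z ω) i| + 1) P :=
      (integrable_linearMap h B i).abs.add (integrable_const 1)
    exact (hint.lintegral_lt_top).ne
  have hfl : Measurable fun ω => floorVec q (B (Z ω)) := (measurable_floorVec q).comp hBZ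
  refine (condEntropy_le_lintegral hfl (hFZ.prodMk hD) (residualCode B F dec J k M q)
    (measurable_residualCode B F dec J k M q) (tsum_residualCode_le B F dec J k M hq)).trans ?_
  have hbound : ∀ᵐ ω ∂P,
      infoContent (residualCode B F dec J k M q ((F (Z ω), D ω), floorVec q (B (Z ω)))) ≤
      (Module.finrank ℝ (residual B F (zeroSet (D ω))) : ℝ≥0∞) * ENNReal.ofReal (Real.logb 2 q) +
        (c₀ + ∑ i, (ENNReal.ofReal (|B (Z ω) i| + 1) + infoContent geomConst⁻¹)) := by
    filter_upwards [h.decode] with ω hω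
    rw [← hc, ← hJcard]
    exact infoContent_residualCode_le hk hM hq hω
  have hr : Measurable fun ω => (Module.finrank ℝ (residual B F (zeroSet (D ω))) : ℝ≥0∞) :=
    measurable_finrank_residual h B F
  refine (lintegral_mono_ae hbound).trans_eq ?_
  rw [lintegral_add_left (hr.mul_const _), lintegral_mul_const _ hr,
    lintegral_add_left measurable_const, lintegral_finsetSum _ fun i _ => measurable_offsetBound h B i, lintegral_const,
    measure_univ, mul_one]

end RID

end RenyiCompression

/-! ### The lower bound and the formula for the information dimension -/

namespace RenyiCompression

section RID

variable {Ω κ ι E : Type*} [MeasurableSpace Ω] [Fintype κ] [DecidableEq κ] [Fintype ι]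
  [NormedAddCommGroup E] [NormedSpace ℝ E] [FiniteDimensional ℝ E] [MeasurableSpace E]
  [BorelSpace E] {P : Measure Ω} [IsProbabilityMeasure P]
  {Z : Ω → κ → ℝ} {D : Ω → κ → ℕ} {dec : κ → ℕ → ℝ}

lemma condEntropy_floorVec_eq {β : Type*} [MeasurableSpace β] {U : Ω → ι → ℝ} {W : Ω → β}
    (hU : Measurable U) (hW : Measurable W) (q : ℕ) :
    condEntropy P (fun ω => floorVec q (U ω)) W =
      ∫⁻ ω, quantEntropy q (condDistrib U W P (W ω)) ∂P := by
  rw [condEntropy_eq_lintegral_atomEntropy hW]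
  have h := condDistrib_comp (mβ := inferInstance) (μ := P) W hU.aemeasurable
    (measurable_floorVec (ι := ι) q)
  refine lintegral_congr_ae ?_
  filter_upwards [ae_of_ae_map hW.aemeasurable h] with ω hω
  change atomEntropy (condDistrib (floorVec q ∘ U) W P (W ω)) = _
  rw [hω, Kernel.map_apply _ (measurable_floorVec q)]
  rfl

lemma measurable_quantEntropy {β : Type*} [MeasurableSpace β] (k : Kernel β (ι → ℝ)) (q : ℕ) :
    Measurable fun w => quantEntropy q (k w) := by
  unfold quantEntropy
  refine Measurable.tsum fun v => ?_
  refine measurable_entTerm.comp ?_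
  simp_rw [Measure.map_apply (measurable_floorVec q) (measurableSet_singleton v)]
  exact Kernel.measurable_coe _ (measurable_floorVec q (measurableSet_singleton v))

/-- The image of an absolutely continuous law under a surjective pair of linear maps is absolutely
continuous with respect to a product measure. -/
lemma map_prodMk_absolutelyContinuous {C : Finset κ} {ρ : Measure (C → ℝ)} (hρ : ρ ≪ volume)
    (B : (κ → ℝ) →ₗ[ℝ] (ι → ℝ)) (F : (κ → ℝ) →ₗ[ℝ] E) {J : Finset ι}
    (hJ : ∀ t : J → ℝ, ∃ u ∈ residual B F C, ∀ j : J, u j = t j) (z₀ : κ → ℝ) :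
    ∃ m : Measure E, SFinite m ∧
      ρ.map (fun x => (F (z₀ + extendZero C x), fun j : J => B (z₀ + extendZero C x) j)) ≪
        m.prod volume := by
  -- The measurement need not fill `E`, so the reference measure is Haar measure on its range `R`,
  -- translated by `F z₀`. A surjective linear map sends Lebesgue measure to a multiple of Haar
  -- measure.
  let R := LinearMap.range (F.comp (extendZero C))
  let T : (C → ℝ) →ₗ[ℝ] R × (J → ℝ) := (F.comp (extendZero C)).rangeRestrict.prod
      ((LinearMap.funLeft ℝ ℝ (Subtype.val : J → ι)).comp (B.comp (extendZero C)))
  have hT : Function.Surjective T := surjective_measurement B F C hJ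
  obtain ⟨c, -, hc⟩ := T.exists_map_addHaar_eq_smul_addHaar volume
    ((Measure.addHaar : Measure R).prod (volume : Measure (J → ℝ))) hT
  let f : R → E := fun w => F z₀ + w
  let g : (J → ℝ) → (J → ℝ) := fun t => (fun j : J => B z₀ j) + t
  have hf : Measurable f := measurable_const.add measurable_subtype_coe
  have hg : Measurable g := measurable_const.add measurable_id
  have hTm : Measurable T := measurable_linearMap T
  refine ⟨(Measure.addHaar : Measure R).map f, inferInstance, ?_⟩
  have hfun : (fun x => (F (z₀ + extendZero C x), fun j : J => B (z₀ + extendZero C x) j)) =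
      Prod.map f g ∘ T := by
    ext x
    · simp [T, f]
    · simp [T, g, LinearMap.funLeft_apply]
  have hgv : (volume : Measure (J → ℝ)).map g = volume := map_add_left_eq_self _ _
  rw [hfun, ← Measure.map_map (hf.prodMap hg) hTm]
  have h1 : ρ.map T ≪ (Measure.addHaar : Measure R).prod (volume : Measure (J → ℝ)) := by
    refine (hρ.map hTm).trans ?_
    rw [hc]
    exact Measure.smul_absolutelyContinuous
  have h2 := h1.map (hf.prodMap hg)
  rwa [← Measure.map_prod_map _ _ hf hg, hgv] at h2

/-- On the event that the label is `d`, the joint law of the measurement and of the `J`-coordinates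
is absolutely continuous with respect to a product with Lebesgue measure. Disintegration gives the
same for almost every conditional law, and there are only countably many labels. -/
lemma ae_absolutelyContinuous_condDistrib (h : IsMixedVector P Z D dec)
    (B : (κ → ℝ) →ₗ[ℝ] (ι → ℝ)) (F : (κ → ℝ) →ₗ[ℝ] E) (J : Finset κ → Finset ι)
    (hJ : ∀ C, ∀ t : J C → ℝ, ∃ u ∈ residual B F C, ∀ j : J C, u j = t j) :
    ∀ᵐ ω ∂P, (condDistrib (fun ω => B (Z ω)) (fun ω => (F (Z ω), D ω)) P (F (Z ω), D ω)).map
      (fun u (j : J (zeroSet (D ω))) => u j) ≪ volume := by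
  have hZ := h.measurable_vec
  have hD := h.measurable_label
  have hBZ : Measurable fun ω => B (Z ω) := (measurable_linearMap B).comp hZ
  have hFZ : Measurable fun ω => F (Z ω) := (measurable_linearMap F).comp hZ
  set k := condDistrib (fun ω => B (Z ω)) (fun ω => (F (Z ω), D ω)) P with hk
  have key : ∀ d : κ → ℕ, ∀ᵐ ω ∂P.restrict (D ⁻¹' {d}),
      (k (F (Z ω), d)).map (fun u (j : J (zeroSet d)) => u j) ≪ volume := by
    intro d
    have hDd : MeasurableSet (D ⁻¹' {d}) := hD (measurableSet_singleton d)
    set Pd := P.restrict (D ⁻¹' {d}) with hPd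
    set π : (ι → ℝ) → (J (zeroSet d) → ℝ) := fun u j => u j with hπ
    have hπm : Measurable π := by fun_prop
    -- With the label frozen at `d`, the conditional law becomes a kernel in the measurement alone.
    -- `hjoint` checks that it disintegrates the joint law on this event, by testing `k` on the
    -- indicator `G`.
    let kd : Kernel E (J (zeroSet d) → ℝ) := (k.comap (fun w => (w, d)) (by fun_prop)).map π
    have : IsMarkovKernel kd := Kernel.IsMarkovKernel.map _ hπm
    have hjoint : (Pd.map fun ω => F (Z ω)) ⊗ₘ kd =
        Pd.map (fun ω => (F (Z ω), π (B (Z ω)))) := by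
      classical
      ext s hs
      have hFπ : Measurable fun ω => (F (Z ω), π (B (Z ω))) := hFZ.prodMk (hπm.comp hBZ)
      rw [Measure.compProd_apply hs, lintegral_map (Kernel.measurable_kernel_prodMk_left hs) hFZ,
        Measure.map_apply hFπ hs, hPd, Measure.restrict_apply (hFπ hs)]
      let G : (E × (κ → ℕ)) × (ι → ℝ) → ℝ≥0∞ :=
        Set.indicator {x | x.1.2 = d ∧ (x.1.1, π x.2) ∈ s} 1
      have hGs : MeasurableSet {x : (E × (κ → ℕ)) × (ι → ℝ) | x.1.2 = d ∧ (x.1.1, π x.2) ∈ s} :=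
        MeasurableSet.inter ((measurable_snd.comp measurable_fst) (measurableSet_singleton d))
          (((measurable_fst.comp measurable_fst).prodMk (hπm.comp measurable_snd)) hs)
      have hG : Measurable G := measurable_one.indicator hGs
      have := lintegral_comp_condDistrib (P := P) hBZ (hFZ.prodMk hD) hG
      have hL : ∫⁻ ω, G ((F (Z ω), D ω), B (Z ω)) ∂P =
          P ((fun ω => (F (Z ω), π (B (Z ω)))) ⁻¹' s ∩ D ⁻¹' {d}) := by
        rw [← lintegral_indicator_one ((hFπ hs).inter hDd)]
        refine lintegral_congr fun ω => ?_
        simp only [G, Set.indicator_apply, Set.mem_inter_iff, Set.mem_preimage,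
          Set.mem_singleton_iff, Set.mem_ofPred_eq, Pi.one_apply, and_comm]
      rw [← hL, this, ← lintegral_indicator hDd]
      refine lintegral_congr fun ω => ?_
      rw [Set.indicator_apply]
      split_ifs with hω
      · have hω' : D ω = d := hω
        simp only [kd, G]
        rw [Kernel.map_apply' _ hπm _ (measurable_prodMk_left hs), Kernel.comap_apply,
          ← lintegral_indicator_one (hπm (measurable_prodMk_left hs)), hω']
        refine lintegral_congr fun u => ?_
        simp [Set.indicator_apply]
      · have hω' : D ω ≠ d := hω
        simp [G, hω']
    obtain ⟨m, hm, hac⟩ := map_prodMk_absolutelyContinuous (h.absolutelyContinuous d) B F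
      (hJ (zeroSet d)) (discretePart dec d)
    have hac2 : Pd.map (fun ω => (F (Z ω), π (B (Z ω)))) ≪ m.prod volume := by
      refine (Measure.absolutelyContinuous_of_eq ?_).trans hac
      rw [Measure.map_map]
      · refine Measure.map_congr ?_
        rw [Filter.EventuallyEq, hPd, ae_restrict_iff' hDd]
        filter_upwards [h.decode] with ω hω hωd
        have hωd' : D ω = d := hωd
        rw [hωd'] at hω
        have := eq_discretePart_add hω
        simp only [Function.comp]
        rw [← this]
      · exact ((measurable_linearMap F).comp (measurable_const.add (measurable_linearMap _))).prodMk
          (hπm.comp ((measurable_linearMap B).comp (measurable_const.add (measurable_linearMap _))))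
      · exact measurable_pi_lambda _ fun j => (measurable_pi_apply _).comp hZ
    -- Lebesgue measure is exchanged for an equivalent finite measure, so that it can act as a
    -- constant finite kernel.
    have hac3 := hac2.trans (Measure.AbsolutelyContinuous.rfl.prod
      (absolutelyContinuous_toFinite (volume : Measure (J (zeroSet d) → ℝ))))
    rw [← hjoint, ← Measure.compProd_const] at hac3
    have := hac3.kernel_of_compProd
    have h3 := ae_of_ae_map hFZ.aemeasurable this
    filter_upwards [h3] with ω hω
    rw [Kernel.const_apply, Kernel.map_apply _ hπm, Kernel.comap_apply] at hω
    exact hω.trans (toFinite_absolutelyContinuous _)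
  have hall : ∀ᵐ ω ∂P, ∀ d, D ω = d →
      (k (F (Z ω), d)).map (fun u (j : J (zeroSet d)) => u j) ≪ volume := by
    rw [ae_all_iff]
    intro d
    exact (ae_restrict_iff' (hD (measurableSet_singleton d))).1 (key d)
  filter_upwards [hall] with ω hω
  exact hω _ rfl

/-- Fatou's lemma: for almost every value of measurement and label the conditional law has lower
dimension at least `|J|`, the dimension of the residual subspace. -/
lemma lintegral_finrank_le_liminf (h : IsMixedVector P Z D dec) (B : (κ → ℝ) →ₗ[ℝ] (ι → ℝ))
    (F : (κ → ℝ) →ₗ[ℝ] E) :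
    ∫⁻ ω, (Module.finrank ℝ (residual B F (zeroSet (D ω))) : ℝ≥0∞) ∂P ≤
      liminf (fun q : ℕ => condEntropy P (fun ω => floorVec q (B (Z ω)))
        (fun ω => (F (Z ω), D ω)) / ENNReal.ofReal (Real.logb 2 q)) atTop := by
  have hZ := h.measurable_vec
  have hD := h.measurable_label
  have hBZ : Measurable fun ω => B (Z ω) := (measurable_linearMap B).comp hZ
  have hFZ : Measurable fun ω => F (Z ω) := (measurable_linearMap F).comp hZ
  choose J hJcard _ hJsurj using fun C : Finset κ => exists_coordinates (residual B F C)
  have hm : ∀ q : ℕ, Measurable fun ω => quantEntropy q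
      (condDistrib (fun ω => B (Z ω)) (fun ω => (F (Z ω), D ω)) P (F (Z ω), D ω)) := fun q =>
    (measurable_quantEntropy _ q).comp (hFZ.prodMk hD)
  have heq : ∀ q : ℕ, condEntropy P (fun ω => floorVec q (B (Z ω))) (fun ω => (F (Z ω), D ω)) /
      ENNReal.ofReal (Real.logb 2 q) = ∫⁻ ω, quantEntropy q
        (condDistrib (fun ω => B (Z ω)) (fun ω => (F (Z ω), D ω)) P (F (Z ω), D ω)) /
          ENNReal.ofReal (Real.logb 2 q) ∂P := fun q => by
    rw [condEntropy_floorVec_eq hBZ (hFZ.prodMk hD)]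
    simp_rw [div_eq_mul_inv]
    rw [lintegral_mul_const _ (hm q)]
  simp_rw [heq]
  refine le_trans (lintegral_mono_ae ?_) (lintegral_liminf_le fun q => (hm q).div_const _)
  filter_upwards [ae_absolutelyContinuous_condDistrib h B F J hJsurj] with ω hω
  rw [← hJcard]
  exact card_le_liminf_quantEntropy _ _ hω

/-- The conditional Rényi information dimension of linear images of a mixed vector. -/
theorem tendsto_condEntropy_floorVec (h : IsMixedVector P Z D dec) (B : (κ → ℝ) →ₗ[ℝ] (ι → ℝ))
    (F : (κ → ℝ) →ₗ[ℝ] E) :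
    Tendsto (fun q : ℕ => condEntropy P (fun ω => floorVec q (B (Z ω))) (fun ω => F (Z ω)) /
        ENNReal.ofReal (Real.logb 2 q)) atTop
      (𝓝 (∫⁻ ω, (Module.finrank ℝ (residual B F (zeroSet (D ω))) : ℝ≥0∞) ∂P)) := by
  have hZ := h.measurable_vec
  have hD := h.measurable_label
  have hBZ : Measurable fun ω => B (Z ω) := (measurable_linearMap B).comp hZ
  have hFZ : Measurable fun ω => F (Z ω) := (measurable_linearMap F).comp hZ
  have hfl : ∀ q, Measurable fun ω => floorVec q (B (Z ω)) := fun q =>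
    (measurable_floorVec q).comp hBZ
  obtain ⟨c, hc, hle⟩ := exists_condEntropy_label_le h B F
  set r := ∫⁻ ω, (Module.finrank ℝ (residual B F (zeroSet (D ω))) : ℝ≥0∞) ∂P
  have hup : ∀ᶠ q : ℕ in atTop, condEntropy P (fun ω => floorVec q (B (Z ω))) (fun ω => F (Z ω)) /
      ENNReal.ofReal (Real.logb 2 q) ≤ r + (entropy P D + c) / ENNReal.ofReal (Real.logb 2 q) := by
    filter_upwards [eventually_ge_atTop 2] with q hq
    have hlog : 0 < Real.logb 2 q := Real.logb_pos one_lt_two (by exact_mod_cast hq)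
    have h1 := condEntropy_le_add (P := P) hD (hfl q) hFZ
    have h2 := h1.trans (add_le_add le_rfl (hle q (by omega)))
    refine (ENNReal.div_le_div_right h2 _).trans_eq ?_
    rw [add_left_comm, ENNReal.add_div, mul_div_assoc, ENNReal.div_self (by simpa using hlog)
      ENNReal.ofReal_ne_top, mul_one]
  have hlim : Tendsto (fun q : ℕ => r + (entropy P D + c) / ENNReal.ofReal (Real.logb 2 q)) atTop
      (𝓝 r) := by
    have h1 : Tendsto (fun q : ℕ => (entropy P D + c) / ENNReal.ofReal (Real.logb 2 q)) atTop
        (𝓝 0) := by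
      have := ENNReal.Tendsto.const_div tendsto_log_atTop
        (Or.inr (ENNReal.add_ne_top.2 ⟨h.entropy_label, hc⟩))
      simpa using this
    simpa using h1.const_add r
  refine tendsto_of_le_liminf_of_limsup_le ?_ ?_
  · refine (lintegral_finrank_le_liminf h B F).trans (liminf_le_liminf ?_)
    refine Eventually.of_forall fun q => ENNReal.div_le_div_right ?_ _
    -- Withholding the label can only raise the entropy, so the lower bound is not affected by it.
    exact condEntropy_le_comp (hfl q) (hFZ.prodMk hD) measurable_fst
  · exact (limsup_le_limsup hup).trans hlim.limsup_eq.le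

end RID

end RenyiCompression

/-! ### Product measures, and labels for the discrete parts -/

namespace RenyiCompression

section PiMeasures

lemma pi_fin_absolutelyContinuous (n : ℕ) (μ ν : Fin n → Measure ℝ) [∀ i, SigmaFinite (μ i)]
    [∀ i, SigmaFinite (ν i)] (h : ∀ i, μ i ≪ ν i) : Measure.pi μ ≪ Measure.pi ν := by
  induction n with
  | zero => rw [Subsingleton.elim μ ν]
  | succ n ih =>
    rw [← (measurePreserving_piFinSuccAbove μ 0).symm.map_eq,
      ← (measurePreserving_piFinSuccAbove ν 0).symm.map_eq]
    exact ((h 0).prod (ih _ _ fun i => h _)).map (MeasurableEquiv.measurable _)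

lemma pi_absolutelyContinuous {κ : Type*} [Fintype κ] (μ ν : κ → Measure ℝ)
    [∀ i, SigmaFinite (μ i)] [∀ i, SigmaFinite (ν i)] (h : ∀ i, μ i ≪ ν i) :
    Measure.pi μ ≪ Measure.pi ν := by
  let e := (Fintype.equivFin κ).symm
  rw [← (measurePreserving_piCongrLeft μ e).map_eq, ← (measurePreserving_piCongrLeft ν e).map_eq]
  exact (pi_fin_absolutelyContinuous _ _ _ fun i => h _).map (MeasurableEquiv.measurable _)

/-- Projecting away the coordinates outside `C` only multiplies by their total mass. The factors are
merely finite because they will be restrictions to the event that the label takes a given value. -/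
lemma pi_map_restrict_absolutelyContinuous {κ : Type*} [Fintype κ] [DecidableEq κ]
    (μ : κ → Measure ℝ) [∀ i, IsFiniteMeasure (μ i)] (C : Finset κ)
    (h : ∀ j ∈ C, μ j ≪ volume) :
    (Measure.pi μ).map (fun z (j : C) => z j) ≪ volume := by
  have hp := measurePreserving_piEquivPiSubtypeProd μ (fun j => j ∈ C)
  have h1 : (Measure.pi μ).map (fun z (j : C) => z j) = ((Measure.pi μ).map
      (MeasurableEquiv.piEquivPiSubtypeProd (fun _ => ℝ) fun j => j ∈ C)).map Prod.fst := by
    rw [Measure.map_map measurable_fst (MeasurableEquiv.measurable _)]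
    rfl
  rw [h1, hp.map_eq, Measure.map_fst_prod]
  refine Measure.smul_absolutelyContinuous.trans ?_
  rw [volume_pi]
  convert pi_absolutelyContinuous (fun j : C => μ j) (fun _ => volume) fun j => h j j.2
  rfl

end PiMeasures

section Independence

variable {Ω : Type*} [MeasurableSpace Ω] {P : Measure Ω} [IsProbabilityMeasure P]

/-- Entropies of independent variables add up. -/
lemma entropy_pi_of_iIndepFun {κ α : Type*} [Fintype κ] [MeasurableSpace α] [Countable α]
    [MeasurableSingletonClass α] [Nonempty α] {V : Ω → κ → α} (hV : Measurable V)
    (h : iIndepFun (fun j ω => V ω j) P) :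
    entropy P V = ∑ j, entropy P (fun ω => V ω j) := by
  have hVj : ∀ j, Measurable fun ω => V ω j := fun j => (measurable_pi_apply j).comp hV
  have hpr : ∀ j, IsProbabilityMeasure (P.map fun ω => V ω j) := fun j =>
    Measure.isProbabilityMeasure_map (hVj j).aemeasurable
  have hlaw := (iIndepFun_iff_map_fun_eq_pi_map fun j => (hVj j).aemeasurable).1 h
  have hlaw' : P.map V = Measure.pi fun j => P.map fun ω => V ω j := hlaw
  rw [entropy_eq_lintegral_infoContent hV]
  simp_rw [entropy_eq_lintegral_infoContent (hVj _)]
  rw [← lintegral_finsetSum]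
  · refine lintegral_congr fun ω => ?_
    rw [hlaw', Measure.pi_singleton, infoContent_prod _ _ fun j _ => prob_le_one]
  · intro j _
    exact (measurable_of_countable fun a => infoContent (P.map (fun ω => V ω j) {a})).comp (hVj j)

end Independence

section Encoding

/-- A labelling of the points of a countable set by positive integers; `0` labels the others. -/
lemma exists_encoding {S : Set ℝ} (hS : S.Countable) :
    ∃ (enc : ℝ → ℕ) (dec : ℕ → ℝ), Measurable enc ∧ (∀ x, enc x = 0 ↔ x ∉ S) ∧
      ∀ x ∈ S, dec (enc x) = x := by
  classical
  obtain ⟨f, hf⟩ := Set.countable_iff_exists_injOn.1 hS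
  let enc : ℝ → ℕ := fun x => if x ∈ S then f x + 1 else 0
  have henc : ∀ x, enc x = 0 ↔ x ∉ S := fun x => by
    by_cases hx : x ∈ S <;> simp [enc, hx]
  refine ⟨enc, fun n => if h : ∃ x ∈ S, enc x = n then h.choose else 0, ?_, henc, ?_⟩
  · refine measurable_to_countable' fun n => ?_
    by_cases hn : n = 0
    · have : enc ⁻¹' {n} = Sᶜ := by ext x; simp [hn, henc]
      rw [this]; exact hS.measurableSet.compl
    · have : enc ⁻¹' {n} ⊆ S := fun x hx => by
        by_contra hxS
        exact hn (by rw [← (henc x).2 hxS]; exact hx.symm)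
      exact (hS.mono this).measurableSet
  · intro x hx
    have h : ∃ y ∈ S, enc y = enc x := ⟨x, hx, rfl⟩
    simp only [dif_pos h]
    obtain ⟨h1, h2⟩ := h.choose_spec
    refine hf h1 hx ?_
    have h3 : ∀ y ∈ S, enc y = f y + 1 := fun y hy => if_pos hy
    have h4 := h3 _ h1
    have h5 := h3 x hx
    omega

/-- All points outside `S` share the label `0`, which adds one finite term. Every other label
carries the mass of a single point of `S`, a term already present in the entropy of `ν`. -/
lemma atomEntropy_map_encoding_ne_top {ν : Measure ℝ} (hν : atomEntropy ν ≠ ∞)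
    {S : Set ℝ} {enc : ℝ → ℕ} {dec : ℕ → ℝ} (hm : Measurable enc)
    (h0 : ∀ x, enc x = 0 ↔ x ∉ S) (hdec : ∀ x ∈ S, dec (enc x) = x) :
    atomEntropy (ν.map enc) ≠ ∞ := by
  classical
  have hle : atomEntropy (ν.map enc) ≤ entTerm (ν.map enc {0}) + atomEntropy ν := by
    rw [atomEntropy_eq, ENNReal.tsum_eq_add_tsum_ite 0]
    gcongr
    let T : Set ℕ := {n | ∃ x ∈ S, enc x = n}
    have hinj : Function.Injective fun n : T => dec n := by
      rintro ⟨n, x, hx, rfl⟩ ⟨m, y, hy, rfl⟩ hxy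
      simp only [hdec x hx, hdec y hy] at hxy
      simp [hxy]
    calc _ ≤ ∑' n, T.indicator (fun n => entTerm (ν {dec n})) n := by
          refine ENNReal.tsum_le_tsum fun n => ?_
          split_ifs with hn
          · exact zero_le
          rw [Measure.map_apply hm (measurableSet_singleton n)]
          by_cases hT : n ∈ T
          · rw [Set.indicator_of_mem hT]
            obtain ⟨x, hx, rfl⟩ := hT
            have : enc ⁻¹' {enc x} = {dec (enc x)} := by
              ext y
              simp only [Set.mem_preimage, Set.mem_singleton_iff]
              refine ⟨fun hy => ?_, fun hy => by rw [hy, hdec x hx]⟩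
              have hyS : y ∈ S := by
                by_contra hyS
                exact hn (by rw [← hy]; exact (h0 y).2 hyS)
              rw [← hdec y hyS, hy]
            rw [this]
          · have : enc ⁻¹' {n} = ∅ := by
              ext y
              simp only [Set.mem_preimage, Set.mem_singleton_iff, Set.mem_empty_iff_false,
                iff_false]
              intro hy
              refine hT ⟨y, ?_, hy⟩
              by_contra hyS
              exact hn (by rw [← hy]; exact (h0 y).2 hyS)
            rw [this]; simp [entTerm_zero]
      _ = ∑' n : T, entTerm (ν {dec n}) := (tsum_subtype T fun n => entTerm (ν {dec n})).symm
      _ ≤ atomEntropy ν := ENNReal.tsum_comp_le_tsum_of_injective hinj fun s => entTerm (ν {s})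
  exact ne_top_of_le_ne_top (ENNReal.add_ne_top.2 ⟨entTerm_ne_top _, hν⟩) hle

/-- Independent nonsingular variables form a mixed vector. -/
lemma isMixedVector_pi {κ : Type*} [Fintype κ] [DecidableEq κ] {ν : κ → Measure ℝ}
    (hν : ∀ j, IsNonsingularLaw (ν j)) {S : κ → Set ℝ}
    (hac : ∀ j, (ν j).restrict (S j)ᶜ ≪ volume) {enc : κ → ℝ → ℕ} {dec : κ → ℕ → ℝ}
    (hm : ∀ j, Measurable (enc j)) (h0 : ∀ j x, enc j x = 0 ↔ x ∉ S j)
    (hdec : ∀ j, ∀ x ∈ S j, dec j (enc j x) = x) :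
    IsMixedVector (Measure.pi ν) (fun z => z) (fun z j => enc j (z j)) dec := by
  have hpr : ∀ j, IsProbabilityMeasure (ν j) := fun j => (hν j).prob
  have hD : Measurable fun (z : κ → ℝ) j => enc j (z j) :=
    measurable_pi_lambda _ fun j => (hm j).comp (measurable_pi_apply j)
  have heval : ∀ j, (Measure.pi ν).map (fun z => z j) = ν j := fun j =>
    (measurePreserving_eval ν j).map_eq
  refine ⟨measurable_id, hD, fun j => ?_, ?_, ?_, fun d => ?_⟩
  · have h2 : Integrable (fun x : ℝ => x) (ν j) := (hν j).secondMoment.integrable (by norm_num)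
    exact (measurePreserving_eval ν j).integrable_comp_of_integrable h2
  · rw [entropy_pi_of_iIndepFun hD]
    · refine ENNReal.sum_ne_top.2 fun j _ => ?_
      rw [entropy]
      have : (Measure.pi ν).map (fun z => enc j (z j)) = (ν j).map (enc j) := by
        rw [← heval j, Measure.map_map (hm j) (measurable_pi_apply j)]
        rfl
      rw [this]
      exact atomEntropy_map_encoding_ne_top (hν j).discreteEntropy (hm j) (h0 j) (hdec j)
    · exact iIndepFun_pi fun j => (hm j).aemeasurable
  · refine Eventually.of_forall fun z j hj => (hdec j _ ?_).symm
    by_contra h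
    exact hj ((h0 j _).2 h)
  · have hpre : (fun (z : κ → ℝ) j => enc j (z j)) ⁻¹' {d} =
        Set.univ.pi fun j => enc j ⁻¹' {d j} := by
      ext z; simp [funext_iff]
    rw [hpre, Measure.restrict_pi_pi]
    refine pi_map_restrict_absolutelyContinuous _ _ fun j hj => ?_
    have hj0 : d j = 0 := by simpa [zeroSet] using hj
    have : enc j ⁻¹' {d j} = (S j)ᶜ := by
      ext x; simp [hj0, h0]
    rw [this]
    exact hac j

end Encoding

end RenyiCompression

/-! ### Hadamard rows under doubling, and the erasure recursion -/

namespace RenyiCompression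

section Hadamard

/-- The two halves of the index set of order `2 ^ (n + 1)`. -/
def halves (n : ℕ) : Fin (2 ^ n) ⊕ Fin (2 ^ n) ≃ Fin (2 ^ (n + 1)) :=
  finSumFinEquiv.trans (finCongr (by rw [pow_succ, mul_two]))

lemma hadamard_succ (n : ℕ) (a b : Fin (2 ^ n) ⊕ Fin (2 ^ n)) :
    hadamard (n + 1) (halves n a) (halves n b) = Matrix.fromBlocks (hadamard n) (hadamard n)
      (hadamard n) (-hadamard n) a b := by
  have : hadamard (n + 1) = Matrix.reindex (halves n) (halves n)
      (Matrix.fromBlocks (hadamard n) (hadamard n) (hadamard n) (-hadamard n)) := rfl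
  rw [this]
  simp

lemma sum_halves {n : ℕ} {M : Type*} [AddCommMonoid M] (f : Fin (2 ^ (n + 1)) → M) :
    ∑ i, f i = ∑ i, f (halves n (.inl i)) + ∑ i, f (halves n (.inr i)) := by
  rw [← (halves n).sum_comp, Fintype.sum_sum_type]

lemma forall_halves {n : ℕ} {p : Fin (2 ^ (n + 1)) → Prop} :
    (∀ i, p i) ↔ (∀ i, p (halves n (.inl i))) ∧ ∀ i, p (halves n (.inr i)) := by
  rw [← (halves n).forall_congr_right, Sum.forall]

lemma hadamard_mulVec_inl {n : ℕ} (v : Fin (2 ^ (n + 1)) → ℝ) (i : Fin (2 ^ n)) :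
    (hadamard (n + 1)).mulVec v (halves n (.inl i)) =
      (hadamard n).mulVec (fun j => v (halves n (.inl j))) i +
        (hadamard n).mulVec (fun j => v (halves n (.inr j))) i := by
  simp only [Matrix.mulVec, dotProduct]
  rw [sum_halves]
  simp [hadamard_succ]

lemma hadamard_mulVec_inr {n : ℕ} (v : Fin (2 ^ (n + 1)) → ℝ) (i : Fin (2 ^ n)) :
    (hadamard (n + 1)).mulVec v (halves n (.inr i)) =
      (hadamard n).mulVec (fun j => v (halves n (.inl j))) i -
        (hadamard n).mulVec (fun j => v (halves n (.inr j))) i := by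
  simp only [Matrix.mulVec, dotProduct]
  rw [sum_halves]
  simp [hadamard_succ, sub_eq_add_neg]

lemma hadamard_mulVec_injective {n : ℕ} {v : Fin (2 ^ n) → ℝ}
    (h : ∀ i, (hadamard n).mulVec v i = 0) : v = 0 := by
  induction n with
  | zero =>
    ext j
    have := h j
    simp only [Matrix.mulVec, dotProduct, hadamard] at this
    have hs : ∀ i : Fin (2 ^ 0), i = j := fun i => by
      apply Fin.ext; have := i.2; have := j.2; simp at *
    rw [Finset.sum_eq_single j (fun i _ hi => absurd (hs i) hi)
      (fun h => absurd (Finset.mem_univ j) h), one_mul] at this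
    exact this
  | succ n ih =>
    obtain ⟨h1, h2⟩ := forall_halves.1 h
    simp only [hadamard_mulVec_inl, hadamard_mulVec_inr] at h1 h2
    have h3 := ih (v := fun j => v (halves n (.inl j))) fun i => by linarith [h1 i, h2 i]
    have h4 := ih (v := fun j => v (halves n (.inr j))) fun i => by linarith [h1 i, h2 i]
    ext i
    revert i
    exact forall_halves.2 ⟨congrFun h3, congrFun h4⟩

end Hadamard

section IidSum

variable {A : Type*} [Fintype A]

/-- The word of length `2 ^ (n + 1)` with given halves. -/
def glue {A : Type*} {n : ℕ} (c₁ c₂ : Fin (2 ^ n) → A) : Fin (2 ^ (n + 1)) → A :=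
  fun j => Sum.elim c₁ c₂ ((halves n).symm j)

@[simp] lemma glue_inl {A : Type*} {n : ℕ} (c₁ c₂ : Fin (2 ^ n) → A) (j : Fin (2 ^ n)) :
    glue c₁ c₂ (halves n (.inl j)) = c₁ j := by simp [glue]

@[simp] lemma glue_inr {A : Type*} {n : ℕ} (c₁ c₂ : Fin (2 ^ n) → A) (j : Fin (2 ^ n)) :
    glue c₁ c₂ (halves n (.inr j)) = c₂ j := by simp [glue]

/-- The equivalence between pairs of words and words of double length. -/
def glueEquiv (A : Type*) (n : ℕ) :
    (Fin (2 ^ n) → A) × (Fin (2 ^ n) → A) ≃ (Fin (2 ^ (n + 1)) → A) where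
  toFun c := glue c.1 c.2
  invFun c := (fun j => c (halves n (.inl j)), fun j => c (halves n (.inr j)))
  left_inv c := by simp
  right_inv c := by
    funext i
    revert i
    exact forall_halves.2 ⟨fun i => by simp, fun i => by simp⟩

/-- The weight of a word with independent letters of weights `w`. -/
def wordWeight {ι : Type*} [Fintype ι] (w : A → ℝ) (c : ι → A) : ℝ := ∏ i, w (c i)

lemma wordWeight_nonneg {ι : Type*} [Fintype ι] {w : A → ℝ} (hw : ∀ a, 0 ≤ w a) (c : ι → A) :
    0 ≤ wordWeight w c := Finset.prod_nonneg fun _ _ => hw _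

lemma sum_wordWeight {ι : Type*} [Fintype ι] [DecidableEq ι] {w : A → ℝ} (hw : ∑ a, w a = 1) :
    ∑ c : ι → A, wordWeight w c = 1 := by
  unfold wordWeight
  rw [← Fintype.piFinset_univ, Finset.sum_prod_piFinset]
  simp [hw]

lemma wordWeight_glue {n : ℕ} (w : A → ℝ) (c₁ c₂ : Fin (2 ^ n) → A) :
    wordWeight w (glue c₁ c₂) = wordWeight w c₁ * wordWeight w c₂ := by
  unfold wordWeight
  rw [← (halves n).prod_comp, Fintype.prod_sum_type]
  simp

lemma sum_glue {n : ℕ} {M : Type*} [AddCommMonoid M] (f : (Fin (2 ^ (n + 1)) → A) → M) :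
    ∑ c, f c = ∑ x : (Fin (2 ^ n) → A) × (Fin (2 ^ n) → A), f (glue x.1 x.2) :=
  ((glueEquiv A n).sum_comp f).symm

end IidSum

section Innovation

variable {A T : Type*}

/-- The value of row `i` of the Hadamard matrix on the `t`-th components of `v`. -/
def rowVal {n : ℕ} (v : Fin (2 ^ n) → T → ℝ) (t : T) (i : Fin (2 ^ n)) : ℝ :=
  (hadamard n).mulVec (fun j => v j t) i

/-- With respect to the order `τ` of the measurements `(t, i)`, the measurement `x` is not
determined by the earlier ones on the vectors `v` with `v j ∈ S (c j)`. -/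
def Innovative (S : A → Submodule ℝ (T → ℝ)) {n : ℕ} (τ : T × Fin (2 ^ n) → ℕ)
    (c : Fin (2 ^ n) → A) (x : T × Fin (2 ^ n)) : Prop :=
  ∃ v : Fin (2 ^ n) → T → ℝ, (∀ j, v j ∈ S (c j)) ∧
    (∀ y, τ y < τ x → rowVal v y.1 y.2 = 0) ∧ rowVal v x.1 x.2 ≠ 0

/-- The order of the measurements of double length induced by `τ`. -/
def doubleOrder {n : ℕ} (τ : T × Fin (2 ^ n) → ℕ) (x : T × Fin (2 ^ (n + 1))) : ℕ :=
  Sum.elim (fun i => 2 * τ (x.1, i)) (fun i => 2 * τ (x.1, i) + 1) ((halves n).symm x.2)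

@[simp] lemma doubleOrder_inl {n : ℕ} (τ : T × Fin (2 ^ n) → ℕ) (t : T) (i : Fin (2 ^ n)) :
    doubleOrder τ (t, halves n (.inl i)) = 2 * τ (t, i) := by simp [doubleOrder]

@[simp] lemma doubleOrder_inr {n : ℕ} (τ : T × Fin (2 ^ n) → ℕ) (t : T) (i : Fin (2 ^ n)) :
    doubleOrder τ (t, halves n (.inr i)) = 2 * τ (t, i) + 1 := by simp [doubleOrder]

lemma doubleOrder_injective {n : ℕ} {τ : T × Fin (2 ^ n) → ℕ} (hτ : Function.Injective τ) :
    Function.Injective (doubleOrder τ) := by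
  rintro ⟨t, i⟩ ⟨s, j⟩ h
  obtain ⟨i, rfl⟩ := (halves n).surjective i
  obtain ⟨j, rfl⟩ := (halves n).surjective j
  rcases i with i | i <;> rcases j with j | j <;>
    simp only [doubleOrder_inl, doubleOrder_inr] at h
  · have := hτ (by omega : τ (t, i) = τ (s, j))
    simp_all
  · omega
  · omega
  · have := hτ (by omega : τ (t, i) = τ (s, j))
    simp_all

lemma rowVal_glue_inl {n : ℕ} (v₁ v₂ : Fin (2 ^ n) → T → ℝ) (t : T) (i : Fin (2 ^ n)) :
    rowVal (glue v₁ v₂) t (halves n (.inl i)) = rowVal v₁ t i + rowVal v₂ t i := by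
  simp [rowVal, hadamard_mulVec_inl]

lemma rowVal_glue_inr {n : ℕ} (v₁ v₂ : Fin (2 ^ n) → T → ℝ) (t : T) (i : Fin (2 ^ n)) :
    rowVal (glue v₁ v₂) t (halves n (.inr i)) = rowVal v₁ t i - rowVal v₂ t i := by
  simp [rowVal, hadamard_mulVec_inr]

lemma rowVal_zero {n : ℕ} (t : T) (i : Fin (2 ^ n)) :
    rowVal (0 : Fin (2 ^ n) → T → ℝ) t i = 0 := by
  have : (fun _ : Fin (2 ^ n) => (0 : ℝ)) = 0 := rfl
  simp [rowVal, this]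

lemma rowVal_smul {n : ℕ} (a : ℝ) (v : Fin (2 ^ n) → T → ℝ) (t : T) (i : Fin (2 ^ n)) :
    rowVal (a • v) t i = a * rowVal v t i := by
  have : (fun j => (a • v) j t) = a • fun j => v j t := rfl
  rw [rowVal, this, Matrix.mulVec_smul]
  rfl

lemma exists_glue {n : ℕ} {p : (Fin (2 ^ (n + 1)) → T → ℝ) → Prop} :
    (∃ v, p v) ↔ ∃ v₁ v₂, p (glue v₁ v₂) := by
  constructor
  · rintro ⟨v, hv⟩
    refine ⟨fun j => v (halves n (.inl j)), fun j => v (halves n (.inr j)), ?_⟩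
    have := (glueEquiv (T → ℝ) n).apply_symm_apply v
    change glue _ _ = v at this
    rwa [← this] at hv
  · rintro ⟨v₁, v₂, h⟩
    exact ⟨_, h⟩

variable {S : A → Submodule ℝ (T → ℝ)} {n : ℕ} {τ : T × Fin (2 ^ n) → ℕ}
  {c₁ c₂ : Fin (2 ^ n) → A}

lemma forall_label {p : T × Fin (2 ^ (n + 1)) → Prop} :
    (∀ y, p y) ↔ ∀ y : T × Fin (2 ^ n), p (y.1, halves n (.inl y.2)) ∧
      p (y.1, halves n (.inr y.2)) := by
  simp only [Prod.forall]
  exact forall_congr' fun t => forall_halves.trans forall_and.symm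

/-- An earlier row of the half-length order contributes both its sum and its difference, so it must
vanish on both halves. A sum that is then nonzero needs one half on which row `(t, i)` survives;
conversely the other half can be set to zero. -/
lemma innovative_inl (t : T) (i : Fin (2 ^ n)) :
    Innovative S (doubleOrder τ) (glue c₁ c₂) (t, halves n (.inl i)) ↔
      Innovative S τ c₁ (t, i) ∨ Innovative S τ c₂ (t, i) := by
  unfold Innovative
  rw [exists_glue]
  simp only [forall_halves (n := n), forall_label, glue_inl, glue_inr, doubleOrder_inl,
    doubleOrder_inr, rowVal_glue_inl, rowVal_glue_inr, Prod.mk.eta]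
  constructor
  · rintro ⟨v₁, v₂, ⟨h1, h2⟩, hp, hne⟩
    have hp1 : ∀ y : T × Fin (2 ^ n), τ y < τ (t, i) →
        rowVal v₁ y.1 y.2 = 0 ∧ rowVal v₂ y.1 y.2 = 0 := fun y hy => by
      have h3 := (hp y).1 (by omega)
      have h4 := (hp y).2 (by omega)
      constructor <;> linarith
    by_cases h : rowVal v₁ t i = 0
    · exact Or.inr ⟨v₂, h2, fun y hy => (hp1 y hy).2, fun h' => hne (by rw [h, h', add_zero])⟩
    · exact Or.inl ⟨v₁, h1, fun y hy => (hp1 y hy).1, h⟩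
  · rintro (⟨v, h1, hp, hne⟩ | ⟨v, h1, hp, hne⟩)
    · refine ⟨v, 0, ⟨h1, fun j => (S _).zero_mem⟩, fun y => ⟨fun hy => ?_, fun hy => ?_⟩, ?_⟩
      · rw [hp y (by omega), rowVal_zero, add_zero]
      · rw [hp y (by omega), rowVal_zero, sub_zero]
      · rwa [rowVal_zero, add_zero]
    · refine ⟨0, v, ⟨fun j => (S _).zero_mem, h1⟩, fun y => ⟨fun hy => ?_, fun hy => ?_⟩, ?_⟩
      · rw [hp y (by omega), rowVal_zero, add_zero]
      · rw [hp y (by omega), rowVal_zero, sub_zero]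
      · rwa [rowVal_zero, zero_add]

/-- Here the sum of row `(t, i)` is itself an earlier measurement, so the two values are opposite,
and their difference is nonzero iff both are. Injectivity of `τ` ensures that no other row shares
the position of `(t, i)`. -/
lemma innovative_inr (hτ : Function.Injective τ) (t : T) (i : Fin (2 ^ n)) :
    Innovative S (doubleOrder τ) (glue c₁ c₂) (t, halves n (.inr i)) ↔
      Innovative S τ c₁ (t, i) ∧ Innovative S τ c₂ (t, i) := by
  unfold Innovative
  rw [exists_glue]
  simp only [forall_halves (n := n), forall_label, glue_inl, glue_inr, doubleOrder_inl,
    doubleOrder_inr, rowVal_glue_inl, rowVal_glue_inr, Prod.mk.eta]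
  constructor
  · rintro ⟨v₁, v₂, ⟨h1, h2⟩, hp, hne⟩
    have hp1 : ∀ y : T × Fin (2 ^ n), τ y < τ (t, i) →
        rowVal v₁ y.1 y.2 = 0 ∧ rowVal v₂ y.1 y.2 = 0 := fun y hy => by
      have h3 := (hp y).1 (by omega)
      have h4 := (hp y).2 (by omega)
      constructor <;> linarith
    have h0 := (hp (t, i)).1 (by omega)
    simp only at h0
    refine ⟨⟨v₁, h1, fun y hy => (hp1 y hy).1, fun h => hne ?_⟩,
      ⟨v₂, h2, fun y hy => (hp1 y hy).2, fun h => hne ?_⟩⟩ <;> linarith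
  · rintro ⟨⟨v, h1, hp1, hne1⟩, ⟨u, h2, hp2, hne2⟩⟩
    set a := rowVal v t i with ha
    set b := rowVal u t i with hb
    -- The cross-scaling makes the two values `ab` and `-ab`: the sum vanishes and the difference is
    -- `2ab`.
    refine ⟨b • v, (-a) • u, ⟨fun j => (S _).smul_mem _ (h1 j), fun j => (S _).smul_mem _ (h2 j)⟩,
      fun y => ⟨fun hy => ?_, fun hy => ?_⟩, ?_⟩
    · rw [rowVal_smul, rowVal_smul]
      by_cases hy' : τ y < τ (t, i)
      · rw [hp1 y hy', hp2 y hy']; ring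
      · have : y = (t, i) := hτ (by omega)
        rw [this]
        simp only [← ha, ← hb]; ring
    · rw [rowVal_smul, rowVal_smul, hp1 y (by omega), hp2 y (by omega)]; ring
    · rw [rowVal_smul, rowVal_smul, ← ha, ← hb]
      have : b * a - -a * b = 2 * (a * b) := by ring
      rw [this]
      exact mul_ne_zero two_ne_zero (mul_ne_zero hne1 hne2)

end Innovation

section Polarization

variable {A T : Type*} [Fintype A]

open Classical in
/-- The probability that the measurement `x` is innovative, for independent letters of
weights `w`. -/
def innovation (w : A → ℝ) (S : A → Submodule ℝ (T → ℝ)) {n : ℕ} (τ : T × Fin (2 ^ n) → ℕ)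
    (x : T × Fin (2 ^ n)) : ℝ :=
  ∑ c : Fin (2 ^ n) → A, wordWeight w c * if Innovative S τ c x then 1 else 0

variable {w : A → ℝ} (hw : ∀ a, 0 ≤ w a) (hw1 : ∑ a, w a = 1) {S : A → Submodule ℝ (T → ℝ)}
  {n : ℕ} {τ : T × Fin (2 ^ n) → ℕ}

include hw in
lemma innovation_nonneg (x : T × Fin (2 ^ n)) : 0 ≤ innovation w S τ x :=
  Finset.sum_nonneg fun c _ => mul_nonneg (wordWeight_nonneg hw c) (by split_ifs <;> norm_num)

include hw hw1 in
lemma innovation_le_one (x : T × Fin (2 ^ n)) : innovation w S τ x ≤ 1 := by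
  rw [← sum_wordWeight (ι := Fin (2 ^ n)) hw1]
  exact Finset.sum_le_sum fun c _ =>
    mul_le_of_le_one_right (wordWeight_nonneg hw c) (by split_ifs <;> norm_num)

/-- The two halves are independent words, so "both innovative" has the squared probability; "one of
them" gives `2x - x²` in `innovation_inl`. -/
lemma innovation_inr (hτ : Function.Injective τ) (t : T) (i : Fin (2 ^ n)) :
    innovation w S (doubleOrder τ) (t, halves n (.inr i)) = innovation w S τ (t, i) ^ 2 := by
  classical
  unfold innovation
  rw [sum_glue, pow_two, Finset.sum_mul_sum, ← Finset.sum_product']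
  refine Finset.sum_congr rfl fun x _ => ?_
  simp only [wordWeight_glue, innovative_inr hτ]
  by_cases h1 : Innovative S τ x.1 (t, i) <;> by_cases h2 : Innovative S τ x.2 (t, i) <;>
    simp [h1, h2]

include hw1 in
lemma innovation_inl (t : T) (i : Fin (2 ^ n)) :
    innovation w S (doubleOrder τ) (t, halves n (.inl i)) =
      2 * innovation w S τ (t, i) - innovation w S τ (t, i) ^ 2 := by
  classical
  have h1 := sum_wordWeight (ι := Fin (2 ^ n)) hw1
  have h : 2 * innovation w S τ (t, i) - innovation w S τ (t, i) ^ 2 =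
      innovation w S τ (t, i) * (∑ c : Fin (2 ^ n) → A, wordWeight w c) +
      (∑ c : Fin (2 ^ n) → A, wordWeight w c) * innovation w S τ (t, i) -
      innovation w S τ (t, i) * innovation w S τ (t, i) := by rw [h1]; ring
  rw [h]
  unfold innovation
  rw [sum_glue, Finset.sum_mul_sum, Finset.sum_mul_sum, Finset.sum_mul_sum,
    ← Finset.sum_product', ← Finset.sum_product', ← Finset.sum_product',
    ← Finset.sum_add_distrib, ← Finset.sum_sub_distrib]
  refine Finset.sum_congr rfl fun x _ => ?_
  simp only [wordWeight_glue, innovative_inl]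
  by_cases h1 : Innovative S τ x.1 (t, i) <;> by_cases h2 : Innovative S τ x.2 (t, i) <;>
    simp [h1, h2]

end Polarization

end RenyiCompression

/-! ### Counting dimensions by pivots, polarization and selection of rows -/

namespace RenyiCompression

section Pivots

/-- For functionals `f` processed in the order `τ`, the functional `y` is the first one that does
not vanish at some element of `K`. -/
def IsPivot {V Λ : Type*} [AddCommGroup V] [Module ℝ V] (f : Λ → V →ₗ[ℝ] ℝ) (τ : Λ → ℕ)
    (K : Submodule ℝ V) (y : Λ) : Prop :=
  ∃ v ∈ K, (∀ z, τ z < τ y → f z v = 0) ∧ f y v ≠ 0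

lemma finrank_inf_ker_add_one {V : Type*} [AddCommGroup V] [Module ℝ V] [FiniteDimensional ℝ V]
    (f : V →ₗ[ℝ] ℝ) (K : Submodule ℝ V) {v : V} (hv : v ∈ K) (hf : f v ≠ 0) :
    Module.finrank ℝ (K ⊓ LinearMap.ker f : Submodule ℝ V) + 1 = Module.finrank ℝ K := by
  have h := LinearMap.finrank_range_add_finrank_ker (f.domRestrict K)
  have h1 : LinearMap.range (f.domRestrict K) = ⊤ := by
    refine LinearMap.range_eq_top.2 (LinearMap.surjective ?_)
    intro h0
    exact hf (by simpa using LinearMap.congr_fun h0 ⟨v, hv⟩)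
  have h2 : LinearMap.ker (f.domRestrict K) = (LinearMap.ker f).comap K.subtype := by
    ext x; simp
  rw [h1, finrank_top, Module.finrank_self, h2] at h
  have h3 := (Submodule.comapSubtypeEquivOfLe
    (inf_le_left : K ⊓ LinearMap.ker f ≤ K)).finrank_eq
  have h4 : (K ⊓ LinearMap.ker f).comap K.subtype = (LinearMap.ker f).comap K.subtype := by
    ext x; simp
  rw [h4] at h3
  omega

open Classical in
-- Gaussian elimination: imposing the equations `f z = 0` in the order `τ` lowers the dimension by
-- one exactly at the pivots, and ends at zero because the functionals separate points.
lemma finrank_eq_card_pivots {V Λ : Type*} [AddCommGroup V] [Module ℝ V] [FiniteDimensional ℝ V]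
    [Fintype Λ] {f : Λ → V →ₗ[ℝ] ℝ} (hf : ∀ v, (∀ z, f z v = 0) → v = 0) {τ : Λ → ℕ}
    (hτ : Function.Injective τ) (K : Submodule ℝ V) :
    Module.finrank ℝ K = (Finset.univ.filter (IsPivot f τ K)).card := by
  obtain ⟨M, hM⟩ : ∃ M, ∀ z, τ z < M :=
    ⟨Finset.univ.sup τ + 1, fun z => Nat.lt_succ_of_le (Finset.le_sup (Finset.mem_univ z))⟩
  -- Induction on the number `k` of positions left to process. `K` varies: it is the subspace that
  -- remains after the equations at positions below `m` have been imposed.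
  suffices h : ∀ k m, M ≤ m + k → ∀ K : Submodule ℝ V,
      (∀ v ∈ K, ∀ z, τ z < m → f z v = 0) →
        Module.finrank ℝ K = (Finset.univ.filter (IsPivot f τ K)).card from
    h M 0 (by omega) K (fun _ _ _ h => absurd h (Nat.not_lt_zero _))
  intro k
  induction k with
  | zero =>
    intro m hm K hK
    have h0 : K = ⊥ := (Submodule.eq_bot_iff _).2 fun v hv =>
      hf v fun z => hK v hv z ((hM z).trans_le hm)
    subst h0
    rw [finrank_bot, eq_comm, Finset.card_eq_zero, Finset.filter_eq_empty_iff]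
    rintro y - ⟨v, hv, -, hne⟩
    rw [(Submodule.mem_bot ℝ).1 hv, map_zero] at hne
    exact hne rfl
  | succ k ih =>
    intro m hm K hK
    by_cases h : ∃ y, τ y = m ∧ ∃ v ∈ K, f y v ≠ 0
    · obtain ⟨y, hy, v, hv, hne⟩ := h
      rw [← finrank_inf_ker_add_one (f y) K hv hne, ih (m + 1) (by omega)]
      -- `y` is the pivot at position `m`; the others are the pivots of the smaller space, since a
      -- functional later than `y` sees only vectors on which `f y` vanishes.
      · have hins : Finset.univ.filter (IsPivot f τ K) =
            insert y (Finset.univ.filter (IsPivot f τ (K ⊓ LinearMap.ker (f y)))) := by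
          ext z
          simp only [Finset.mem_filter, Finset.mem_univ, true_and, Finset.mem_insert]
          constructor
          · rintro ⟨u, hu, hlt, hz⟩
            refine or_iff_not_imp_left.2 fun hzy => ⟨u, ⟨hu, ?_⟩, hlt, hz⟩
            refine hlt y (lt_of_le_of_ne ?_ fun h => hzy (hτ h.symm))
            by_contra h
            exact hz (hK u hu z (by omega))
          · rintro (rfl | ⟨u, hu, hlt, hz⟩)
            · exact ⟨v, hv, fun z hz => hK v hv z (by omega), hne⟩
            · exact ⟨u, hu.1, hlt, hz⟩
        rw [hins, Finset.card_insert_of_notMem]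
        simp only [Finset.mem_filter, Finset.mem_univ, true_and]
        rintro ⟨u, hu, -, hz⟩
        exact hz hu.2
      · intro u hu z hz
        rcases Nat.lt_succ_iff_lt_or_eq.1 hz with h | h
        · exact hK u hu.1 z h
        · rw [hτ (h.trans hy.symm)]; exact hu.2
    · push Not at h
      refine ih (m + 1) (by omega) K fun v hv z hz => ?_
      rcases Nat.lt_succ_iff_lt_or_eq.1 hz with h' | h'
      · exact hK v hv z h'
      · exact h z h' v hv

end Pivots

section Unresolved

variable {A T : Type*} [Fintype T]

/-- `rowVal` as a linear functional. -/
def rowFun {n : ℕ} (y : T × Fin (2 ^ n)) : (Fin (2 ^ n) → T → ℝ) →ₗ[ℝ] ℝ where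
  toFun v := rowVal v y.1 y.2
  map_add' u v := by
    have : (fun j => (u + v) j y.1) = (fun j => u j y.1) + fun j => v j y.1 := rfl
    rw [rowVal, this, Matrix.mulVec_add]
    rfl
  map_smul' a v := rowVal_smul a v _ _

/-- The vectors `v` with `v j ∈ S (c j)` on which the rows in `R t`, applied to the `t`-th
components, vanish. -/
def unresolved (S : A → Submodule ℝ (T → ℝ)) {n : ℕ} (R : T → Finset (Fin (2 ^ n)))
    (c : Fin (2 ^ n) → A) : Submodule ℝ (Fin (2 ^ n) → T → ℝ) :=
  Submodule.pi Set.univ (fun j => S (c j)) ⊓ ⨅ t, ⨅ i ∈ R t, LinearMap.ker (rowFun (t, i))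

lemma mem_unresolved {S : A → Submodule ℝ (T → ℝ)} {n : ℕ} {R : T → Finset (Fin (2 ^ n))}
    {c : Fin (2 ^ n) → A} {v : Fin (2 ^ n) → T → ℝ} :
    v ∈ unresolved S R c ↔ (∀ j, v j ∈ S (c j)) ∧ ∀ t, ∀ i ∈ R t, rowVal v t i = 0 := by
  simp [unresolved, Submodule.mem_pi, rowFun]

lemma eq_zero_of_rowVal {n : ℕ} {v : Fin (2 ^ n) → T → ℝ} (h : ∀ t i, rowVal v t i = 0) :
    v = 0 := by
  ext j t
  exact congrFun (hadamard_mulVec_injective (h t)) j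

variable {S : A → Submodule ℝ (T → ℝ)} {n : ℕ} {τ : T × Fin (2 ^ n) → ℕ}

open Classical in
lemma finrank_unresolved_empty (hτ : Function.Injective τ) (c : Fin (2 ^ n) → A) :
    Module.finrank ℝ (unresolved S (fun _ => ∅) c) =
      (Finset.univ.filter (Innovative S τ c)).card := by
  rw [finrank_eq_card_pivots (f := rowFun) (fun v h => eq_zero_of_rowVal fun t i => h (t, i)) hτ]
  congr 1
  ext y
  simp only [Finset.mem_filter, Finset.mem_univ, true_and, IsPivot, Innovative]
  refine exists_congr fun v => ?_
  rw [mem_unresolved]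
  simp [rowFun]

open Classical in
-- A pivot of the unresolved space is innovative, and it is not a measured row, since those vanish
-- on that space.
lemma finrank_unresolved_le (hτ : Function.Injective τ) (R : T → Finset (Fin (2 ^ n)))
    (c : Fin (2 ^ n) → A) :
    Module.finrank ℝ (unresolved S R c) ≤
      (Finset.univ.filter fun y => y.2 ∉ R y.1 ∧ Innovative S τ c y).card := by
  rw [finrank_eq_card_pivots (f := rowFun) (fun v h => eq_zero_of_rowVal fun t i => h (t, i)) hτ]
  refine Finset.card_le_card fun y => ?_
  simp only [Finset.mem_filter, Finset.mem_univ, true_and]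
  rintro ⟨v, hv, hlt, hne⟩
  rw [mem_unresolved] at hv
  exact ⟨fun h => hne (hv.2 _ _ h), v, hv.1, fun z hz => hlt z hz, hne⟩

variable [Fintype A] {w : A → ℝ}

/-- The right side does not involve `τ`: every order splits the same total among the two terminals.
This yields the sum constraint of the rate region. -/
lemma sum_innovation (hτ : Function.Injective τ) :
    ∑ t, ∑ i, innovation w S τ (t, i) =
      ∑ c : Fin (2 ^ n) → A,
        wordWeight w c * (Module.finrank ℝ (unresolved S (fun _ => ∅) c) : ℝ) := by
  classical
  rw [← Fintype.sum_prod_type']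
  simp only [innovation]
  rw [Finset.sum_comm]
  refine Finset.sum_congr rfl fun c _ => ?_
  rw [finrank_unresolved_empty hτ, ← Finset.mul_sum]
  congr 1
  rw [Finset.card_filter]
  push_cast
  exact Finset.sum_congr rfl fun y _ => by congr

lemma sum_finrank_unresolved_le (hw : ∀ a, 0 ≤ w a) (hτ : Function.Injective τ)
    (R : T → Finset (Fin (2 ^ n))) :
    ∑ c, wordWeight w c * (Module.finrank ℝ (unresolved S R c) : ℝ) ≤
      ∑ t, ∑ i ∈ (R t)ᶜ, innovation w S τ (t, i) := by
  classical
  have h : ∀ t, ∑ i ∈ (R t)ᶜ, innovation w S τ (t, i) =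
      ∑ i, if i ∉ R t then innovation w S τ (t, i) else 0 := fun t => by
    rw [← Finset.sum_filter]
    congr 1
    ext; simp
  simp only [h]
  rw [← Fintype.sum_prod_type' (f := fun t i => if i ∉ R t then innovation w S τ (t, i) else 0)]
  have h' : ∀ x : T × Fin (2 ^ n), (if x.2 ∉ R x.1 then innovation w S τ (x.1, x.2) else 0) =
      ∑ c : Fin (2 ^ n) → A, wordWeight w c *
        if x.2 ∉ R x.1 ∧ Innovative S τ c x then 1 else 0 := fun x => by
    by_cases hx : x.2 ∉ R x.1 <;> simp [hx, innovation]
  simp only [h']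
  rw [Finset.sum_comm]
  refine Finset.sum_le_sum fun c _ => ?_
  rw [← Finset.mul_sum]
  refine mul_le_mul_of_nonneg_left ?_ (wordWeight_nonneg hw c)
  have := finrank_unresolved_le (S := S) hτ R c
  rw [Finset.card_filter] at this
  calc (Module.finrank ℝ (unresolved S R c) : ℝ) ≤ _ := Nat.cast_le.2 this
    _ = _ := by push_cast; exact Finset.sum_congr rfl fun y _ => by congr

end Unresolved

section Doubling

variable {A T : Type*} [Fintype A] {w : A → ℝ} {S : A → Submodule ℝ (T → ℝ)} {n : ℕ}

/-- `(2x - x²) + x² = 2x`: doubling preserves the rate of each terminal separately. -/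
lemma sum_innovation_double (hw1 : ∑ a, w a = 1) {τ : T × Fin (2 ^ n) → ℕ}
    (hτ : Function.Injective τ) (t : T) :
    ∑ i, innovation w S (doubleOrder τ) (t, i) = 2 * ∑ i, innovation w S τ (t, i) := by
  rw [sum_halves, ← Finset.sum_add_distrib, Finset.mul_sum]
  refine Finset.sum_congr rfl fun i _ => ?_
  rw [innovation_inl hw1, innovation_inr hτ]
  ring

/-- The normalized second moment grows by exactly the mean of `(x(1 - x))²`, which measures the lack
of polarization. -/
lemma sum_innovation_sq_double (hw1 : ∑ a, w a = 1) {τ : T × Fin (2 ^ n) → ℕ}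
    (hτ : Function.Injective τ) (t : T) :
    ∑ i, innovation w S (doubleOrder τ) (t, i) ^ 2 = 2 * (∑ i, innovation w S τ (t, i) ^ 2 +
      ∑ i, (innovation w S τ (t, i) * (1 - innovation w S τ (t, i))) ^ 2) := by
  rw [sum_halves, ← Finset.sum_add_distrib, ← Finset.sum_add_distrib, Finset.mul_sum]
  refine Finset.sum_congr rfl fun i _ => ?_
  rw [innovation_inl hw1, innovation_inr hτ]
  ring

/-- The order `τ` doubled `m` times. -/
def iterOrder (τ : T × Fin (2 ^ n) → ℕ) : (m : ℕ) → T × Fin (2 ^ (n + m)) → ℕ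
  | 0 => τ
  | m + 1 => doubleOrder (iterOrder τ m)

variable {τ : T × Fin (2 ^ n) → ℕ} (hτ : Function.Injective τ)

include hτ in
lemma iterOrder_injective (m : ℕ) : Function.Injective (iterOrder τ m) := by
  induction m with
  | zero => exact hτ
  | succ m ih => exact doubleOrder_injective ih

include hτ in
lemma sum_innovation_iter (hw1 : ∑ a, w a = 1) (t : T) (m : ℕ) :
    ∑ i, innovation w S (iterOrder τ m) (t, i) = 2 ^ m * ∑ i, innovation w S τ (t, i) := by
  induction m with
  | zero => simp [iterOrder]
  | succ m ih =>
    refine (sum_innovation_double hw1 (iterOrder_injective hτ m) t).trans ?_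
    rw [ih]; ring

include hτ in
-- The normalized second moments increase and are bounded, so their increments, which are the
-- quantities here, tend to zero.
lemma tendsto_sum_unpolarized (hw : ∀ a, 0 ≤ w a) (hw1 : ∑ a, w a = 1) (t : T) :
    Tendsto (fun m : ℕ => (∑ i, (innovation w S (iterOrder τ m) (t, i) *
      (1 - innovation w S (iterOrder τ m) (t, i))) ^ 2) / 2 ^ m) atTop (𝓝 0) := by
  set e : ℕ → ℝ := fun m => (∑ i, (innovation w S (iterOrder τ m) (t, i) *
      (1 - innovation w S (iterOrder τ m) (t, i))) ^ 2) / 2 ^ m with he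
  set u : ℕ → ℝ := fun m => (∑ i, innovation w S (iterOrder τ m) (t, i) ^ 2) / 2 ^ m with hu
  have hstep : ∀ m, u (m + 1) = u m + e m := fun m => by
    refine (congrArg (· / 2 ^ (m + 1))
      (sum_innovation_sq_double hw1 (iterOrder_injective hτ m) t)).trans ?_
    simp only [hu, he, pow_succ]
    ring
  have hmono : Monotone u := monotone_nat_of_le_succ fun m => by
    rw [hstep]
    exact le_add_of_nonneg_right (div_nonneg (Finset.sum_nonneg fun _ _ => sq_nonneg _)
      (by positivity))
  have hbdd : ∀ m, u m ≤ 2 ^ n := fun m => by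
    have h1 : ∑ i, innovation w S (iterOrder τ m) (t, i) ^ 2 ≤
        ∑ _i : Fin (2 ^ (n + m)), (1 : ℝ) := Finset.sum_le_sum fun i _ =>
      pow_le_one₀ (innovation_nonneg hw _) (innovation_le_one hw hw1 _)
    simp only [Finset.sum_const, Finset.card_univ, Fintype.card_fin, nsmul_eq_mul, mul_one] at h1
    simp only [hu]
    rw [div_le_iff₀ (by positivity), ← pow_add]
    exact_mod_cast h1
  have hlim := tendsto_atTop_ciSup hmono ⟨2 ^ n, by rintro _ ⟨m, rfl⟩; exact hbdd m⟩
  have h2 := (hlim.comp (tendsto_add_atTop_nat 1)).sub hlim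
  rw [sub_self] at h2
  refine h2.congr fun m => ?_
  simp only [Function.comp, hstep]
  ring

end Doubling

section Selection

/-- Pointwise comparison with the indicator of `θ < x`: the middle term covers the values above `1 -
θ`, the last term the unpolarized ones. -/
lemma card_selected_le {ι : Type*} [Fintype ι] {x : ι → ℝ} (h0 : ∀ i, 0 ≤ x i) {θ : ℝ} (hθ : 0 < θ) :
    ((Finset.univ.filter fun i => θ < x i).card : ℝ) ≤
      ∑ i, x i + Fintype.card ι * θ + (∑ i, (x i * (1 - x i)) ^ 2) / θ ^ 3 := by
  have h : ∀ i, (if θ < x i then (1 : ℝ) else 0) ≤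
      x i + θ + (x i * (1 - x i)) ^ 2 / θ ^ 3 := by
    intro i
    have hx := h0 i
    have hp : 0 ≤ (x i * (1 - x i)) ^ 2 / θ ^ 3 := by positivity
    split_ifs with hi
    · by_cases h2 : 1 - x i ≤ θ
      · linarith
      -- Since `x > θ` and `1 - x > θ`, one has `(x(1-x))² ≥ θ² · θ · (1-x)`; hence the cube of `θ`.
      · have : 1 - x i ≤ (x i * (1 - x i)) ^ 2 / θ ^ 3 := by
          rw [le_div_iff₀ (by positivity), mul_pow]
          push Not at h2
          have h3 : θ ^ 2 ≤ x i ^ 2 := pow_le_pow_left₀ hθ.le hi.le 2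
          calc (1 - x i) * θ ^ 3 = (1 - x i) * (θ ^ 2 * θ) := by ring
            _ ≤ (1 - x i) * (x i ^ 2 * (1 - x i)) := by
              refine mul_le_mul_of_nonneg_left ?_ (by linarith)
              exact mul_le_mul h3 h2.le hθ.le (by positivity)
            _ = _ := by ring
        linarith
    · linarith
  calc ((Finset.univ.filter fun i => θ < x i).card : ℝ)
      = ∑ i, if θ < x i then (1 : ℝ) else 0 := by simp
    _ ≤ ∑ i, (x i + θ + (x i * (1 - x i)) ^ 2 / θ ^ 3) := Finset.sum_le_sum fun i _ => h i
    _ = _ := by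
      rw [Finset.sum_add_distrib, Finset.sum_add_distrib, ← Finset.sum_div]
      simp

/-- Numbers in `[0, 1]` that are nearly `0` or `1` are nearly exhausted by any number of them that
is not much less than their sum. -/
lemma exists_selection {ι : Type*} [Fintype ι] [DecidableEq ι] {x : ι → ℝ} (h0 : ∀ i, 0 ≤ x i)
    (h1 : ∀ i, x i ≤ 1) {θ : ℝ} (hθ : 0 < θ) {s : ℝ} (hs : 0 ≤ s) :
    ∃ R : Finset ι, (R.card : ℝ) ≤ s ∧ ∑ i ∈ Rᶜ, x i ≤
      max 0 (∑ i, x i - s) + 2 * (Fintype.card ι * θ) +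
        (∑ i, (x i * (1 - x i)) ^ 2) / θ ^ 3 + 1 := by
  set R₀ := Finset.univ.filter fun i => θ < x i with hR₀
  have hcard := card_selected_le h0 hθ
  -- Keep as many rows above the threshold as the budget `s` allows. Rows below the threshold lose
  -- `θ` each, the count of rows above it exceeds the sum by another `θ` each, and rounding `s` down
  -- costs `1`.
  obtain ⟨R, hR, hRc⟩ := Finset.exists_subset_card_eq (min_le_left R₀.card ⌊s⌋₊)
  have hfl : s < ⌊s⌋₊ + 1 := Nat.lt_floor_add_one s
  refine ⟨R, ?_, ?_⟩
  · rw [hRc]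
    exact le_trans (Nat.cast_le.2 (min_le_right _ _)) (Nat.floor_le hs)
  · have hun : Rᶜ = R₀ᶜ ∪ (R₀ \ R) := by
      ext i
      simp only [Finset.mem_compl, Finset.mem_union, Finset.mem_sdiff]
      have := @hR i
      tauto
    have h2 : ∑ i ∈ R₀ᶜ, x i ≤ Fintype.card ι * θ := by
      calc ∑ i ∈ R₀ᶜ, x i ≤ ∑ _i ∈ R₀ᶜ, θ := Finset.sum_le_sum fun i hi => by
            simpa [hR₀] using hi
        _ = (R₀ᶜ.card : ℝ) * θ := by simp
        _ ≤ _ := mul_le_mul_of_nonneg_right (Nat.cast_le.2 (Finset.card_le_univ _)) hθ.le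
    have h3 : ∑ i ∈ R₀ \ R, x i ≤ ((R₀ \ R).card : ℝ) := by
      calc ∑ i ∈ R₀ \ R, x i ≤ ∑ _i ∈ R₀ \ R, (1 : ℝ) := Finset.sum_le_sum fun i _ => h1 i
        _ = _ := by simp
    have h4 : ((R₀ \ R).card : ℝ) = R₀.card - min (R₀.card : ℝ) ⌊s⌋₊ := by
      rw [Finset.card_sdiff_of_subset hR, hRc, Nat.cast_sub (min_le_left _ _), Nat.cast_min]
    have h5 : ∑ i ∈ Rᶜ, x i = ∑ i ∈ R₀ᶜ, x i + ∑ i ∈ R₀ \ R, x i := by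
      rw [hun, Finset.sum_union]
      exact Finset.disjoint_left.2 fun i hi hi' => Finset.mem_compl.1 hi (Finset.mem_sdiff.1 hi').1
    have h6 : 0 ≤ (∑ i, (x i * (1 - x i)) ^ 2) / θ ^ 3 := by positivity
    have h7 : 0 ≤ (Fintype.card ι : ℝ) * θ := by positivity
    have h8 := le_max_left 0 (∑ i, x i - s)
    have h9 := le_max_right 0 (∑ i, x i - s)
    rw [h5]
    rcases min_cases (R₀.card : ℝ) ⌊s⌋₊ with ⟨h, _⟩ | ⟨h, _⟩ <;> rw [h] at h4 <;> linarith

end Selection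

end RenyiCompression

/-! ### Path orders and the Slepian–Wolf region -/

namespace RenyiCompression

section PathOrder

/-- The natural order of the rows under repeated doubling. -/
def rowPos : (n : ℕ) → Fin (2 ^ n) → ℕ
  | 0 => fun _ => 0
  | n + 1 => fun i =>
    Sum.elim (fun i => 2 * rowPos n i) (fun i => 2 * rowPos n i + 1) ((halves n).symm i)

@[simp] lemma rowPos_inl (n : ℕ) (i : Fin (2 ^ n)) :
    rowPos (n + 1) (halves n (.inl i)) = 2 * rowPos n i := by simp [rowPos]

@[simp] lemma rowPos_inr (n : ℕ) (i : Fin (2 ^ n)) :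
    rowPos (n + 1) (halves n (.inr i)) = 2 * rowPos n i + 1 := by simp [rowPos]

lemma rowPos_lt {n : ℕ} (i : Fin (2 ^ n)) : rowPos n i < 2 ^ n := by
  induction n with
  | zero => simp [rowPos]
  | succ n ih =>
    revert i
    refine forall_halves.2 ⟨fun i => ?_, fun i => ?_⟩ <;> have := ih i <;>
      simp only [rowPos_inl, rowPos_inr, pow_succ] <;> omega

lemma rowPos_injective (n : ℕ) : Function.Injective (rowPos n) := by
  induction n with
  | zero =>
    intro i j _
    have h1 := i.2; have h2 := j.2
    apply Fin.ext
    simp at *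
  | succ n ih =>
    intro i j h
    obtain ⟨i, rfl⟩ := (halves n).surjective i
    obtain ⟨j, rfl⟩ := (halves n).surjective j
    rcases i with i | i <;> rcases j with j | j <;> simp only [rowPos_inl, rowPos_inr] at h
    · rw [ih (by omega : rowPos n i = rowPos n j)]
    · omega
    · omega
    · rw [ih (by omega : rowPos n i = rowPos n j)]

/-- The order that processes the first `K` rows of the first component, then all rows of the
second component, and then the other rows of the first component. -/
def pathOrder (n K : ℕ) (x : Fin 2 × Fin (2 ^ n)) : ℕ :=
  if x.1 = 1 then 2 ^ n + rowPos n x.2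
  else if rowPos n x.2 < K then rowPos n x.2 else 2 * 2 ^ n + rowPos n x.2

lemma pathOrder_one (n K : ℕ) (i : Fin (2 ^ n)) : pathOrder n K (1, i) = 2 ^ n + rowPos n i := rfl

lemma pathOrder_zero (n K : ℕ) (i : Fin (2 ^ n)) : pathOrder n K (0, i) =
    if rowPos n i < K then rowPos n i else 2 * 2 ^ n + rowPos n i := rfl

lemma pathOrder_injective (n K : ℕ) : Function.Injective (pathOrder n K) := by
  rintro ⟨t, i⟩ ⟨s, j⟩ h
  have hi := rowPos_lt i
  have hj := rowPos_lt j
  have key : t = s ∧ rowPos n i = rowPos n j := by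
    fin_cases t <;> fin_cases s <;> simp only [Fin.zero_eta, Fin.mk_one, pathOrder_one,
      pathOrder_zero, Fin.isValue] at h ⊢ <;> (try split_ifs at h) <;>
      simp <;> omega
  rw [key.1, rowPos_injective n key.2]

/-- The two extreme orders, one terminal entirely before the other, are stable under doubling, so
their rates can be read off at block length one. Intermediate orders are not stable in this way. -/
lemma doubleOrder_pathOrder_bot (n : ℕ) : doubleOrder (pathOrder n 0) = pathOrder (n + 1) 0 := by
  funext ⟨t, i⟩
  obtain ⟨i, rfl⟩ := (halves n).surjective i
  fin_cases t <;> rcases i with i | i <;> simp [pathOrder, pow_succ] <;> omega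

lemma doubleOrder_pathOrder_top (n : ℕ) :
    doubleOrder (pathOrder n (2 ^ n)) = pathOrder (n + 1) (2 ^ (n + 1)) := by
  funext ⟨t, i⟩
  obtain ⟨i, rfl⟩ := (halves n).surjective i
  fin_cases t <;> rcases i with i | i <;> have h := rowPos_lt i <;>
    simp [pathOrder, h, pow_succ] <;> omega

variable {A : Type*} [Fintype A] {w : A → ℝ} {S : A → Submodule ℝ (Fin 2 → ℝ)}

lemma innovation_congr {T : Type*} {S : A → Submodule ℝ (T → ℝ)} {n : ℕ}
    {τ τ' : T × Fin (2 ^ n) → ℕ} {x : T × Fin (2 ^ n)}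
    (h : ∀ y, τ y < τ x ↔ τ' y < τ' x) : innovation w S τ x = innovation w S τ' x := by
  have : ∀ c, Innovative S τ c x ↔ Innovative S τ' c x := fun c => by
    simp only [Innovative, h]
  classical
  refine Finset.sum_congr rfl fun c _ => congrArg _ ?_
  exact if_congr (this c) rfl rfl

/-- Passing from `K` to `K + 1` moves only row `K` of the first terminal ahead of the second
terminal. Every other row of the first terminal keeps its set of predecessors. So the rate of the
first terminal moves in steps of at most one row. -/
lemma innovation_pathOrder_succ {n : ℕ} (K : ℕ) {i : Fin (2 ^ n)} (hi : rowPos n i ≠ K) :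
    innovation w S (pathOrder n (K + 1)) (0, i) = innovation w S (pathOrder n K) (0, i) := by
  refine innovation_congr ?_
  rintro ⟨t, j⟩
  have hi' := rowPos_lt i
  have hj := rowPos_lt j
  fin_cases t <;> simp only [Fin.zero_eta, Fin.mk_one, pathOrder_one, pathOrder_zero,
    Fin.isValue] <;> split_ifs <;> omega

lemma sum_innovation_pathOrder_succ_le (hw : ∀ a, 0 ≤ w a) (hw1 : ∑ a, w a = 1) {n : ℕ} (K : ℕ) :
    ∑ i, innovation w S (pathOrder n (K + 1)) (0, i) ≤
      ∑ i, innovation w S (pathOrder n K) (0, i) + 1 := by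
  classical
  by_cases h : ∃ i, rowPos n i = K
  · obtain ⟨i, hi⟩ := h
    rw [← Finset.add_sum_erase _ _ (Finset.mem_univ i),
      ← Finset.add_sum_erase _ (fun i => innovation w S (pathOrder n K) (0, i))
        (Finset.mem_univ i)]
    have h1 : ∑ j ∈ Finset.univ.erase i, innovation w S (pathOrder n (K + 1)) (0, j) =
        ∑ j ∈ Finset.univ.erase i, innovation w S (pathOrder n K) (0, j) :=
      Finset.sum_congr rfl fun j hj => innovation_pathOrder_succ K fun h =>
        Finset.ne_of_mem_erase hj (rowPos_injective n (h.trans hi.symm))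
    have h2 := innovation_le_one hw hw1 (S := S) (τ := pathOrder n (K + 1)) (0, i)
    have h3 := innovation_nonneg hw (S := S) (τ := pathOrder n K) (0, i)
    rw [h1]
    linarith
  · push Not at h
    rw [Finset.sum_congr rfl fun j _ => innovation_pathOrder_succ K (h j)]
    linarith

lemma sum_innovation_bot (hw1 : ∑ a, w a = 1) (n : ℕ) (t : Fin 2) :
    ∑ i, innovation w S (pathOrder n 0) (t, i) =
      2 ^ n * innovation w S (pathOrder 0 0) (t, 0) := by
  induction n with
  | zero =>
    rw [pow_zero (2 : ℝ), one_mul]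
    exact Fintype.sum_unique (ι := Fin 1) fun i => innovation w S (pathOrder 0 0) (t, i)
  | succ n ih =>
    rw [← doubleOrder_pathOrder_bot, sum_innovation_double hw1 (pathOrder_injective _ _), ih]
    ring

lemma sum_innovation_top (hw1 : ∑ a, w a = 1) (n : ℕ) (t : Fin 2) :
    ∑ i, innovation w S (pathOrder n (2 ^ n)) (t, i) =
      2 ^ n * innovation w S (pathOrder 0 1) (t, 0) := by
  induction n with
  | zero =>
    rw [pow_zero (2 : ℝ), one_mul]
    exact Fintype.sum_unique (ι := Fin 1) fun i => innovation w S (pathOrder 0 1) (t, i)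
  | succ n ih =>
    rw [← doubleOrder_pathOrder_top, sum_innovation_double hw1 (pathOrder_injective _ _), ih]
    ring

lemma sum_innovation_pathOrder (hw1 : ∑ a, w a = 1) (n K : ℕ) :
    ∑ i, innovation w S (pathOrder n K) (0, i) + ∑ i, innovation w S (pathOrder n K) (1, i) =
      2 ^ n * (innovation w S (pathOrder 0 0) (0, 0) +
        innovation w S (pathOrder 0 0) (1, 0)) := by
  rw [mul_add, ← sum_innovation_bot hw1, ← sum_innovation_bot hw1, ← Fin.sum_univ_two
    (fun t => ∑ i, innovation w S (pathOrder n K) (t, i)), ← Fin.sum_univ_two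
    (fun t => ∑ i, innovation w S (pathOrder n 0) (t, i)),
    sum_innovation (pathOrder_injective _ _), sum_innovation (pathOrder_injective _ _)]

variable (hw : ∀ a, 0 ≤ w a) (hw1 : ∑ a, w a = 1) {ρ : Fin 2 → ℝ}
  (h0 : innovation w S (pathOrder 0 0) (0, 0) ≤ ρ 0)
  (h1 : innovation w S (pathOrder 0 1) (1, 0) ≤ ρ 1)
  (hsum : innovation w S (pathOrder 0 0) (0, 0) + innovation w S (pathOrder 0 0) (1, 0) ≤
    ρ 0 + ρ 1)

include hw hw1 h0 h1 hsum in
/-- Among the path orders there is one whose rates nearly dominate a given point of the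
Slepian–Wolf region. -/
lemma exists_pathOrder (n : ℕ) :
    ∃ K, ∀ t, ∑ i, innovation w S (pathOrder n K) (t, i) ≤ 2 ^ n * ρ t + 1 := by
  classical
  have hpos : (0 : ℝ) < 2 ^ n := by positivity
  -- Take the first `K` at which the first terminal exceeds its target. The excess is at most `1` by
  -- the step bound, and the second terminal gets the remainder of the total, which is within its
  -- own target. `K = 0` is excluded by `h0`. If the target is never exceeded, the opposite corner
  -- works.
  by_cases h : ∃ K, 2 ^ n * ρ 0 < ∑ i, innovation w S (pathOrder n K) (0, i)
  · have hK := Nat.find_spec h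
    have hmin := fun m => @Nat.find_min _ _ h m
    set K := Nat.find h with hKdef
    have htot := sum_innovation_pathOrder (S := S) hw1 n K
    have h2 := mul_le_mul_of_nonneg_left hsum hpos.le
    refine ⟨K, Fin.forall_fin_two.2 ⟨?_, by linarith⟩⟩
    rcases Nat.eq_zero_or_pos K with h' | h'
    · rw [h', sum_innovation_bot hw1] at hK
      linarith [mul_le_mul_of_nonneg_left h0 hpos.le]
    · have h3 := hmin (K - 1) (by omega)
      have h4 := sum_innovation_pathOrder_succ_le (S := S) hw hw1 (n := n) (K - 1)
      rw [Nat.sub_add_cancel h'] at h4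
      linarith
  · push Not at h
    refine ⟨2 ^ n, Fin.forall_fin_two.2 ⟨by linarith [h (2 ^ n)], ?_⟩⟩
    rw [sum_innovation_top hw1]
    linarith [mul_le_mul_of_nonneg_left h1 hpos.le]

include hw hw1 h0 h1 hsum in
/-- Selected rows of large Hadamard matrices, at rates in the Slepian–Wolf region, leave only a
small fraction of the dimensions unresolved on average. -/
theorem exists_rows (hρ : ∀ t, 0 ≤ ρ t) {ε : ℝ} (hε : 0 < ε) :
    ∃ n₁, ∀ n, n₁ ≤ n → ∃ R : Fin 2 → Finset (Fin (2 ^ n)),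
      (∀ t, ((R t).card : ℝ) ≤ ρ t * 2 ^ n) ∧
      ∑ c : Fin (2 ^ n) → A, wordWeight w c * (Module.finrank ℝ (unresolved S R c) : ℝ) ≤
        ε * 2 ^ n := by
  -- Each of the two terminals will contribute five errors of size `θ · 2 ^ n`.
  set θ := ε / 10 with hθ
  have hθ0 : 0 < θ := by positivity
  -- The path order is fixed at block length `2 ^ n₀`, long enough that the excess `1` is a fraction
  -- at most `θ` of it. Further doublings preserve the normalized rates exactly.
  obtain ⟨n₀, hn₀⟩ := exists_pow_lt_of_lt_one hθ0 (by norm_num : (1 / 2 : ℝ) < 1)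
  have hn₀' : 1 ≤ θ * 2 ^ n₀ := by
    have h := mul_lt_mul_of_pos_right hn₀ (by positivity : (0 : ℝ) < 2 ^ n₀)
    rw [← mul_pow] at h
    norm_num at h
    exact h.le
  obtain ⟨K, hK⟩ := exists_pathOrder hw hw1 h0 h1 hsum n₀
  have hinj := pathOrder_injective n₀ K
  -- Division by `θ³` in the selection lemma leaves `θ` out of `θ⁴`.
  have hlim : ∀ t : Fin 2, ∀ᶠ m : ℕ in atTop,
      (∑ i, (innovation w S (iterOrder (pathOrder n₀ K) m) (t, i) *
        (1 - innovation w S (iterOrder (pathOrder n₀ K) m) (t, i))) ^ 2) / 2 ^ m < θ ^ 4 :=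
    fun t => (tendsto_sum_unpolarized hinj hw hw1 t).eventually_lt_const (by positivity)
  obtain ⟨m₀, hm₀⟩ := eventually_atTop.1 ((hlim 0).and (hlim 1))
  have hm₀' : ∀ m, m₀ ≤ m → ∀ t : Fin 2,
      (∑ i, (innovation w S (iterOrder (pathOrder n₀ K) m) (t, i) *
        (1 - innovation w S (iterOrder (pathOrder n₀ K) m) (t, i))) ^ 2) / 2 ^ m < θ ^ 4 :=
    fun m hm => Fin.forall_fin_two.2 (hm₀ m hm)
  refine ⟨n₀ + m₀, fun n hn => ?_⟩
  obtain ⟨m, rfl⟩ := Nat.exists_eq_add_of_le (le_trans (Nat.le_add_right n₀ m₀) hn)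
  have hsel := fun t : Fin 2 => exists_selection
    (x := fun i => innovation w S (iterOrder (pathOrder n₀ K) m) (t, i))
    (fun i => innovation_nonneg hw _) (fun i => innovation_le_one hw hw1 _) hθ0
    (s := ρ t * 2 ^ (n₀ + m)) (mul_nonneg (hρ t) (by positivity))
  choose R hR hRsum using hsel
  refine ⟨R, hR, (sum_finrank_unresolved_le hw (iterOrder_injective hinj m) R).trans ?_⟩
  have h2m : (1 : ℝ) ≤ 2 ^ m := one_le_pow₀ (by norm_num)
  have h2n : (2 : ℝ) ^ (n₀ + m) = 2 ^ n₀ * 2 ^ m := pow_add _ _ _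
  have hm1 : (2 : ℝ) ^ m ≤ θ * 2 ^ (n₀ + m) := by
    rw [h2n, ← mul_assoc]
    exact le_mul_of_one_le_left (by positivity) hn₀'
  have hbound : ∀ t, ∑ i ∈ (R t)ᶜ, innovation w S (iterOrder (pathOrder n₀ K) m) (t, i) ≤
      5 * (θ * 2 ^ (n₀ + m)) := fun t => by
    refine (hRsum t).trans ?_
    have e1 : (∑ i, (innovation w S (iterOrder (pathOrder n₀ K) m) (t, i) *
        (1 - innovation w S (iterOrder (pathOrder n₀ K) m) (t, i))) ^ 2) / θ ^ 3 ≤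
        θ * 2 ^ m := by
      have := hm₀' m (by omega) t
      rw [div_lt_iff₀ (by positivity)] at this
      rw [div_le_iff₀ (by positivity)]
      calc _ ≤ θ ^ 4 * 2 ^ m := this.le
        _ = _ := by ring
    have e2 : max 0 (∑ i, innovation w S (iterOrder (pathOrder n₀ K) m) (t, i) -
        ρ t * 2 ^ (n₀ + m)) ≤ 2 ^ m := by
      refine max_le (by positivity) ?_
      rw [sum_innovation_iter hinj hw1, h2n]
      have := mul_le_mul_of_nonneg_left (hK t) (by positivity : (0 : ℝ) ≤ 2 ^ m)
      linarith
    have e3 : θ * 2 ^ m ≤ θ * 2 ^ (n₀ + m) := by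
      refine mul_le_mul_of_nonneg_left ?_ hθ0.le
      rw [h2n]
      exact le_mul_of_one_le_left (by positivity) (one_le_pow₀ (by norm_num))
    have e4 : ((Fintype.card (Fin (2 ^ (n₀ + m))) : ℕ) : ℝ) = 2 ^ (n₀ + m) := by simp
    rw [e4]
    linarith
  rw [Fin.sum_univ_two]
  calc _ ≤ 5 * (θ * 2 ^ (n₀ + m)) + 5 * (θ * 2 ^ (n₀ + m)) := add_le_add (hbound 0) (hbound 1)
    _ = _ := by rw [hθ]; ring

end PathOrder

end RenyiCompression

/-! ### Entropy on finite weighted spaces -/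

namespace RenyiCompression

section FiniteEntropy

variable {Ω Ω' β γ δ : Type*} [Fintype Ω] [Fintype Ω']

/-- A probability weight on a finite type. -/
structure IsWeight (p : Ω → ℝ) : Prop where
  nonneg : ∀ ω, 0 ≤ p ω
  sum_eq_one : ∑ ω, p ω = 1

open Classical in
/-- The mass of the fibre of `g` over `b`. -/
def massAt (p : Ω → ℝ) (g : Ω → β) (b : β) : ℝ := ∑ ω, if g ω = b then p ω else 0

/-- The entropy, in nats, of the function `g` on a finite weighted space. -/
def finEntropy (p : Ω → ℝ) (g : Ω → β) : ℝ := ∑ ω, p ω * -Real.log (massAt p g (g ω))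

variable {p : Ω → ℝ} {p' : Ω' → ℝ} (hp : IsWeight p) (hp' : IsWeight p')

include hp in
lemma massAt_nonneg (g : Ω → β) (b : β) : 0 ≤ massAt p g b :=
  Finset.sum_nonneg fun ω _ => by split_ifs; exacts [hp.nonneg ω, le_rfl]

include hp in
lemma le_massAt (g : Ω → β) (ω : Ω) : p ω ≤ massAt p g (g ω) := by
  classical
  refine le_trans (by rw [if_pos rfl]) (Finset.single_le_sum
    (f := fun ω' => if g ω' = g ω then p ω' else 0) (fun ω' _ => ?_) (Finset.mem_univ ω))
  split_ifs; exacts [hp.nonneg ω', le_rfl]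

include hp in
lemma massAt_pos (g : Ω → β) {ω : Ω} (h : 0 < p ω) : 0 < massAt p g (g ω) :=
  h.trans_le (le_massAt hp g ω)

include hp in
lemma massAt_mono {g : Ω → β} {k : Ω → γ} {b : β} {c : γ} (h : ∀ ω, g ω = b → k ω = c) :
    massAt p g b ≤ massAt p k c := by
  refine Finset.sum_le_sum fun ω _ => ?_
  by_cases hg : g ω = b
  · rw [if_pos hg, if_pos (h ω hg)]
  · rw [if_neg hg]; split_ifs; exacts [hp.nonneg ω, le_rfl]

include hp in
lemma massAt_le_one (g : Ω → β) (b : β) : massAt p g b ≤ 1 := by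
  rw [← hp.sum_eq_one]
  exact Finset.sum_le_sum fun ω _ => by split_ifs; exacts [le_rfl, hp.nonneg ω]

lemma massAt_congr {g : Ω → β} {k : Ω → γ} {b : β} {c : γ} (h : ∀ ω, g ω = b ↔ k ω = c) :
    massAt p g b = massAt p k c := by
  classical
  refine Finset.sum_congr rfl fun ω _ => ?_
  exact if_congr (h ω) rfl rfl

lemma sum_mul_comp (g : Ω → β) (b : β) (F : β → ℝ) :
    (∑ ω, open Classical in if g ω = b then p ω * F (g ω) else 0) = massAt p g b * F b := by
  classical
  rw [massAt, Finset.sum_mul]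
  refine Finset.sum_congr rfl fun ω _ => ?_
  by_cases h : g ω = b <;> simp [h]

include hp in
lemma finEntropy_nonneg (g : Ω → β) : 0 ≤ finEntropy p g :=
  Finset.sum_nonneg fun ω _ => mul_nonneg (hp.nonneg ω)
    (neg_nonneg.2 (Real.log_nonpos (massAt_nonneg hp _ _) (massAt_le_one hp _ _)))

/-- Entropy depends only on the partition into fibres. This replaces a variable by any other that
determines it and is determined by it. -/
lemma finEntropy_congr {g : Ω → β} {k : Ω → γ} (h : ∀ ω ω', g ω = g ω' ↔ k ω = k ω') :
    finEntropy p g = finEntropy p k :=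
  Finset.sum_congr rfl fun ω _ => by rw [massAt_congr fun ω' => h ω' ω]

include hp in
lemma finEntropy_mono {g : Ω → β} {k : Ω → γ} (h : ∀ ω ω', g ω = g ω' → k ω = k ω') :
    finEntropy p k ≤ finEntropy p g := by
  refine Finset.sum_le_sum fun ω _ => ?_
  rcases (hp.nonneg ω).eq_or_lt with h0 | h0
  · simp [← h0]
  · exact mul_le_mul_of_nonneg_left (neg_le_neg (Real.log_le_log (massAt_pos hp g h0)
      (massAt_mono hp fun ω' => h ω' ω))) h0.le

lemma finEntropy_equiv (e : Ω' ≃ Ω) (g : Ω → β) :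
    finEntropy (fun ω => p (e ω)) (fun ω => g (e ω)) = finEntropy p g := by
  have h : ∀ b, massAt (fun ω => p (e ω)) (fun ω => g (e ω)) b = massAt p g b := fun b => by
    classical
    exact e.sum_comp fun ω => if g ω = b then p ω else 0
  unfold finEntropy
  simp only [h]
  exact e.sum_comp fun ω => p ω * -Real.log (massAt p g (g ω))

include hp in
-- The ratio compares the coupling in which `f` and `k` are independent given `g` with the actual
-- joint law. Its expectation is the mass this coupling gives to the actual support. With `log t ≤ t
-- - 1` it yields submodularity.
lemma sum_interaction_le (f : Ω → β) (k : Ω → γ) (g : Ω → δ) :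
    ∑ ω, p ω * (massAt p (fun ω => (f ω, g ω)) (f ω, g ω) *
      massAt p (fun ω => (k ω, g ω)) (k ω, g ω) /
        (massAt p (fun ω => (f ω, k ω, g ω)) (f ω, k ω, g ω) * massAt p g (g ω))) ≤ 1 := by
  classical
  set a := massAt p (fun ω => (f ω, k ω, g ω)) with ha
  set b := massAt p g with hb
  have ha0 : ∀ x, 0 ≤ a x := massAt_nonneg hp _
  have hb0 : ∀ x, 0 ≤ b x := massAt_nonneg hp _
  -- Two independent points `ω₁`, `ω₂` realize the masses of `(f, g)` and `(k, g)`. Summing over `ω`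
  -- next leaves only the condition `g ω₂ = g ω₁`.
  have e1 : ∀ ω, p ω * (massAt p (fun ω => (f ω, g ω)) (f ω, g ω) *
      massAt p (fun ω => (k ω, g ω)) (k ω, g ω) / (a (f ω, k ω, g ω) * b (g ω))) =
      ∑ ω₁, ∑ ω₂, p ω₁ * (p ω₂ * if (f ω₁, g ω₁) = (f ω, g ω) ∧ (k ω₂, g ω₂) = (k ω, g ω) then
        p ω / (a (f ω, k ω, g ω) * b (g ω)) else 0) := by
    intro ω
    rw [massAt, massAt, Finset.sum_mul_sum, Finset.sum_div, Finset.mul_sum]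
    refine Finset.sum_congr rfl fun ω₁ _ => ?_
    rw [Finset.sum_div, Finset.mul_sum]
    refine Finset.sum_congr rfl fun ω₂ _ => ?_
    by_cases h1 : (f ω₁, g ω₁) = (f ω, g ω) <;> by_cases h2 : (k ω₂, g ω₂) = (k ω, g ω) <;>
      simp only [h1, h2, if_true, if_false, and_true, and_false] <;> ring
  simp only [e1]
  rw [Finset.sum_comm]
  calc ∑ ω₁, ∑ ω, ∑ ω₂, p ω₁ * (p ω₂ * if (f ω₁, g ω₁) = (f ω, g ω) ∧
          (k ω₂, g ω₂) = (k ω, g ω) then p ω / (a (f ω, k ω, g ω) * b (g ω)) else 0)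
      ≤ ∑ ω₁, p ω₁ * 1 := ?_
    _ = 1 := by simp [hp.sum_eq_one]
  refine Finset.sum_le_sum fun ω₁ _ => ?_
  rw [Finset.sum_comm]
  simp only [← Finset.mul_sum]
  refine mul_le_mul_of_nonneg_left ?_ (hp.nonneg _)
  calc ∑ ω₂, p ω₂ * ∑ ω, (if (f ω₁, g ω₁) = (f ω, g ω) ∧
          (k ω₂, g ω₂) = (k ω, g ω) then p ω / (a (f ω, k ω, g ω) * b (g ω)) else 0)
      ≤ ∑ ω₂, (if g ω₂ = g ω₁ then p ω₂ * (b (g ω₁))⁻¹ else 0) := ?_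
    _ = b (g ω₁) * (b (g ω₁))⁻¹ := by
      rw [hb, ← sum_mul_comp g (g ω₁) fun x => (massAt p g x)⁻¹]
      exact Finset.sum_congr rfl fun ω _ => by by_cases h : g ω = g ω₁ <;> simp [h]
    _ ≤ 1 := mul_inv_le_one
  refine Finset.sum_le_sum fun ω₂ _ => ?_
  by_cases h : g ω₂ = g ω₁
  · rw [if_pos h]
    refine mul_le_mul_of_nonneg_left ?_ (hp.nonneg _)
    calc _ ≤ ∑ ω, (if (f ω, k ω, g ω) = (f ω₁, k ω₂, g ω₁) then
            p ω * ((a (f ω, k ω, g ω))⁻¹ * (b (g ω₁))⁻¹) else 0) := by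
          refine Finset.sum_le_sum fun ω _ => ?_
          by_cases h' : (f ω, k ω, g ω) = (f ω₁, k ω₂, g ω₁)
          · rw [if_pos h']
            simp only [Prod.mk.injEq] at h'
            split_ifs
            · rw [h'.2.2, div_eq_mul_inv, mul_inv]
            · exact mul_nonneg (hp.nonneg _)
                (mul_nonneg (inv_nonneg.2 (ha0 _)) (inv_nonneg.2 (hb0 _)))
          · rw [if_neg h', if_neg]
            rintro ⟨h1, h2⟩
            simp only [Prod.mk.injEq] at h1 h2 h'
            exact h' ⟨h1.1.symm, h2.1.symm, h1.2.symm⟩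
      _ = a (f ω₁, k ω₂, g ω₁) * ((a (f ω₁, k ω₂, g ω₁))⁻¹ * (b (g ω₁))⁻¹) := by
          rw [ha, ← sum_mul_comp (fun ω => (f ω, k ω, g ω)) (f ω₁, k ω₂, g ω₁)
            fun x => ((massAt p (fun ω => (f ω, k ω, g ω)) x)⁻¹ * (b (g ω₁))⁻¹)]
          exact Finset.sum_congr rfl fun ω _ => by split_ifs <;> rfl
      _ ≤ (b (g ω₁))⁻¹ := by
          rw [← mul_assoc]
          exact mul_le_of_le_one_left (inv_nonneg.2 (hb0 _)) mul_inv_le_one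
  · rw [if_neg h]
    refine (mul_eq_zero_of_right _ (Finset.sum_eq_zero fun ω _ => if_neg ?_)).le
    rintro ⟨h1, h2⟩
    simp only [Prod.mk.injEq] at h1 h2
    exact h (h2.2.trans h1.2.symm)

include hp in
/-- Submodularity of entropy: conditioning on more reduces the conditional entropy. -/
lemma finEntropy_submodular (f : Ω → β) (k : Ω → γ) (g : Ω → δ) :
    finEntropy p (fun ω => (f ω, k ω, g ω)) + finEntropy p g ≤
      finEntropy p (fun ω => (f ω, g ω)) + finEntropy p (fun ω => (k ω, g ω)) := by
  rw [← sub_nonpos]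
  have h := sum_interaction_le hp f k g
  refine le_trans ?_ (sub_nonpos.2 h)
  nth_rewrite 1 [← hp.sum_eq_one]
  unfold finEntropy
  rw [← Finset.sum_add_distrib, ← Finset.sum_add_distrib, ← Finset.sum_sub_distrib,
    ← Finset.sum_sub_distrib]
  refine Finset.sum_le_sum fun ω _ => ?_
  rcases (hp.nonneg ω).eq_or_lt with h0 | h0
  · simp [← h0]
  · have h1 := massAt_pos hp (fun ω => (f ω, k ω, g ω)) h0
    have h2 := massAt_pos hp g h0
    have h3 := massAt_pos hp (fun ω => (f ω, g ω)) h0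
    have h4 := massAt_pos hp (fun ω => (k ω, g ω)) h0
    have hlog := Real.log_le_sub_one_of_pos (div_pos (mul_pos h3 h4) (mul_pos h1 h2))
    rw [Real.log_div (mul_pos h3 h4).ne' (mul_pos h1 h2).ne', Real.log_mul h3.ne' h4.ne',
      Real.log_mul h1.ne' h2.ne'] at hlog
    have := mul_le_mul_of_nonneg_left hlog h0.le
    linarith

include hp in
lemma finEntropy_const {g : Ω → β} (h : ∀ ω ω', g ω = g ω') : finEntropy p g = 0 := by
  refine Finset.sum_eq_zero fun ω _ => ?_
  have : massAt p g (g ω) = 1 := by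
    rw [← hp.sum_eq_one]
    exact Finset.sum_congr rfl fun ω' _ => if_pos (h ω' ω)
  simp [this]

include hp in
lemma finEntropy_pair_le (f : Ω → β) (k : Ω → γ) :
    finEntropy p (fun ω => (f ω, k ω)) ≤ finEntropy p f + finEntropy p k := by
  have h := finEntropy_submodular hp f k (fun _ => ())
  rw [finEntropy_const hp (g := fun _ => ()) fun _ _ => rfl, add_zero] at h
  rw [finEntropy_congr (k := fun ω => (f ω, k ω)) (fun _ _ => by simp),
    finEntropy_congr (g := fun ω => (f ω, ())) (k := f) (fun _ _ => by simp),
    finEntropy_congr (g := fun ω => (k ω, ())) (k := k) (fun _ _ => by simp)] at h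
  exact h

/-- The product weight. -/
def prodWeight (p : Ω → ℝ) (p' : Ω' → ℝ) (x : Ω × Ω') : ℝ := p x.1 * p' x.2

include hp hp' in
lemma IsWeight.prod : IsWeight (prodWeight p p') where
  nonneg x := mul_nonneg (hp.nonneg _) (hp'.nonneg _)
  sum_eq_one := by
    rw [Fintype.sum_prod_type]
    simp [prodWeight, ← Finset.mul_sum, hp.sum_eq_one, hp'.sum_eq_one]

lemma massAt_prod (g : Ω → β) (k : Ω' → γ) (b : β) (c : γ) :
    massAt (prodWeight p p') (fun x => (g x.1, k x.2)) (b, c) = massAt p g b * massAt p' k c := by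
  classical
  rw [massAt, massAt, massAt, Finset.sum_mul_sum, Fintype.sum_prod_type]
  refine Finset.sum_congr rfl fun ω _ => Finset.sum_congr rfl fun ω' _ => ?_
  by_cases h1 : g ω = b <;> by_cases h2 : k ω' = c <;> simp [h1, h2, prodWeight]

include hp hp' in
lemma sum_prodWeight_fst (F : Ω → ℝ) : ∑ x, prodWeight p p' x * F x.1 = ∑ ω, p ω * F ω := by
  rw [Fintype.sum_prod_type]
  refine Finset.sum_congr rfl fun ω _ => ?_
  simp only [prodWeight]
  rw [← Finset.sum_mul, ← Finset.mul_sum, hp'.sum_eq_one, mul_one]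

include hp hp' in
lemma sum_prodWeight_snd (F : Ω' → ℝ) : ∑ x, prodWeight p p' x * F x.2 = ∑ ω, p' ω * F ω := by
  rw [Fintype.sum_prod_type_right]
  refine Finset.sum_congr rfl fun ω _ => ?_
  simp only [prodWeight]
  rw [← Finset.sum_mul, ← Finset.sum_mul, hp.sum_eq_one, one_mul]

include hp hp' in
lemma finEntropy_prod (g : Ω → β) (k : Ω' → γ) :
    finEntropy (prodWeight p p') (fun x => (g x.1, k x.2)) = finEntropy p g + finEntropy p' k := by
  unfold finEntropy
  rw [← sum_prodWeight_fst hp hp', ← sum_prodWeight_snd hp hp', ← Finset.sum_add_distrib]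
  refine Finset.sum_congr rfl fun x _ => ?_
  rw [massAt_prod]
  rcases (hp.nonneg x.1).eq_or_lt with h0 | h0
  · simp [prodWeight, ← h0]
  rcases (hp'.nonneg x.2).eq_or_lt with h1 | h1
  · simp [prodWeight, ← h1]
  rw [Real.log_mul (massAt_pos hp g h0).ne' (massAt_pos hp' k h1).ne']
  ring

include hp hp' in
lemma massAt_prod_snd (g : Ω' → β) (b : β) :
    massAt (prodWeight p p') (fun x => g x.2) b = massAt p' g b := by
  classical
  rw [massAt, massAt, Fintype.sum_prod_type_right]
  refine Finset.sum_congr rfl fun ω _ => ?_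
  by_cases h : g ω = b <;> simp [h, prodWeight, ← Finset.sum_mul, hp.sum_eq_one]

include hp hp' in
lemma finEntropy_prod_snd (g : Ω' → β) :
    finEntropy (prodWeight p p') (fun x => g x.2) = finEntropy p' g := by
  unfold finEntropy
  rw [← sum_prodWeight_snd hp hp']
  simp only [massAt_prod_snd hp hp']

end FiniteEntropy

section Conditioning

variable {Ω Ω' β γ : Type*} [Fintype Ω] [Fintype Ω']

open Classical in
/-- The weight `p` conditioned on the fibre of `g` through `ω₀`. -/
def condWeight (p : Ω → ℝ) (g : Ω → β) (ω₀ : Ω) (ω : Ω) : ℝ :=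
  if g ω = g ω₀ then p ω / massAt p g (g ω₀) else 0

variable {p : Ω → ℝ} (hp : IsWeight p)

include hp in
lemma IsWeight.cond (g : Ω → β) {ω₀ : Ω} (h : 0 < p ω₀) : IsWeight (condWeight p g ω₀) where
  nonneg ω := by
    unfold condWeight
    split_ifs
    exacts [div_nonneg (hp.nonneg _) (massAt_nonneg hp _ _), le_rfl]
  sum_eq_one := by
    have h1 := sum_mul_comp (p := p) g (g ω₀) fun x => (massAt p g x)⁻¹
    rw [mul_inv_cancel₀ (massAt_pos hp g h).ne'] at h1
    rw [← h1]
    refine Finset.sum_congr rfl fun ω _ => ?_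
    unfold condWeight
    by_cases h' : g ω = g ω₀ <;> simp [h', div_eq_mul_inv]

lemma massAt_condWeight (g : Ω → β) (f : Ω → γ) (ω₀ : Ω) (c : γ) :
    massAt (condWeight p g ω₀) f c =
      massAt p (fun ω => (f ω, g ω)) (c, g ω₀) / massAt p g (g ω₀) := by
  classical
  rw [massAt, massAt, Finset.sum_div]
  refine Finset.sum_congr rfl fun ω _ => ?_
  by_cases h1 : f ω = c <;> by_cases h2 : g ω = g ω₀ <;> simp [h1, h2, condWeight]

include hp in
/-- The chain rule: the conditional entropy is the average entropy of the conditional weights. -/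
lemma finEntropy_sub_eq_sum (f : Ω → γ) (g : Ω → β) :
    finEntropy p (fun ω => (f ω, g ω)) - finEntropy p g =
      ∑ ω, p ω * finEntropy (condWeight p g ω) f := by
  classical
  have h1 : ∀ ω₀, p ω₀ * finEntropy (condWeight p g ω₀) f =
      ∑ ω, if g ω₀ = g ω then p ω₀ * (massAt p g (g ω₀))⁻¹ *
        (p ω * -Real.log (massAt p (fun ω => (f ω, g ω)) (f ω, g ω) / massAt p g (g ω)))
        else 0 := fun ω₀ => by
    rw [finEntropy, Finset.mul_sum]
    refine Finset.sum_congr rfl fun ω _ => ?_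
    rw [massAt_condWeight]
    by_cases h : g ω₀ = g ω
    · rw [if_pos h, condWeight, if_pos h.symm, h]
      ring
    · rw [if_neg h, condWeight, if_neg (Ne.symm h)]
      ring
  simp only [h1]
  rw [Finset.sum_comm, finEntropy, finEntropy, ← Finset.sum_sub_distrib]
  refine Finset.sum_congr rfl fun ω _ => ?_
  rcases (hp.nonneg ω).eq_or_lt with h0 | h0
  · simp [← h0]
  have h2 := massAt_pos hp g h0
  have h3 := massAt_pos hp (fun ω => (f ω, g ω)) h0
  have h4 := sum_mul_comp (p := p) g (g ω) fun x => (massAt p g x)⁻¹ *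
        (p ω * -Real.log (massAt p (fun ω => (f ω, g ω)) (f ω, g ω) / massAt p g (g ω)))
  rw [← mul_assoc, mul_inv_cancel₀ h2.ne', one_mul] at h4
  simp only [← mul_assoc] at h4 ⊢
  rw [h4, Real.log_div h3.ne' h2.ne']
  ring

/-- Two independent copies stay independent after conditioning on both pasts, so unconditional
entropy gains apply fibre by fibre. -/
lemma condWeight_prod {p' : Ω' → ℝ} (g : Ω → β) (k : Ω' → γ) (x : Ω × Ω') :
    condWeight (prodWeight p p') (fun x => (g x.1, k x.2)) x =
      prodWeight (condWeight p g x.1) (condWeight p' k x.2) := by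
  funext y
  unfold condWeight
  rw [massAt_prod]
  by_cases h1 : g y.1 = g x.1 <;> by_cases h2 : k y.2 = k x.2 <;>
    simp [h1, h2, prodWeight, div_mul_div_comm]

end Conditioning

end RenyiCompression

/-! ### Entropy gain for sums of independent real variables -/

namespace RenyiCompression

section EntropyPower

variable {Ω Ω' : Type} [Fintype Ω] [Fintype Ω'] {p : Ω → ℝ} {p' : Ω' → ℝ}
  (hp : IsWeight p) (hp' : IsWeight p') (f : Ω → ℝ) (f' : Ω' → ℝ)

include hp hp' in
-- The sum and `f'` together determine `f`, so `H(f) + H(f') ≤ H(f + f') + H(f')`.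
lemma finEntropy_le_add :
    finEntropy p f ≤ finEntropy (prodWeight p p') (fun x => f x.1 + f' x.2) := by
  have h := finEntropy_pair_le (hp.prod hp') (fun x => f x.1 + f' x.2) (fun x => f' x.2)
  rw [finEntropy_congr (k := fun x => (f x.1, f' x.2)), finEntropy_prod hp hp',
    finEntropy_prod_snd hp hp'] at h
  · linarith
  · intro x y
    simp only [Prod.mk.injEq]
    constructor <;> rintro ⟨h1, h2⟩ <;> refine ⟨by linarith, h2⟩

include hp hp' in
lemma finEntropy_add_comm :
    finEntropy (prodWeight p' p) (fun x => f' x.1 + f x.2) =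
      finEntropy (prodWeight p p') (fun x => f x.1 + f' x.2) := by
  rw [← finEntropy_equiv (Equiv.prodComm Ω Ω')]
  congr 1
  · funext x; simp [prodWeight, mul_comm]
  · funext x; simp [add_comm]

include hp in
lemma massAt_not (y : ℝ) :
    massAt p (fun ω => f ω = y) False = 1 - massAt p f y := by
  classical
  rw [← hp.sum_eq_one, massAt, massAt, ← Finset.sum_sub_distrib]
  refine Finset.sum_congr rfl fun ω _ => ?_
  by_cases h : f ω = y <;> simp [h]

include hp hp' in
open Classical in
/-- If `f'` has a large atom, the entropy of the sum is almost the sum of the entropies. -/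
lemma finEntropy_add_le_of_atom (y : ℝ) :
    finEntropy p f + finEntropy p' f' ≤ finEntropy (prodWeight p p') (fun x => f x.1 + f' x.2) +
      (Real.binEntropy (1 - massAt p' f' y) + (1 - massAt p' f' y) * finEntropy p f) := by
  -- `W` reveals `f` exactly when `f'` misses the atom `y`. With the sum it determines both
  -- variables: off the atom by subtraction, on it because `f' = y`. Its entropy is the binary
  -- entropy of the miss plus `H(f)` weighted by the probability of a miss.
  set W : Ω × Ω' → Option ℝ := fun x => if f' x.2 = y then none else some (f x.1) with hW
  have hlow : finEntropy p f + finEntropy p' f' ≤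
      finEntropy (prodWeight p p') (fun x => (f x.1 + f' x.2, W x)) := by
    rw [← finEntropy_prod hp hp']
    refine finEntropy_mono (hp.prod hp') fun x z h => ?_
    simp only [Prod.mk.injEq, hW] at h ⊢
    obtain ⟨h1, h2⟩ := h
    split_ifs at h2 with h3 h4
    · exact ⟨by linarith, by rw [h3, h4]⟩
    · have := Option.some.inj h2
      exact ⟨this, by linarith⟩
  refine hlow.trans ((finEntropy_pair_le (hp.prod hp') _ _).trans (add_le_add le_rfl ?_))
  set α := massAt p' f' y with hα
  have hnone : massAt (prodWeight p p') W none = α := by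
    rw [hα, ← massAt_prod_snd hp hp']
    refine massAt_congr fun x => ?_
    simp [hW]
  have hsome : ∀ c, massAt (prodWeight p p') W (some c) = massAt p f c * (1 - α) := fun c => by
    rw [hα, ← massAt_not hp', ← massAt_prod]
    refine massAt_congr fun x => ?_
    by_cases h : f' x.2 = y <;> simp [hW, h]
  have key : ∀ x, prodWeight p p' x * -Real.log (massAt (prodWeight p p') W (W x)) =
      prodWeight p p' x * (if f' x.2 = y then -Real.log α else -Real.log (1 - α)) +
      (p x.1 * -Real.log (massAt p f (f x.1))) * (if f' x.2 = y then 0 else p' x.2) := by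
    intro x
    by_cases h : f' x.2 = y
    · have : W x = none := by simp [hW, h]
      rw [this, hnone, if_pos h, if_pos h]
      ring
    · have : W x = some (f x.1) := by simp [hW, h]
      rw [this, hsome, if_neg h, if_neg h]
      rcases (hp.nonneg x.1).eq_or_lt with h0 | h0
      · simp [prodWeight, ← h0]
      rcases (hp'.nonneg x.2).eq_or_lt with h1 | h1
      · simp [prodWeight, ← h1]
      have h2 : 0 < 1 - α := by
        rw [hα, ← massAt_not hp']
        have := massAt_pos hp' (fun ω => f' ω = y) h1
        simpa [h] using this
      rw [Real.log_mul (massAt_pos hp f h0).ne' h2.ne', prodWeight]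
      ring
  have hnot : ∑ ω, (if f' ω = y then 0 else p' ω) = 1 - α := by
    rw [hα, ← massAt_not hp', massAt]
    exact Finset.sum_congr rfl fun ω _ => by by_cases h : f' ω = y <;> simp [h]
  have hbin : ∑ ω, p' ω * (if f' ω = y then -Real.log α else -Real.log (1 - α)) =
      Real.binEntropy (1 - α) := by
    have h1 : ∀ ω, p' ω * (if f' ω = y then -Real.log α else -Real.log (1 - α)) =
        (if f' ω = y then p' ω else 0) * -Real.log α +
          (if f' ω = y then 0 else p' ω) * -Real.log (1 - α) := fun ω => by
      by_cases h : f' ω = y <;> simp [h]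
    simp only [h1]
    rw [Finset.sum_add_distrib, ← Finset.sum_mul, ← Finset.sum_mul, hnot,
      Real.binEntropy_one_sub, Real.binEntropy, Real.log_inv, Real.log_inv, hα, massAt]
  rw [finEntropy, Finset.sum_congr rfl fun x _ => key x, Finset.sum_add_distrib,
    sum_prodWeight_snd hp hp' (fun ω => if f' ω = y then -Real.log α else -Real.log (1 - α)), hbin,
    Fintype.sum_prod_type]
  simp only
  rw [← Finset.sum_mul_sum, hnot, finEntropy, mul_comm (1 - α)]

/-- The divergence of the law of the sum from the law of `f` shifted by `f' ω'`. -/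
def shiftDivergence (p : Ω → ℝ) (p' : Ω' → ℝ) (f : Ω → ℝ) (f' : Ω' → ℝ) (ω' : Ω') : ℝ :=
  ∑ ω, p ω * (Real.log (massAt p f (f ω)) -
    Real.log (massAt (prodWeight p p') (fun x => f x.1 + f' x.2) (f ω + f' ω')))

include hp hp' in
-- The entropy gain is the mutual information of the sum and `f'`, an average of divergences over
-- the possible shifts.
lemma finEntropy_add_sub :
    finEntropy (prodWeight p p') (fun x => f x.1 + f' x.2) - finEntropy p f =
      ∑ ω', p' ω' * shiftDivergence p p' f f' ω' := by
  unfold finEntropy shiftDivergence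
  rw [← sum_prodWeight_fst hp hp' (fun ω => -Real.log (massAt p f (f ω))),
    ← Finset.sum_sub_distrib, Fintype.sum_prod_type_right]
  refine Finset.sum_congr rfl fun ω' _ => ?_
  rw [Finset.mul_sum]
  refine Finset.sum_congr rfl fun ω _ => ?_
  simp only [prodWeight]
  ring

include hp hp' in
open Classical in
-- The left side is the mass that the law of the sum, shifted back by `y`, gives to the support of
-- `f`. If `x` lies outside this support, its mass is missing. Keeping track of it makes the next
-- estimate valid at every `x`.
lemma sum_mul_ratio_le (y x : ℝ) :
    ∑ ω, p ω * (massAt (prodWeight p p') (fun x => f x.1 + f' x.2) (f ω + y) /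
      massAt p f (f ω)) ≤ 1 - if massAt p f x = 0 then
        massAt (prodWeight p p') (fun x => f x.1 + f' x.2) (x + y) else 0 := by
  have h1 : ∀ ω, p ω * (massAt (prodWeight p p') (fun x => f x.1 + f' x.2) (f ω + y) /
      massAt p f (f ω)) = ∑ z, prodWeight p p' z *
        if f ω = f z.1 + f' z.2 - y then p ω * (massAt p f (f ω))⁻¹ else 0 := fun ω => by
    rw [massAt, Finset.sum_div, Finset.mul_sum]
    refine Finset.sum_congr rfl fun z _ => ?_
    by_cases h : f z.1 + f' z.2 = f ω + y
    · rw [if_pos h, if_pos (by linarith)]; ring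
    · rw [if_neg h, if_neg (fun h' => h (by linarith))]; ring
  simp only [h1]
  rw [Finset.sum_comm]
  simp only [← Finset.mul_sum]
  rw [le_sub_iff_add_le]
  have h2 : (if massAt p f x = 0 then
      massAt (prodWeight p p') (fun x => f x.1 + f' x.2) (x + y) else 0) =
      ∑ z, prodWeight p p' z * if massAt p f x = 0 ∧ f z.1 + f' z.2 = x + y then 1 else 0 := by
    by_cases h : massAt p f x = 0
    · simp only [h, if_true, true_and]
      rw [massAt]
      exact Finset.sum_congr rfl fun z _ => by split_ifs <;> simp
    · simp only [h, if_false, false_and, mul_zero, Finset.sum_const_zero]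
  rw [h2, ← Finset.sum_add_distrib]
  refine le_trans ?_ (hp.prod hp').sum_eq_one.le
  refine Finset.sum_le_sum fun z _ => ?_
  rw [← mul_add]
  refine mul_le_of_le_one_right ((hp.prod hp').nonneg z) ?_
  have h3 := sum_mul_comp (p := p) f (f z.1 + f' z.2 - y) fun x => (massAt p f x)⁻¹
  rw [h3]
  by_cases h : massAt p f x = 0 ∧ f z.1 + f' z.2 = x + y
  · rw [if_pos h, h.2, add_sub_cancel_right, h.1]
    simp
  · rw [if_neg h, add_zero]
    exact mul_inv_le_one

include hp hp' in
-- The divergence dominates the squared Hellinger distance, of which the left side is the single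
-- term at `x`.
lemma sq_le_shiftDivergence {ω' : Ω'} (hω' : 0 < p' ω') (x : ℝ) :
    (√(massAt p f x) - √(massAt (prodWeight p p') (fun x => f x.1 + f' x.2) (x + f' ω'))) ^ 2 ≤
      shiftDivergence p p' f f' ω' := by
  classical
  set R := massAt (prodWeight p p') (fun x => f x.1 + f' x.2) with hR
  set y := f' ω' with hy
  have hR0 : ∀ s, 0 ≤ R s := massAt_nonneg (hp.prod hp') _
  have hterm : ∀ ω, p ω * (1 - √(R (f ω + y) / massAt p f (f ω))) ^ 2 +
      (p ω - p ω * (R (f ω + y) / massAt p f (f ω))) ≤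
      p ω * (Real.log (massAt p f (f ω)) - Real.log (R (f ω + y))) := fun ω => by
    rcases (hp.nonneg ω).eq_or_lt with h0 | h0
    · simp [← h0]
    have h1 := massAt_pos hp f h0
    have h2 : 0 < R (f ω + y) :=
      massAt_pos (hp.prod hp') (fun x => f x.1 + f' x.2) (ω := (ω, ω')) (mul_pos h0 hω')
    have h3 : 0 < R (f ω + y) / massAt p f (f ω) := div_pos h2 h1
    set t := R (f ω + y) / massAt p f (f ω) with ht
    have h4 : Real.log (massAt p f (f ω)) - Real.log (R (f ω + y)) = -(2 * Real.log (√t)) := by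
      rw [Real.log_sqrt h3.le, ht, Real.log_div h2.ne' h1.ne']; ring
    have h5 := Real.log_le_sub_one_of_pos (Real.sqrt_pos.2 h3)
    have h6 := Real.sq_sqrt h3.le
    -- From `-2 log s ≥ 2(1 - s) = (1 - s)² + (1 - s²)` with `s = √t`.
    have h7 : (1 - √t) ^ 2 + (1 - t) ≤ -(2 * Real.log (√t)) := by nlinarith
    rw [h4]
    have := mul_le_mul_of_nonneg_left h7 h0.le
    linarith
  have hsum : ∑ ω, p ω * (1 - √(R (f ω + y) / massAt p f (f ω))) ^ 2 +
      (1 - ∑ ω, p ω * (R (f ω + y) / massAt p f (f ω))) ≤ shiftDivergence p p' f f' ω' := by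
    have h1 : 1 - ∑ ω, p ω * (R (f ω + y) / massAt p f (f ω)) =
        ∑ ω, (p ω - p ω * (R (f ω + y) / massAt p f (f ω))) := by
      rw [Finset.sum_sub_distrib, hp.sum_eq_one]
    rw [h1, ← Finset.sum_add_distrib]
    exact Finset.sum_le_sum fun ω _ => hterm ω
  have hratio := sum_mul_ratio_le hp hp' f f' y x
  rw [← hR] at hratio
  refine le_trans ?_ hsum
  by_cases hx : massAt p f x = 0
  · rw [if_pos hx] at hratio
    rw [hx, Real.sqrt_zero, zero_sub, neg_sq, Real.sq_sqrt (hR0 _)]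
    have : 0 ≤ ∑ ω, p ω * (1 - √(R (f ω + y) / massAt p f (f ω))) ^ 2 :=
      Finset.sum_nonneg fun ω _ => mul_nonneg (hp.nonneg _) (sq_nonneg _)
    linarith
  · rw [if_neg hx] at hratio
    have hx0 : 0 < massAt p f x := lt_of_le_of_ne (massAt_nonneg hp _ _) (Ne.symm hx)
    have h1 : massAt p f x * (1 - √(R (x + y) / massAt p f x)) ^ 2 ≤
        ∑ ω, p ω * (1 - √(R (f ω + y) / massAt p f (f ω))) ^ 2 := by
      rw [← sum_mul_comp (p := p) f x fun x => (1 - √(R (x + y) / massAt p f x)) ^ 2]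
      refine Finset.sum_le_sum fun ω _ => ?_
      split_ifs
      exacts [le_rfl, mul_nonneg (hp.nonneg _) (sq_nonneg _)]
    have h2 : (√(massAt p f x) - √(R (x + y))) ^ 2 =
        massAt p f x * (1 - √(R (x + y) / massAt p f x)) ^ 2 := by
      rw [Real.sqrt_div (hR0 _)]
      have h3 := Real.sqrt_pos.2 hx0
      have h4 : √(massAt p f x) - √(R (x + y)) =
          √(massAt p f x) * (1 - √(R (x + y)) / √(massAt p f x)) := by field_simp
      rw [h4, mul_pow, Real.sq_sqrt hx0.le]
    linarith

include hp in
lemma sum_massAt_le_one {u : ℕ → ℝ} (hu : Function.Injective u) (M : ℕ) :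
    ∑ k ∈ Finset.range M, massAt p f (u k) ≤ 1 := by
  classical
  unfold massAt
  rw [Finset.sum_comm, ← hp.sum_eq_one]
  refine Finset.sum_le_sum fun ω _ => ?_
  rw [← Finset.sum_filter, Finset.sum_const, nsmul_eq_mul]
  refine mul_le_of_le_one_left (hp.nonneg ω) ?_
  have : ((Finset.range M).filter fun k => f ω = u k).card ≤ 1 :=
    Finset.card_le_one.2 fun a ha b hb => hu
      ((Finset.mem_filter.1 ha).2.symm.trans (Finset.mem_filter.1 hb).2)
  exact_mod_cast this

include hp in
-- If all masses were below `exp (-b)`, every code length, hence the entropy, would exceed `b`.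
lemma exists_exp_le_massAt {b : ℝ} (h : finEntropy p f ≤ b) :
    ∃ x, Real.exp (-b) ≤ massAt p f x := by
  by_contra! hlt
  have h1 : ∀ ω, p ω * b ≤ p ω * -Real.log (massAt p f (f ω)) := fun ω => by
    rcases (hp.nonneg ω).eq_or_lt with h0 | h0
    · simp [← h0]
    refine mul_le_mul_of_nonneg_left ?_ h0.le
    rw [le_neg, ← Real.log_exp (-b)]
    exact Real.log_le_log (massAt_pos hp f h0) (hlt _).le
  obtain ⟨ω, hω⟩ : ∃ ω, 0 < p ω := by
    by_contra! h0
    have := hp.sum_eq_one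
    rw [Finset.sum_eq_zero fun ω _ => le_antisymm (h0 ω) (hp.nonneg ω)] at this
    norm_num at this
  have h2 : p ω * b < p ω * -Real.log (massAt p f (f ω)) := by
    refine mul_lt_mul_of_pos_left ?_ hω
    rw [lt_neg, ← Real.log_exp (-b)]
    exact Real.log_lt_log (massAt_pos hp f hω) (hlt _)
  have h3 := Finset.sum_lt_sum (fun ω _ => h1 ω) ⟨ω, Finset.mem_univ _, h2⟩
  rw [← Finset.sum_mul, hp.sum_eq_one, one_mul] at h3
  exact absurd h (not_le.2 h3)

include hp hp' in
/-- If the divergence is mostly small and `f'` is not nearly constant, then some shift moves the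
law of `f` only a little. -/
lemma exists_shift {η ζ : ℝ} (hζ : 0 < ζ)
    (hspread : ∀ y, massAt p' f' y ≤ 1 - η)
    (hsmall : finEntropy (prodWeight p p') (fun x => f x.1 + f' x.2) <
      finEntropy p f + η * ζ ^ 2) :
    ∃ d : ℝ, d ≠ 0 ∧ ∀ x, √(massAt p f x) - 2 * ζ ≤ √(massAt p f (x + d)) := by
  classical
  have hD0 : ∀ ω', 0 < p' ω' → 0 ≤ shiftDivergence p p' f f' ω' := fun ω' h =>
    (sq_nonneg _).trans (sq_le_shiftDivergence hp hp' f f' h 0)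
  -- The mean divergence is below `η ζ²`, so the shifts with divergence at most `ζ²` carry mass
  -- above `1 - η`, too much for one value of `f'`. Two distinct such values put two shifts of the
  -- law of `f` within `ζ` of the law of the sum; their difference is the required `d`.
  obtain ⟨ω₁, ω₂, h1, h2, h1', h2', hne⟩ : ∃ ω₁ ω₂, 0 < p' ω₁ ∧ 0 < p' ω₂ ∧
      shiftDivergence p p' f f' ω₁ ≤ ζ ^ 2 ∧ shiftDivergence p p' f f' ω₂ ≤ ζ ^ 2 ∧
      f' ω₁ ≠ f' ω₂ := by
    by_contra! hcon
    obtain ⟨y, hy⟩ : ∃ y, ∀ ω', 0 < p' ω' → shiftDivergence p p' f f' ω' ≤ ζ ^ 2 → f' ω' = y := by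
      by_cases hex : ∃ ω', 0 < p' ω' ∧ shiftDivergence p p' f f' ω' ≤ ζ ^ 2
      · obtain ⟨ω, hω, hω'⟩ := hex
        exact ⟨f' ω, fun ω' h h' => hcon ω' ω h hω h' hω'⟩
      · push Not at hex
        exact ⟨0, fun ω' h h' => absurd h' (not_le.2 (hex ω' h))⟩
    have hle : ∀ ω', p' ω' * ζ ^ 2 ≤ (if f' ω' = y then p' ω' else 0) * ζ ^ 2 +
        p' ω' * shiftDivergence p p' f f' ω' := fun ω' => by
      rcases (hp'.nonneg ω').eq_or_lt with h0 | h0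
      · simp [← h0]
      by_cases h : shiftDivergence p p' f f' ω' ≤ ζ ^ 2
      · rw [if_pos (hy ω' h0 h)]
        exact le_add_of_nonneg_right (mul_nonneg h0.le (hD0 ω' h0))
      · push Not at h
        have h3 : 0 ≤ (if f' ω' = y then p' ω' else 0) := by
          split_ifs; exacts [h0.le, le_rfl]
        have := mul_le_mul_of_nonneg_left h.le h0.le
        have := mul_nonneg h3 (sq_nonneg ζ)
        linarith
    have h3 := Finset.sum_le_sum fun ω' (_ : ω' ∈ Finset.univ) => hle ω'
    rw [Finset.sum_add_distrib, ← Finset.sum_mul, ← Finset.sum_mul, hp'.sum_eq_one,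
      ← finEntropy_add_sub hp hp'] at h3
    have h4 := mul_le_mul_of_nonneg_right (hspread y) (sq_nonneg ζ)
    rw [massAt] at h4
    linarith
  refine ⟨f' ω₁ - f' ω₂, sub_ne_zero.2 hne, fun x => ?_⟩
  have e1 := abs_le.1 (abs_le_of_sq_le_sq ((sq_le_shiftDivergence hp hp' f f' h1 x).trans h1') hζ.le)
  have e2 := abs_le.1 (abs_le_of_sq_le_sq ((sq_le_shiftDivergence hp hp' f f' h2
    (x + (f' ω₁ - f' ω₂))).trans h2') hζ.le)
  have e3 : x + (f' ω₁ - f' ω₂) + f' ω₂ = x + f' ω₁ := by ring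
  rw [e3] at e2
  linarith [e1.1, e1.2, e2.1, e2.2]

end EntropyPower

/-- A sum of independent variables gains entropy unless one of them is nearly constant. -/
lemma exists_gain_of_spread (b : ℝ) {η : ℝ} (hη : 0 < η) :
    ∃ γ : ℝ, 0 < γ ∧ ∀ {Ω Ω' : Type} [Fintype Ω] [Fintype Ω'] {p : Ω → ℝ} {p' : Ω' → ℝ},
      IsWeight p → IsWeight p' → ∀ (f : Ω → ℝ) (f' : Ω' → ℝ), finEntropy p f ≤ b →
      (∀ y, massAt p' f' y ≤ 1 - η) →
      finEntropy p f + γ ≤ finEntropy (prodWeight p p') (fun x => f x.1 + f' x.2) := by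
  set s := √(Real.exp (-b)) with hs
  have hs0 : 0 < s := Real.sqrt_pos.2 (Real.exp_pos _)
  -- With `ζ = s / (4M)`, each shift by `d` lowers the root mass by at most `2ζ`. Starting from a
  -- point of root mass at least `s`, `M` shifts keep it above `s/2`: this gives `M` distinct points
  -- of mass at least `s²/4`, total mass above `1`.
  obtain ⟨M, hM⟩ := exists_nat_gt (4 / s ^ 2)
  have hM0 : (0 : ℝ) < M := lt_trans (by positivity) hM
  refine ⟨η * (s / (4 * M)) ^ 2, by positivity, ?_⟩
  intro Ω Ω' _ _ p p' hp hp' f f' hb hspread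
  by_contra! hcon
  obtain ⟨d, hd, hshift⟩ := exists_shift hp hp' f f' (by positivity : 0 < s / (4 * M))
    hspread hcon
  obtain ⟨x, hx⟩ := exists_exp_le_massAt hp f hb
  have hiter : ∀ k : ℕ, s - k * (2 * (s / (4 * M))) ≤ √(massAt p f (x + k * d)) := by
    intro k
    induction k with
    | zero => simpa using Real.sqrt_le_sqrt hx
    | succ k ih =>
      have := hshift (x + k * d)
      rw [show x + ((k + 1 : ℕ) : ℝ) * d = x + k * d + d by push_cast; ring]
      push_cast
      linarith
  have hge : ∀ k ∈ Finset.range M, s ^ 2 / 4 ≤ massAt p f (x + k * d) := fun k hk => by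
    have hk' : (k : ℝ) ≤ M := by exact_mod_cast (Finset.mem_range.1 hk).le
    have h1 : (k : ℝ) * (2 * (s / (4 * M))) ≤ s / 2 := by
      calc (k : ℝ) * (2 * (s / (4 * M))) ≤ M * (2 * (s / (4 * M))) :=
            mul_le_mul_of_nonneg_right hk' (by positivity)
        _ = s / 2 := by field_simp; norm_num
    have h2 : s / 2 ≤ √(massAt p f (x + k * d)) := by linarith [hiter k]
    calc s ^ 2 / 4 = (s / 2) ^ 2 := by ring
      _ ≤ √(massAt p f (x + k * d)) ^ 2 := pow_le_pow_left₀ (by positivity) h2 2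
      _ = _ := Real.sq_sqrt (massAt_nonneg hp _ _)
  have hinj : Function.Injective fun k : ℕ => x + (k : ℝ) * d := fun i j h => by
    have : (i : ℝ) * d = j * d := by simpa using h
    exact_mod_cast mul_right_cancel₀ hd this
  have h1 := (Finset.sum_le_sum hge).trans (sum_massAt_le_one hp f hinj M)
  rw [Finset.sum_const, Finset.card_range, nsmul_eq_mul] at h1
  rw [div_lt_iff₀ (by positivity)] at hM
  linarith

/-- An entropy power inequality: adding an independent variable of entropy at least `a` to a
variable of entropy at most `b` increases the entropy by a definite amount. -/
theorem exists_entropy_gain {a : ℝ} (ha : 0 < a) (b : ℝ) :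
    ∃ γ : ℝ, 0 < γ ∧ ∀ {Ω Ω' : Type} [Fintype Ω] [Fintype Ω'] {p : Ω → ℝ} {p' : Ω' → ℝ},
      IsWeight p → IsWeight p' → ∀ (f : Ω → ℝ) (f' : Ω' → ℝ), finEntropy p f ≤ b →
      a ≤ finEntropy p' f' →
      finEntropy p f + γ ≤ finEntropy (prodWeight p p') (fun x => f x.1 + f' x.2) := by
  -- `η` decides when an atom of `f'` counts as large: above `1 - η`, the error in
  -- `finEntropy_add_le_of_atom` is under `a/2`, so at least half of the entropy of `f'` is gained.
  -- Otherwise `f'` is spread and `exists_gain_of_spread` applies.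
  obtain ⟨η, hη, hsmall⟩ : ∃ η > 0, ∀ t, 0 ≤ t → t < η → Real.binEntropy t + t * b < a / 2 := by
    have hcont : Continuous fun t => Real.binEntropy t + t * b :=
      Real.binEntropy_continuous.add (continuous_id.mul continuous_const)
    have h0 := hcont.tendsto 0
    simp only [Real.binEntropy_zero, zero_mul, add_zero] at h0
    obtain ⟨η, hη, h⟩ := Metric.eventually_nhds_iff.1
      (h0.eventually_lt_const (by positivity : (0 : ℝ) < a / 2))
    refine ⟨η, hη, fun t ht htη => h ?_⟩
    rwa [Real.dist_eq, sub_zero, abs_of_nonneg ht]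
  obtain ⟨γ, hγ, hgain⟩ := exists_gain_of_spread b hη
  refine ⟨min γ (a / 2), lt_min hγ (by positivity), ?_⟩
  intro Ω Ω' _ _ p p' hp hp' f f' hfb hfa
  by_cases hat : ∃ y, 1 - η < massAt p' f' y
  · obtain ⟨y, hy⟩ := hat
    have h1 := finEntropy_add_le_of_atom hp hp' f f' y
    have h2 : 0 ≤ 1 - massAt p' f' y := sub_nonneg.2 (massAt_le_one hp' _ _)
    have h3 := hsmall _ h2 (by linarith)
    have h4 := mul_le_mul_of_nonneg_left hfb h2
    linarith [min_le_right γ (a / 2)]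
  · push Not at hat
    linarith [hgain hp hp' f f' hfb hat, min_le_left γ (a / 2)]

section ConditionalEntropyPower

/-- The conditional entropy `h` varies with the past, and the bounds `a`, `b` hold only on average.
Either `h ≥ a/4` with probability at least `1/2`, and a pair of independent pasts is eligible for
the unconditional gain with probability at least `1/4`; or the entropy is concentrated on less than
half of the pasts, and a sum profits from whichever copy has the large value. -/
lemma exists_conditional_entropy_gain {a : ℝ} (ha : 0 < a) {b : ℝ} (hb : 0 < b) :
    ∃ γ : ℝ, 0 < γ ∧ ∀ {Ω β : Type} [Fintype Ω] {p : Ω → ℝ},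
      IsWeight p → ∀ (f : Ω → ℝ) (g : Ω → β),
      a ≤ finEntropy p (fun ω => (f ω, g ω)) - finEntropy p g →
      finEntropy p (fun ω => (f ω, g ω)) - finEntropy p g ≤ b →
      finEntropy p (fun ω => (f ω, g ω)) - finEntropy p g + γ ≤
        finEntropy (prodWeight p p) (fun x => (f x.1 + f x.2, (g x.1, g x.2))) -
          finEntropy (prodWeight p p) (fun x => (g x.1, g x.2)) := by
  classical
  obtain ⟨γ, hγ, hgain⟩ := exists_entropy_gain (by positivity : 0 < a / 4) (2 * b)
  refine ⟨min (γ / 4) (a / 8), lt_min (by positivity) (by positivity), ?_⟩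
  intro Ω β _ p hp f g h1 h2
  rw [finEntropy_sub_eq_sum (hp.prod hp)]
  rw [finEntropy_sub_eq_sum hp] at h1 h2 ⊢
  simp only [condWeight_prod]
  set h : Ω → ℝ := fun ω => finEntropy (condWeight p g ω) f with hh
  set H : Ω × Ω → ℝ := fun x => finEntropy (prodWeight (condWeight p g x.1) (condWeight p g x.2))
    (fun x => f x.1 + f x.2) with hH
  change ∑ ω, p ω * h ω + _ ≤ ∑ x, prodWeight p p x * H x
  change a ≤ ∑ ω, p ω * h ω at h1
  change ∑ ω, p ω * h ω ≤ b at h2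
  have hh0 : ∀ ω, 0 < p ω → 0 ≤ h ω := fun ω hω => finEntropy_nonneg (hp.cond g hω) _
  have hfst : ∀ x : Ω × Ω, 0 < p x.1 → 0 < p x.2 → h x.1 ≤ H x := fun x hx hy =>
    finEntropy_le_add (hp.cond g hx) (hp.cond g hy) f f
  have hsnd : ∀ x : Ω × Ω, 0 < p x.1 → 0 < p x.2 → h x.2 ≤ H x := fun x hx hy => by
    have := finEntropy_le_add (hp.cond g hy) (hp.cond g hx) f f
    rwa [finEntropy_add_comm (hp.cond g hx) (hp.cond g hy)] at this
  have hinc : ∀ x : Ω × Ω, 0 < p x.1 → 0 < p x.2 → h x.1 ≤ 2 * b → a / 4 ≤ h x.2 →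
      h x.1 + γ ≤ H x := fun x hx hy => hgain (hp.cond g hx) (hp.cond g hy) f f
  set q : ℝ := ∑ ω, p ω * (if a / 4 ≤ h ω then 1 else 0) with hq
  have hpt : ∀ {F : Ω × Ω → ℝ}, (∀ x, 0 < p x.1 → 0 < p x.2 → F x ≤ H x) →
      ∑ x, prodWeight p p x * F x ≤ ∑ x, prodWeight p p x * H x := fun {F} hF => by
    refine Finset.sum_le_sum fun x _ => ?_
    rcases (hp.nonneg x.1).eq_or_lt with h0 | h0
    · simp [prodWeight, ← h0]
    rcases (hp.nonneg x.2).eq_or_lt with h0' | h0'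
    · simp [prodWeight, ← h0']
    exact mul_le_mul_of_nonneg_left (hF x h0 h0') ((hp.prod hp).nonneg x)
  have hmul : ∀ F G : Ω → ℝ, ∑ x, prodWeight p p x * (F x.1 * G x.2) =
      (∑ ω, p ω * F ω) * ∑ ω, p ω * G ω := fun F G => by
    rw [Finset.sum_mul_sum, Fintype.sum_prod_type]
    refine Finset.sum_congr rfl fun ω _ => Finset.sum_congr rfl fun ω' _ => ?_
    simp only [prodWeight]; ring
  by_cases hq2 : 1 / 2 ≤ q
  -- Markov's inequality: `h` has mean at most `b`, so `h ≤ 2b` with probability at least `1/2`.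
  · have hmark : 1 / 2 ≤ ∑ ω, p ω * (if h ω ≤ 2 * b then 1 else 0) := by
      have h3 : ∀ ω, p ω * (2 * b) ≤ p ω * (if h ω ≤ 2 * b then 1 else 0) * (2 * b) +
          p ω * h ω := fun ω => by
        rcases (hp.nonneg ω).eq_or_lt with h0 | h0
        · simp [← h0]
        have := hh0 ω h0
        split_ifs with h4
        · have := mul_nonneg h0.le this; linarith
        · have := mul_le_mul_of_nonneg_left (not_le.1 h4).le h0.le; linarith
      have h4 := Finset.sum_le_sum fun ω (_ : ω ∈ Finset.univ) => h3 ω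
      rw [Finset.sum_add_distrib, ← Finset.sum_mul, ← Finset.sum_mul, hp.sum_eq_one] at h4
      nlinarith
    have h5 := hpt (F := fun x => h x.1 + γ * ((if h x.1 ≤ 2 * b then 1 else 0) *
      (if a / 4 ≤ h x.2 then 1 else 0))) (fun x hx hy => by
        by_cases h6 : h x.1 ≤ 2 * b
        · by_cases h7 : a / 4 ≤ h x.2
          · have := hinc x hx hy h6 h7
            simp only [h6, h7, if_true, mul_one]; exact this
          · simp only [h7, if_false, mul_zero, add_zero]; exact hfst x hx hy
        · simp only [h6, if_false, zero_mul, mul_zero, add_zero]; exact hfst x hx hy)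
    refine le_trans ?_ h5
    simp only [mul_add, Finset.sum_add_distrib]
    rw [sum_prodWeight_fst hp hp h]
    have h8 : ∑ x, prodWeight p p x * (γ * ((if h x.1 ≤ 2 * b then 1 else 0) *
        (if a / 4 ≤ h x.2 then 1 else 0))) =
        γ * ((∑ ω, p ω * (if h ω ≤ 2 * b then 1 else 0)) * q) := by
      rw [hq, ← hmul, Finset.mul_sum]
      exact Finset.sum_congr rfl fun x _ => by ring
    rw [h8]
    have h9 : 1 / 4 ≤ (∑ ω, p ω * (if h ω ≤ 2 * b then (1 : ℝ) else 0)) * q := by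
      calc (1 : ℝ) / 4 = 1 / 2 * (1 / 2) := by norm_num
        _ ≤ _ := mul_le_mul hmark hq2 (by norm_num) (le_trans (by norm_num) hmark)
    have := mul_le_mul_of_nonneg_left h9 hγ.le
    linarith [min_le_left (γ / 4) (a / 8)]
  · push Not at hq2
    -- `u` discards the small values, at a cost of at most `a/4` in the mean, so its mean is at
    -- least `3a/4`. The sum has entropy at least `u` of the first copy or, if that is discarded, of
    -- the second. The mean is then at least `(2 - q)` times that of `u`, a gain of `a/8` over the
    -- mean of `h`.
    set u : Ω → ℝ := fun ω => if a / 4 ≤ h ω then h ω else 0 with hu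
    have h5 := hpt (F := fun x => u x.1 + (1 - if a / 4 ≤ h x.1 then 1 else 0) * u x.2)
      (fun x hx hy => by
        have e1 := hfst x hx hy
        have e2 := hsnd x hx hy
        have e3 := hh0 _ hx
        simp only [hu]
        split_ifs <;> linarith)
    refine le_trans ?_ h5
    simp only [mul_add, Finset.sum_add_distrib]
    rw [sum_prodWeight_fst hp hp u, hmul (fun ω => 1 - if a / 4 ≤ h ω then 1 else 0) u]
    have h6 : ∑ ω, p ω * (1 - if a / 4 ≤ h ω then 1 else 0) = 1 - q := by
      simp only [mul_sub, Finset.sum_sub_distrib, mul_one, hp.sum_eq_one, hq]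
    have h7 : ∑ ω, p ω * h ω ≤ ∑ ω, p ω * u ω + a / 4 := by
      rw [← one_mul (a / 4), ← hp.sum_eq_one, Finset.sum_mul, ← Finset.sum_add_distrib]
      refine Finset.sum_le_sum fun ω _ => ?_
      rw [← mul_add]
      refine mul_le_mul_of_nonneg_left ?_ (hp.nonneg ω)
      simp only [hu]
      split_ifs <;> linarith
    rw [h6]
    have h8 : 0 ≤ ∑ ω, p ω * u ω := by linarith
    have h9 := mul_nonneg (by linarith : 0 ≤ 1 / 2 - q) h8
    linarith [min_le_right (γ / 4) (a / 8)]

end ConditionalEntropyPower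

end RenyiCompression

/-! ### Polarization of the row entropies of a finite alphabet -/

namespace RenyiCompression

section EntropyPolarization

variable {A : Type} [Fintype A] {w : A → ℝ} (hw : IsWeight w) (val : A → ℝ)

include hw in
lemma isWeight_wordWeight {ι : Type*} [Fintype ι] [DecidableEq ι] :
    IsWeight (fun c : ι → A => wordWeight w c) where
  nonneg := wordWeight_nonneg hw.nonneg
  sum_eq_one := sum_wordWeight hw.sum_eq_one

/-- The `i`-th Hadamard coefficient of the word `c`. -/
def rowOut {n : ℕ} (c : Fin (2 ^ n) → A) (i : Fin (2 ^ n)) : ℝ :=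
  (hadamard n).mulVec (fun j => val (c j)) i

/-- The Hadamard coefficients with index in `R`. -/
def rowsOut {n : ℕ} (R : Finset (Fin (2 ^ n))) (c : Fin (2 ^ n) → A) : Fin (2 ^ n) → ℝ :=
  fun i => if i ∈ R then rowOut val c i else 0

variable {val} in
lemma rowsOut_eq_iff {n : ℕ} {R : Finset (Fin (2 ^ n))} {c c' : Fin (2 ^ n) → A} :
    rowsOut val R c = rowsOut val R c' ↔ ∀ i ∈ R, rowOut val c i = rowOut val c' i := by
  constructor
  · intro h i hi
    have := congrFun h i
    simpa [rowsOut, hi] using this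
  · intro h
    funext i
    by_cases hi : i ∈ R
    · simp [rowsOut, hi, h i hi]
    · simp [rowsOut, hi]

lemma rowOut_glue_inl {n : ℕ} (c₁ c₂ : Fin (2 ^ n) → A) (i : Fin (2 ^ n)) :
    rowOut val (glue c₁ c₂) (halves n (.inl i)) = rowOut val c₁ i + rowOut val c₂ i := by
  simp [rowOut, hadamard_mulVec_inl]

lemma rowOut_glue_inr {n : ℕ} (c₁ c₂ : Fin (2 ^ n) → A) (i : Fin (2 ^ n)) :
    rowOut val (glue c₁ c₂) (halves n (.inr i)) = rowOut val c₁ i - rowOut val c₂ i := by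
  simp [rowOut, hadamard_mulVec_inr]

/-- The rows before the row `i`. -/
def pastRows {n : ℕ} (i : Fin (2 ^ n)) : Finset (Fin (2 ^ n)) :=
  Finset.univ.filter fun j => rowPos n j < rowPos n i

@[simp] lemma mem_pastRows {n : ℕ} {i j : Fin (2 ^ n)} :
    j ∈ pastRows i ↔ rowPos n j < rowPos n i := by simp [pastRows]

/-- The conditional entropy of a Hadamard coefficient given the earlier ones. -/
def rowEntropy (w : A → ℝ) (val : A → ℝ) {n : ℕ} (i : Fin (2 ^ n)) : ℝ :=
  finEntropy (fun c : Fin (2 ^ n) → A => wordWeight w c)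
      (fun c => (rowOut val c i, rowsOut val (pastRows i) c)) -
    finEntropy (fun c : Fin (2 ^ n) → A => wordWeight w c) (rowsOut val (pastRows i))

include hw in
lemma rowEntropy_nonneg {n : ℕ} (i : Fin (2 ^ n)) : 0 ≤ rowEntropy w val i :=
  sub_nonneg.2 (finEntropy_mono (isWeight_wordWeight hw) fun _ _ h => (Prod.mk.inj h).2)

/-- The conditional entropy of the sum of two independent copies of a Hadamard coefficient given
both pasts. -/
def plusEntropy (w : A → ℝ) (val : A → ℝ) {n : ℕ} (i : Fin (2 ^ n)) : ℝ :=
  finEntropy (prodWeight (fun c : Fin (2 ^ n) → A => wordWeight w c)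
      (fun c : Fin (2 ^ n) → A => wordWeight w c))
      (fun x => (rowOut val x.1 i + rowOut val x.2 i,
        (rowsOut val (pastRows i) x.1, rowsOut val (pastRows i) x.2))) -
    finEntropy (prodWeight (fun c : Fin (2 ^ n) → A => wordWeight w c)
      (fun c : Fin (2 ^ n) → A => wordWeight w c))
      (fun x => (rowsOut val (pastRows i) x.1, rowsOut val (pastRows i) x.2))

lemma finEntropy_glue {n : ℕ} {β : Type*} (G : (Fin (2 ^ (n + 1)) → A) → β) :
    finEntropy (fun c : Fin (2 ^ (n + 1)) → A => wordWeight w c) G =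
      finEntropy (prodWeight (fun c : Fin (2 ^ n) → A => wordWeight w c)
        (fun c : Fin (2 ^ n) → A => wordWeight w c)) (fun x => G (glue x.1 x.2)) := by
  rw [← finEntropy_equiv (glueEquiv A n)]
  congr 1
  funext x
  exact wordWeight_glue w x.1 x.2

/-- Sums and differences of earlier rows determine both half-length pasts and conversely. For `inr`
the sum of row `i` itself joins the past. -/
lemma rowsOut_glue_inl_iff {n : ℕ} {i : Fin (2 ^ n)} {x y : (Fin (2 ^ n) → A) × (Fin (2 ^ n) → A)} :
    rowsOut val (pastRows (halves n (.inl i))) (glue x.1 x.2) =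
        rowsOut val (pastRows (halves n (.inl i))) (glue y.1 y.2) ↔
      (rowsOut val (pastRows i) x.1, rowsOut val (pastRows i) x.2) =
        (rowsOut val (pastRows i) y.1, rowsOut val (pastRows i) y.2) := by
  simp only [Prod.mk.injEq, rowsOut_eq_iff, forall_halves (n := n), mem_pastRows, rowPos_inl,
    rowPos_inr, rowOut_glue_inl, rowOut_glue_inr]
  constructor
  · rintro ⟨h1, h2⟩
    constructor <;> intro j hj <;> have e1 := h1 j (by omega) <;> have e2 := h2 j (by omega) <;>
      linarith
  · rintro ⟨h1, h2⟩
    constructor <;> intro j hj <;> rw [h1 j (by omega), h2 j (by omega)]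

lemma rowsOut_glue_inr_iff {n : ℕ} {i : Fin (2 ^ n)} {x y : (Fin (2 ^ n) → A) × (Fin (2 ^ n) → A)} :
    rowsOut val (pastRows (halves n (.inr i))) (glue x.1 x.2) =
        rowsOut val (pastRows (halves n (.inr i))) (glue y.1 y.2) ↔
      (rowOut val x.1 i + rowOut val x.2 i,
        (rowsOut val (pastRows i) x.1, rowsOut val (pastRows i) x.2)) =
      (rowOut val y.1 i + rowOut val y.2 i,
        (rowsOut val (pastRows i) y.1, rowsOut val (pastRows i) y.2)) := by
  simp only [Prod.mk.injEq, rowsOut_eq_iff, forall_halves (n := n), mem_pastRows, rowPos_inl,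
    rowPos_inr, rowOut_glue_inl, rowOut_glue_inr]
  constructor
  · rintro ⟨h1, h2⟩
    refine ⟨h1 i (by omega), ?_, ?_⟩ <;> intro j hj <;> have e1 := h1 j (by omega) <;>
      have e2 := h2 j (by omega) <;> linarith
  · rintro ⟨h0, h1, h2⟩
    constructor <;> intro j hj
    · rcases (by omega : rowPos n j ≤ rowPos n i).lt_or_eq with h | h
      · rw [h1 j h, h2 j h]
      · rw [rowPos_injective n h, h0]
    · rw [h1 j (by omega), h2 j (by omega)]

lemma rowEntropy_inl {n : ℕ} (i : Fin (2 ^ n)) :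
    rowEntropy w val (halves n (.inl i)) = plusEntropy w val i := by
  unfold rowEntropy plusEntropy
  rw [finEntropy_glue, finEntropy_glue]
  congr 1
  · refine finEntropy_congr fun x y => ?_
    rw [Prod.mk.injEq, rowsOut_glue_inl_iff, rowOut_glue_inl, rowOut_glue_inl, ← Prod.mk.injEq]
  · exact finEntropy_congr fun x y => rowsOut_glue_inl_iff val

include hw in
-- Conservation of entropy: sum and difference together are equivalent to the two original
-- coefficients, of total conditional entropy `2 * rowEntropy`.
lemma rowEntropy_inr {n : ℕ} (i : Fin (2 ^ n)) :
    rowEntropy w val (halves n (.inr i)) = 2 * rowEntropy w val i - plusEntropy w val i := by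
  have hww := isWeight_wordWeight (ι := Fin (2 ^ n)) hw
  unfold rowEntropy plusEntropy
  rw [finEntropy_glue, finEntropy_glue, finEntropy_congr (g := fun x : _ × _ => rowsOut val
    (pastRows (halves n (.inr i))) (glue x.1 x.2)) (fun x y => rowsOut_glue_inr_iff val),
    finEntropy_prod hww hww (rowsOut val (pastRows i)) (rowsOut val (pastRows i)),
    finEntropy_congr (k := fun x : _ × _ => ((rowOut val x.1 i, rowsOut val (pastRows i) x.1),
      (rowOut val x.2 i, rowsOut val (pastRows i) x.2))),
    finEntropy_prod hww hww (fun c => (rowOut val c i, rowsOut val (pastRows i) c))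
      (fun c => (rowOut val c i, rowsOut val (pastRows i) c))]
  · ring
  · intro x y
    rw [Prod.mk.injEq, rowsOut_glue_inr_iff, rowOut_glue_inr, rowOut_glue_inr]
    simp only [Prod.mk.injEq]
    constructor
    · rintro ⟨h1, h2, h3, h4⟩
      exact ⟨⟨by linarith, h3⟩, ⟨by linarith, h4⟩⟩
    · rintro ⟨⟨h1, h3⟩, ⟨h2, h4⟩⟩
      exact ⟨by linarith, by linarith, h3, h4⟩

include hw in
-- Conditioning the sum on the second copy leaves the uncertainty of the first.
lemma rowEntropy_le_plusEntropy {n : ℕ} (i : Fin (2 ^ n)) :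
    rowEntropy w val i ≤ plusEntropy w val i := by
  have hww := isWeight_wordWeight (ι := Fin (2 ^ n)) hw
  have h := finEntropy_submodular (hww.prod hww)
    (fun x => rowOut val x.1 i + rowOut val x.2 i) (fun x => rowOut val x.2 i)
    (fun x => (rowsOut val (pastRows i) x.1, rowsOut val (pastRows i) x.2))
  rw [finEntropy_congr (k := fun x : _ × _ => ((rowOut val x.1 i, rowsOut val (pastRows i) x.1),
      (rowOut val x.2 i, rowsOut val (pastRows i) x.2))),
    finEntropy_prod hww hww (fun c => (rowOut val c i, rowsOut val (pastRows i) c))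
      (fun c => (rowOut val c i, rowsOut val (pastRows i) c)),
    finEntropy_congr (g := fun x : _ × _ => (rowOut val x.2 i,
      (rowsOut val (pastRows i) x.1, rowsOut val (pastRows i) x.2)))
      (k := fun x : _ × _ => (rowsOut val (pastRows i) x.1,
        (rowOut val x.2 i, rowsOut val (pastRows i) x.2))),
    finEntropy_prod hww hww (rowsOut val (pastRows i))
      (fun c => (rowOut val c i, rowsOut val (pastRows i) c))] at h
  · unfold rowEntropy plusEntropy
    rw [finEntropy_prod hww hww (rowsOut val (pastRows i)) (rowsOut val (pastRows i))] at h ⊢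
    linarith
  · intro x y
    simp only [Prod.mk.injEq]
    tauto
  · intro x y
    simp only [Prod.mk.injEq]
    constructor
    · rintro ⟨h1, h2, h3, h4⟩
      exact ⟨⟨by linarith, h3⟩, h2, h4⟩
    · rintro ⟨⟨h1, h3⟩, h2, h4⟩
      exact ⟨by linarith, h2, h3, h4⟩

include hw in
lemma plusEntropy_le {n : ℕ} (i : Fin (2 ^ n)) : plusEntropy w val i ≤ 2 * rowEntropy w val i := by
  have := rowEntropy_nonneg hw val (halves n (.inr i))
  rw [rowEntropy_inr hw] at this
  linarith

include hw in
lemma sum_rowEntropy (n : ℕ) :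
    ∑ i : Fin (2 ^ n), rowEntropy w val i = 2 ^ n * rowEntropy w val (0 : Fin (2 ^ 0)) := by
  induction n with
  | zero =>
    rw [pow_zero (2 : ℝ), one_mul]
    exact Fintype.sum_unique (ι := Fin 1) fun i => rowEntropy w val (n := 0) i
  | succ n ih =>
    rw [sum_halves, ← Finset.sum_add_distrib]
    simp only [rowEntropy_inl, rowEntropy_inr hw]
    have : ∀ i : Fin (2 ^ n), plusEntropy w val i + (2 * rowEntropy w val i - plusEntropy w val i) =
      2 * rowEntropy w val i := fun i => by ring
    simp only [this]
    rw [← Finset.mul_sum, ih]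
    ring

end EntropyPolarization

section SqrtPotential

/-- Strict concavity of the square root in quantitative form. Row entropies are not uniformly
bounded, so a potential is needed whose mean is controlled in terms of the mean entropy. The square
root decreases by a definite amount whenever `h` is bounded and `g` is bounded below. -/
lemma sqrt_add_sqrt_le {h g : ℝ} (hh : 0 < h) (hg : 0 ≤ g) (hgh : g ≤ h) :
    √(h + g) + √(h - g) + g ^ 2 / (4 * (h * √h)) ≤ 2 * √h := by
  have hr : 0 < √h := Real.sqrt_pos.2 hh
  have hr2 : √h ^ 2 = h := Real.sq_sqrt hh.le
  set r := √h with hrdef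
  set x := √(h + g)
  set y := √(h - g)
  have hx : x ^ 2 = h + g := Real.sq_sqrt (by linarith)
  have hy : y ^ 2 = h - g := Real.sq_sqrt (by linarith)
  have hx0 : 0 ≤ x := Real.sqrt_nonneg _
  have hy0 : 0 ≤ y := Real.sqrt_nonneg _
  set q := g ^ 2 / (4 * (h * r)) with hq
  have hqr : q * r * (4 * h) = g ^ 2 := by rw [hq]; field_simp
  -- `x * y = √(h² - g²)`, bounded by the first two terms of its expansion.
  have hxy : x * y ≤ h - g ^ 2 / (2 * h) := by
    have h1 : g ^ 2 / (2 * h) ≤ h := by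
      rw [div_le_iff₀ (by positivity)]; nlinarith
    refine abs_le_of_sq_le_sq' ?_ (by linarith) |>.2
    have h2 : g ^ 2 / (2 * h) * (2 * h) = g ^ 2 := by field_simp
    calc (x * y) ^ 2 = h ^ 2 - g ^ 2 := by rw [mul_pow, hx, hy]; ring
      _ ≤ (h - g ^ 2 / (2 * h)) ^ 2 := by
        nlinarith [sq_nonneg (g ^ 2 / (2 * h))]
  have hqr2 : q * r = g ^ 2 / (4 * h) := by rw [eq_div_iff (by positivity)]; exact hqr
  have hq1 : q ≤ 2 * r := by
    have h3 : q * r ≤ 2 * r * r := by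
      rw [hqr2, div_le_iff₀ (by positivity)]; nlinarith
    exact le_of_mul_le_mul_right h3 hr
  have h4 : x + y ≤ 2 * r - q := by
    refine abs_le_of_sq_le_sq' ?_ (by linarith) |>.2
    have h5 : g ^ 2 / (2 * h) = 2 * (q * r) := by rw [hqr2]; field_simp; norm_num
    rw [h5] at hxy
    nlinarith [sq_nonneg q]
  linarith

lemma sqrt_add_sqrt_le_two_mul {h g : ℝ} (hg : 0 ≤ g) (hgh : g ≤ h) :
    √(h + g) + √(h - g) ≤ 2 * √h := by
  rcases (hg.trans hgh).eq_or_lt with h0 | h0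
  · have : g = 0 := by linarith
    simp [this, ← h0]
  · have := sqrt_add_sqrt_le h0 hg hgh
    have : 0 ≤ g ^ 2 / (4 * (h * √h)) := by positivity
    linarith

end SqrtPotential

section EntropySelection

variable {A : Type} [Fintype A] {w : A → ℝ} (hw : IsWeight w) (val : A → ℝ)

/-- The average of the square roots of the row entropies. -/
def sqrtPotential (w val : A → ℝ) (n : ℕ) : ℝ :=
  (∑ i : Fin (2 ^ n), √(rowEntropy w val i)) / 2 ^ n

lemma sqrtPotential_nonneg (n : ℕ) : 0 ≤ sqrtPotential w val n :=
  div_nonneg (Finset.sum_nonneg fun _ _ => Real.sqrt_nonneg _) (by positivity)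

include hw in
lemma sqrtPotential_succ (n : ℕ) : sqrtPotential w val n - sqrtPotential w val (n + 1) =
    (∑ i : Fin (2 ^ n), (2 * √(rowEntropy w val i) -
      (√(plusEntropy w val i) + √(2 * rowEntropy w val i - plusEntropy w val i)))) /
      2 ^ (n + 1) := by
  unfold sqrtPotential
  rw [sum_halves]
  simp only [rowEntropy_inl, rowEntropy_inr hw]
  rw [Finset.sum_sub_distrib, Finset.sum_add_distrib, ← Finset.mul_sum, pow_succ]
  field_simp

include hw in
lemma sqrt_loss_nonneg {n : ℕ} (i : Fin (2 ^ n)) :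
    0 ≤ 2 * √(rowEntropy w val i) -
      (√(plusEntropy w val i) + √(2 * rowEntropy w val i - plusEntropy w val i)) := by
  have h1 := rowEntropy_le_plusEntropy hw val i
  have h2 := plusEntropy_le hw val i
  have h := sqrt_add_sqrt_le_two_mul (h := rowEntropy w val i)
    (g := plusEntropy w val i - rowEntropy w val i) (by linarith) (by linarith)
  rw [add_sub_cancel, show rowEntropy w val i - (plusEntropy w val i - rowEntropy w val i) =
    2 * rowEntropy w val i - plusEntropy w val i by ring] at h
  linarith

include hw in
lemma tendsto_sqrtPotential_sub :
    Tendsto (fun n => sqrtPotential w val n - sqrtPotential w val (n + 1)) atTop (𝓝 0) := by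
  have hanti : Antitone (sqrtPotential w val) := antitone_nat_of_succ_le fun n => by
    rw [← sub_nonneg, sqrtPotential_succ hw]
    exact div_nonneg (Finset.sum_nonneg fun i _ => sqrt_loss_nonneg hw val i) (by positivity)
  have hlim := tendsto_atTop_ciInf hanti
    ⟨0, by rintro _ ⟨n, rfl⟩; exact sqrtPotential_nonneg val n⟩
  have := hlim.sub (hlim.comp (tendsto_add_atTop_nat 1))
  rwa [sub_self] at this

include hw in
-- A row with entropy in `[a, b]` separates from its pair by at least `γ`, so it costs the potential
-- a fixed amount; all other rows cost at least nothing.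
lemma exists_card_middle_le {a b : ℝ} (ha : 0 < a) (hb : 0 < b) :
    ∃ κ : ℝ, 0 < κ ∧ ∀ n, κ * ((Finset.univ.filter fun i : Fin (2 ^ n) =>
      a ≤ rowEntropy w val i ∧ rowEntropy w val i ≤ b).card : ℝ) ≤
        2 ^ n * (sqrtPotential w val n - sqrtPotential w val (n + 1)) := by
  obtain ⟨γ, hγ, hgain⟩ := exists_conditional_entropy_gain ha hb
  refine ⟨γ ^ 2 / (4 * (b * √b)) / 2, by positivity, fun n => ?_⟩
  have hhalf : ∀ x : ℝ, 2 ^ n * (x / 2 ^ (n + 1)) = x / 2 := fun x => by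
    rw [pow_succ]; field_simp
  rw [sqrtPotential_succ hw, hhalf, div_mul_eq_mul_div]
  refine div_le_div_of_nonneg_right ?_ (by norm_num)
  rw [mul_comm, ← nsmul_eq_mul, ← Finset.sum_const, Finset.sum_filter]
  refine Finset.sum_le_sum fun i _ => ?_
  split_ifs with hi
  · have h1 : rowEntropy w val i + γ ≤ plusEntropy w val i :=
      hgain (isWeight_wordWeight hw) (fun c => rowOut val c i) (rowsOut val (pastRows i)) hi.1 hi.2
    have h2 := plusEntropy_le hw val i
    have h0 : 0 < rowEntropy w val i := ha.trans_le hi.1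
    have h := sqrt_add_sqrt_le h0
      (g := plusEntropy w val i - rowEntropy w val i) (by linarith) (by linarith)
    rw [add_sub_cancel, show rowEntropy w val i - (plusEntropy w val i - rowEntropy w val i) =
      2 * rowEntropy w val i - plusEntropy w val i by ring] at h
    have h3 : γ ^ 2 / (4 * (b * √b)) ≤ (plusEntropy w val i - rowEntropy w val i) ^ 2 /
        (4 * (rowEntropy w val i * √(rowEntropy w val i))) := by
      refine div_le_div₀ (sq_nonneg _) (pow_le_pow_left₀ hγ.le (by linarith) 2) (by positivity) ?_
      refine mul_le_mul_of_nonneg_left ?_ (by norm_num)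
      exact mul_le_mul hi.2 (Real.sqrt_le_sqrt hi.2) (Real.sqrt_nonneg _) hb.le
    linarith
  · exact sqrt_loss_nonneg hw val i

include hw in
/-- Asymptotically almost all rows have small conditional entropy. -/
theorem tendsto_card_rowEntropy {a : ℝ} (ha : 0 < a) :
    Tendsto (fun n : ℕ => ((Finset.univ.filter fun i : Fin (2 ^ n) =>
      a ≤ rowEntropy w val i).card : ℝ) / 2 ^ n) atTop (𝓝 0) := by
  set H := rowEntropy w val (0 : Fin (2 ^ 0)) with hH
  have hH0 : 0 ≤ H := rowEntropy_nonneg hw val _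
  rw [Metric.tendsto_atTop]
  intro δ hδ
  -- By Markov's inequality, rows above this `b` make up a fraction at most `H / b < δ / 2`. The `+
  -- 1` avoids `b = 0`.
  set b := 2 * (H + 1) / δ with hb
  have hb0 : 0 < b := by positivity
  obtain ⟨κ, hκ, hmid⟩ := exists_card_middle_le hw val ha hb0
  obtain ⟨N, hN⟩ := eventually_atTop.1 ((tendsto_sqrtPotential_sub hw val).eventually_lt_const
    (by positivity : (0 : ℝ) < κ * (δ / 2)))
  refine ⟨N, fun n hn => ?_⟩
  have h2 : (0 : ℝ) < 2 ^ n := by positivity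
  rw [Real.dist_eq, sub_zero, abs_of_nonneg (by positivity), div_lt_iff₀ h2]
  have h3 : ((Finset.univ.filter fun i : Fin (2 ^ n) => a ≤ rowEntropy w val i).card : ℝ) ≤
      ((Finset.univ.filter fun i : Fin (2 ^ n) =>
        a ≤ rowEntropy w val i ∧ rowEntropy w val i ≤ b).card : ℝ) +
      ((Finset.univ.filter fun i : Fin (2 ^ n) => b < rowEntropy w val i).card : ℝ) := by
    rw [← Nat.cast_add]
    refine Nat.cast_le.2 ((Finset.card_le_card ?_).trans (Finset.card_union_le _ _))
    intro i
    simp only [Finset.mem_filter, Finset.mem_univ, true_and, Finset.mem_union]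
    intro hi
    rcases le_or_gt (rowEntropy w val i) b with h | h
    exacts [Or.inl ⟨hi, h⟩, Or.inr h]
  have h4 : b * ((Finset.univ.filter fun i : Fin (2 ^ n) => b < rowEntropy w val i).card : ℝ) ≤
      2 ^ n * H := by
    rw [hH, ← sum_rowEntropy hw, mul_comm, ← nsmul_eq_mul, ← Finset.sum_const, Finset.sum_filter]
    refine Finset.sum_le_sum fun i _ => ?_
    split_ifs with hi
    exacts [hi.le, rowEntropy_nonneg hw val i]
  have h5 : ((Finset.univ.filter fun i : Fin (2 ^ n) => b < rowEntropy w val i).card : ℝ) ≤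
      δ / 2 * 2 ^ n := by
    refine le_of_mul_le_mul_left ?_ hb0
    refine h4.trans ?_
    have : b * (δ / 2 * 2 ^ n) = 2 ^ n * (H + 1) := by rw [hb]; field_simp
    rw [this]
    exact mul_le_mul_of_nonneg_left (by linarith) h2.le
  have h6 : ((Finset.univ.filter fun i : Fin (2 ^ n) =>
        a ≤ rowEntropy w val i ∧ rowEntropy w val i ≤ b).card : ℝ) < δ / 2 * 2 ^ n := by
    refine lt_of_mul_lt_mul_left ?_ hκ.le
    refine (hmid n).trans_lt ?_
    have := mul_lt_mul_of_pos_left (hN n hn) h2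
    linarith
  linarith

include hw in
-- Reveal the unselected rows in their natural order. What is known before row `i` contains its
-- whole past, so by submodularity revealing it costs at most `rowEntropy`. In the end all rows are
-- known, hence the block.
lemma finEntropy_sub_rowsOut_le {n : ℕ} (R : Finset (Fin (2 ^ n))) :
    finEntropy (fun c : Fin (2 ^ n) → A => wordWeight w c) (fun c j => val (c j)) -
      finEntropy (fun c : Fin (2 ^ n) → A => wordWeight w c) (rowsOut val R) ≤
        ∑ i ∈ Rᶜ, rowEntropy w val i := by
  classical
  have hww := isWeight_wordWeight (ι := Fin (2 ^ n)) hw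
  have hind : ∀ m, finEntropy (fun c : Fin (2 ^ n) → A => wordWeight w c)
      (rowsOut val (R ∪ Finset.univ.filter fun i => rowPos n i < m)) ≤
      finEntropy (fun c : Fin (2 ^ n) → A => wordWeight w c) (rowsOut val R) +
        ∑ i ∈ Rᶜ with rowPos n i < m, rowEntropy w val i := by
    intro m
    induction m with
    | zero => simp
    | succ m ih =>
      set S := R ∪ Finset.univ.filter fun i => rowPos n i < m with hS
      by_cases h : ∃ i, i ∉ R ∧ rowPos n i = m
      · obtain ⟨i, hiR, him⟩ := h
        have e1 : (Rᶜ.filter fun i => rowPos n i < m + 1) =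
            insert i (Rᶜ.filter fun i => rowPos n i < m) := by
          ext j
          simp only [Finset.mem_filter, Finset.mem_compl, Finset.mem_insert]
          constructor
          · rintro ⟨h1, h2⟩
            rcases Nat.lt_succ_iff_lt_or_eq.1 h2 with h | h
            exacts [Or.inr ⟨h1, h⟩, Or.inl (rowPos_injective n (h.trans him.symm))]
          · rintro (rfl | ⟨h1, h2⟩)
            exacts [⟨hiR, by omega⟩, ⟨h1, by omega⟩]
        have e2 : (R ∪ Finset.univ.filter fun i => rowPos n i < m + 1) = insert i S := by
          ext j
          simp only [hS, Finset.mem_union, Finset.mem_filter, Finset.mem_univ, true_and,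
            Finset.mem_insert]
          constructor
          · rintro (h | h)
            · exact Or.inr (Or.inl h)
            · rcases Nat.lt_succ_iff_lt_or_eq.1 h with h | h
              exacts [Or.inr (Or.inr h), Or.inl (rowPos_injective n (h.trans him.symm))]
          · rintro (rfl | h | h)
            exacts [Or.inr (by omega), Or.inl h, Or.inr (by omega)]
        have hpast : pastRows i ⊆ S := fun j hj => by
          rw [mem_pastRows, him] at hj
          exact Finset.mem_union_right _ (Finset.mem_filter.2 ⟨Finset.mem_univ _, hj⟩)
        have h := finEntropy_submodular hww (fun c => rowOut val c i) (rowsOut val S)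
          (rowsOut val (pastRows i))
        rw [finEntropy_congr (k := rowsOut val (insert i S)),
          finEntropy_congr (g := fun c => (rowsOut val S c, rowsOut val (pastRows i) c))
            (k := rowsOut val S)] at h
        · rw [e2, e1, Finset.sum_insert (by simp [him])]
          have : finEntropy (fun c : Fin (2 ^ n) → A => wordWeight w c)
              (fun c => (rowOut val c i, rowsOut val (pastRows i) c)) -
            finEntropy (fun c : Fin (2 ^ n) → A => wordWeight w c) (rowsOut val (pastRows i)) =
              rowEntropy w val i := rfl
          linarith
        · intro c c'
          simp only [Prod.mk.injEq, rowsOut_eq_iff]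
          exact ⟨fun h => h.1, fun h => ⟨h, fun j hj => h j (hpast hj)⟩⟩
        · intro c c'
          simp only [Prod.mk.injEq, rowsOut_eq_iff, Finset.forall_mem_insert]
          exact ⟨fun h => ⟨h.1, h.2.1⟩, fun h => ⟨h.1, h.2, fun j hj => h.2 j (hpast hj)⟩⟩
      · push Not at h
        have e1 : (Rᶜ.filter fun i => rowPos n i < m + 1) =
            Rᶜ.filter fun i => rowPos n i < m := by
          refine Finset.filter_congr fun j hj => ?_
          have := h j (Finset.mem_compl.1 hj)
          omega
        have e2 : (R ∪ Finset.univ.filter fun i => rowPos n i < m + 1) = S := by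
          ext j
          simp only [hS, Finset.mem_union, Finset.mem_filter, Finset.mem_univ, true_and]
          by_cases hj : j ∈ R
          · simp [hj]
          · have := h j hj
            simp only [hj, false_or]
            omega
        rw [e1, e2]
        exact ih
  have h := hind (2 ^ n)
  have e1 : (Rᶜ.filter fun i => rowPos n i < 2 ^ n) = Rᶜ :=
    Finset.filter_true_of_mem fun i _ => rowPos_lt i
  have e2 : (R ∪ Finset.univ.filter fun i => rowPos n i < 2 ^ n) = Finset.univ := by
    rw [Finset.filter_true_of_mem fun i _ => rowPos_lt i]
    exact Finset.union_eq_right.2 (Finset.subset_univ R)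
  rw [e1, e2, finEntropy_congr (k := fun c j => val (c j))] at h
  · linarith
  · intro c c'
    rw [rowsOut_eq_iff]
    constructor
    · intro h
      rw [← sub_eq_zero]
      refine hadamard_mulVec_injective fun i => ?_
      rw [Matrix.mulVec_sub, Pi.sub_apply, sub_eq_zero]
      exact h i (Finset.mem_univ i)
    · intro h i _
      simp only [rowOut]
      rw [h]

include hw in
/-- A vanishing fraction of the rows of a Hadamard matrix determines almost all of the entropy of
a block of independent variables with finitely many values. -/
theorem exists_rows_finEntropy {ε : ℝ} (hε : 0 < ε) :
    ∃ R : ∀ n, Finset (Fin (2 ^ n)),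
      Tendsto (fun n => ((R n).card : ℝ) / 2 ^ n) atTop (𝓝 0) ∧
      ∀ n, finEntropy (fun c : Fin (2 ^ n) → A => wordWeight w c) (fun c j => val (c j)) -
        finEntropy (fun c : Fin (2 ^ n) → A => wordWeight w c) (rowsOut val (R n)) ≤ ε * 2 ^ n := by
  refine ⟨fun n => Finset.univ.filter fun i => ε ≤ rowEntropy w val i,
    tendsto_card_rowEntropy hw val hε, fun n => ?_⟩
  refine (finEntropy_sub_rowsOut_le hw val _).trans ?_
  have h1 : ∀ i ∈ (Finset.univ.filter fun i : Fin (2 ^ n) => ε ≤ rowEntropy w val i)ᶜ,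
      rowEntropy w val i ≤ ε := fun i hi => by
    simp only [Finset.mem_compl, Finset.mem_filter, Finset.mem_univ, true_and, not_le] at hi
    exact hi.le
  refine (Finset.sum_le_sum h1).trans ?_
  rw [Finset.sum_const, nsmul_eq_mul, mul_comm]
  refine mul_le_mul_of_nonneg_left ?_ hε.le
  have := Finset.card_le_univ (Finset.univ.filter fun i : Fin (2 ^ n) => ε ≤ rowEntropy w val i)ᶜ
  rw [Fintype.card_fin] at this
  exact_mod_cast this

end EntropySelection

end RenyiCompression

/-! ### From finite alphabets to discrete variables of finite entropy -/

namespace RenyiCompression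

section FiniteBridge

variable {Ω : Type*} [MeasurableSpace Ω] {P : Measure Ω} [IsProbabilityMeasure P]

/-- The conditional entropy of a variable with finitely many values given a function of it. -/
lemma condEntropy_comp_le_finEntropy {κ β : Type*} [Fintype κ] [MeasurableSpace κ]
    [MeasurableSingletonClass κ] [Nonempty κ] [MeasurableSpace β] [MeasurableSingletonClass β]
    {C : Ω → κ} (hC : Measurable C) {p : κ → ℝ} (hp : ∀ c, P.map C {c} = ENNReal.ofReal (p c))
    (hpw : IsWeight p) (φ : κ → β) :
    condEntropy P C (fun ω => φ (C ω)) ≤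
      ENNReal.ofReal ((finEntropy p id - finEntropy p φ) / Real.log 2) := by
  classical
  have hφ : Measurable φ := measurable_of_countable φ
  set r : κ → ℝ := fun c => p c / massAt p φ (φ c) with hr
  have hr0 : ∀ c, 0 ≤ r c := fun c => div_nonneg (hpw.nonneg _) (massAt_nonneg hpw _ _)
  refine (condEntropy_le_lintegral hC (hφ.comp hC)
    (fun x => if x.1 = φ x.2 then ENNReal.ofReal (r x.2) else 0) ?_ fun w => ?_).trans ?_
  · refine measurable_from_prod_countable_left fun c => ?_
    have : Measurable fun w => if w = φ c then ENNReal.ofReal (r c) else 0 :=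
      Measurable.ite (measurableSet_singleton _) measurable_const measurable_const
    exact this
  · rw [tsum_fintype]
    have h1 : ∀ c, (if w = φ c then ENNReal.ofReal (r c) else 0) =
        ENNReal.ofReal (if φ c = w then p c * (massAt p φ (φ c))⁻¹ else 0) := fun c => by
      by_cases h : φ c = w
      · rw [if_pos h.symm, if_pos h]
        exact congrArg ENNReal.ofReal (div_eq_mul_inv _ _)
      · rw [if_neg (Ne.symm h), if_neg h, ENNReal.ofReal_zero]
    simp only [h1]
    rw [← ENNReal.ofReal_sum_of_nonneg, sum_mul_comp φ w fun x => (massAt p φ x)⁻¹]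
    · exact ENNReal.ofReal_le_one.2 mul_inv_le_one
    · intro c _
      split_ifs
      exacts [mul_nonneg (hpw.nonneg _) (inv_nonneg.2 (massAt_nonneg hpw _ _)), le_rfl]
  · simp only [Function.comp, if_true]
    rw [← lintegral_map (f := fun c => infoContent (ENNReal.ofReal (r c)))
      (measurable_of_countable _) hC, lintegral_fintype]
    have hmass : ∀ c, massAt p id c = p c := fun c => by simp [massAt]
    have h2 : (finEntropy p id - finEntropy p φ) / Real.log 2 =
        ∑ c, p c * (-Real.log (r c) / Real.log 2) := by
      unfold finEntropy
      rw [← Finset.sum_sub_distrib, Finset.sum_div]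
      refine Finset.sum_congr rfl fun c _ => ?_
      rcases (hpw.nonneg c).eq_or_lt with h0 | h0
      · simp [← h0]
      · rw [hr, Real.log_div h0.ne' (massAt_pos hpw φ h0).ne', id, hmass]
        ring
    have hrle : ∀ c, r c ≤ 1 := fun c => div_le_one_of_le₀ (le_massAt hpw φ c)
      (massAt_nonneg hpw _ _)
    have h3 : ∀ c, 0 ≤ -Real.log (r c) / Real.log 2 := fun c =>
      div_nonneg (neg_nonneg.2 (Real.log_nonpos (hr0 c) (hrle c))) log_two_pos.le
    rw [h2, ENNReal.ofReal_sum_of_nonneg fun c _ => mul_nonneg (hpw.nonneg c) (h3 c)]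
    refine Finset.sum_le_sum fun c _ => ?_
    rw [hp, mul_comm]
    rcases (hpw.nonneg c).eq_or_lt with h0 | h0
    · simp [← h0]
    have hrpos : 0 < r c := div_pos h0 (massAt_pos hpw φ h0)
    rw [ENNReal.ofReal_mul h0.le, infoContent, if_neg (by simpa using hrpos),
      ENNReal.toReal_ofReal (hr0 c)]

end FiniteBridge

section Truncation

/-- The letter `k` if it is at least `M`. -/
def tailCode (M k : ℕ) : ℕ := if k < M then 0 else k + 1

lemma tendsto_entTerm_one {u : ℕ → ℝ≥0∞} (hu : Tendsto u atTop (𝓝 1)) :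
    Tendsto (fun n => entTerm (u n)) atTop (𝓝 0) := by
  have h1 := (ENNReal.tendsto_toReal ENNReal.one_ne_top).comp hu
  have h2 := ((Real.continuous_negMulLog.tendsto _).comp h1).div_const (Real.log 2)
  have h3 := (ENNReal.continuous_ofReal.tendsto _).comp h2
  simpa [Function.comp_def, entTerm] using h3

/-- The merged letter has mass tending to `1`, so its term vanishes; the other terms are the tail of
a convergent series. -/
lemma tendsto_atomEntropy_map_tailCode {μ : Measure ℕ} [IsProbabilityMeasure μ]
    (h : atomEntropy μ ≠ ∞) :
    Tendsto (fun M => atomEntropy (μ.map (tailCode M))) atTop (𝓝 0) := by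
  have hm : ∀ M, Measurable (tailCode M) := fun M => measurable_of_countable _
  have hformula : ∀ M, atomEntropy (μ.map (tailCode M)) = entTerm (μ (Set.Iio M)) +
      ∑' k : {k // k ∉ Finset.range M}, entTerm (μ {(k : ℕ)}) := fun M => by
    rw [atomEntropy_eq, tsum_eq_zero_add' ENNReal.summable]
    congr 1
    · rw [Measure.map_apply (hm M) (measurableSet_singleton _)]
      congr 2
      ext k
      simp only [Set.mem_preimage, tailCode, Set.mem_singleton_iff, Set.mem_Iio]
      split_ifs with hk <;> simp [hk]
    · have : ∑' k : {k // k ∉ Finset.range M}, entTerm (μ {(k : ℕ)}) =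
          ∑' k, Set.indicator {k | k ∉ Finset.range M} (fun k => entTerm (μ {k})) k :=
        tsum_subtype {k | k ∉ Finset.range M} fun k => entTerm (μ {k})
      rw [this]
      refine tsum_congr fun k => ?_
      rw [Measure.map_apply (hm M) (measurableSet_singleton _)]
      by_cases hk : k < M
      · have : tailCode M ⁻¹' {k + 1} = ∅ := by
          ext j
          change tailCode M j = k + 1 ↔ False
          by_cases hj : j < M
          · simp [tailCode, hj]
          · simp [tailCode, hj]; omega
        rw [this, measure_empty, entTerm_zero, Set.indicator_of_notMem (by simp [hk])]
      · have : tailCode M ⁻¹' {k + 1} = {k} := by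
          ext j
          change tailCode M j = k + 1 ↔ j = k
          by_cases hj : j < M
          · simp [tailCode, hj]; omega
          · simp [tailCode, hj]
        rw [this, Set.indicator_of_mem (by simpa using hk)]
  simp only [hformula]
  rw [← add_zero (0 : ℝ≥0∞)]
  refine Tendsto.add (tendsto_entTerm_one ?_) ?_
  · have h1 := tendsto_measure_iUnion_atTop (μ := μ) (s := fun M : ℕ => Set.Iio M)
      fun a b hab => Set.Iio_subset_Iio hab
    have h2 : ⋃ M : ℕ, Set.Iio M = Set.univ := Set.eq_univ_of_forall fun k =>
      Set.mem_iUnion.2 ⟨k + 1, Nat.lt_succ_self k⟩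
    rwa [h2, measure_univ] at h1
  · exact (ENNReal.tendsto_tsum_compl_atTop_zero (f := fun k => entTerm (μ {k})) h).comp
      tendsto_finset_range

end Truncation

section MaskedRows

/-- The Hadamard coefficients of `x` with index in `R`, the other coordinates being `0`. -/
def maskedRows {n : ℕ} (R : Finset (Fin (2 ^ n))) (x : Fin (2 ^ n) → ℝ) : Fin (2 ^ n) → ℝ :=
  fun i => if i ∈ R then (hadamard n).mulVec x i else 0

lemma maskedRows_sub {n : ℕ} (R : Finset (Fin (2 ^ n))) (x y : Fin (2 ^ n) → ℝ) :
    maskedRows R (x - y) = maskedRows R x - maskedRows R y := by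
  funext i
  by_cases h : i ∈ R <;> simp [maskedRows, h, Matrix.mulVec_sub]

lemma measurable_maskedRows {n : ℕ} (R : Finset (Fin (2 ^ n))) : Measurable (maskedRows R) := by
  refine measurable_pi_lambda _ fun i => ?_
  by_cases h : i ∈ R
  · simp only [maskedRows, h, if_true, Matrix.mulVec, dotProduct]
    exact Finset.measurable_sum _ fun j _ => (measurable_pi_apply j).const_mul _
  · simp only [maskedRows, h, if_false]
    exact measurable_const

end MaskedRows

section DiscreteBlock

variable {Ω : Type*} [MeasurableSpace Ω] {P : Measure Ω} [IsProbabilityMeasure P]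

lemma entropy_tailCode_block {K : ℕ → Ω → ℕ} (hK : ∀ i, Measurable (K i)) (hind : iIndepFun K P)
    (hid : ∀ i, IdentDistrib (K i) (K 0) P P) (M N : ℕ) :
    entropy P (fun ω (i : Fin N) => tailCode M (K i ω)) =
      N * atomEntropy ((P.map (K 0)).map (tailCode M)) := by
  have hm : Measurable (tailCode M) := measurable_of_countable _
  rw [entropy_pi_of_iIndepFun]
  · have : ∀ i : Fin N, entropy P (fun ω => tailCode M (K i ω)) =
        atomEntropy ((P.map (K 0)).map (tailCode M)) := fun i => by
      rw [entropy, ← (hid i).map_eq, Measure.map_map hm (hK _)]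
      rfl
    simp [this]
  · exact measurable_pi_lambda _ fun i => hm.comp (hK i)
  · exact (hind.precomp Fin.val_injective).comp (fun _ => tailCode M) fun _ => hm

lemma map_block_singleton {κ : Type} [Fintype κ] [MeasurableSpace κ] [MeasurableSingletonClass κ]
    {C : ℕ → Ω → κ} (hC : ∀ i, Measurable (C i)) (hind : iIndepFun C P)
    (hid : ∀ i, IdentDistrib (C i) (C 0) P P) {N : ℕ} (c : Fin N → κ) :
    P.map (fun ω (i : Fin N) => C i ω) {c} =
      ENNReal.ofReal (wordWeight (fun a => (P.map (C 0)).real {a}) c) := by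
  have h := (iIndepFun_iff_map_fun_eq_pi_map fun i : Fin N => (hC i).aemeasurable).1
    (hind.precomp Fin.val_injective)
  have hpr : ∀ i : Fin N, IsProbabilityMeasure (P.map (C i)) := fun i =>
    Measure.isProbabilityMeasure_map (hC i).aemeasurable
  have hpr0 := Measure.isProbabilityMeasure_map (μ := P) (hC 0).aemeasurable
  change P.map (fun ω (i : Fin N) => C i ω) {c} = _
  rw [show P.map (fun ω (i : Fin N) => C i ω) = Measure.pi fun i : Fin N => P.map (C i) from h,
    Measure.pi_singleton, wordWeight, ENNReal.ofReal_prod_of_nonneg fun _ _ => measureReal_nonneg]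
  refine Finset.prod_congr rfl fun i _ => ?_
  rw [(hid i).map_eq, ofReal_measureReal]

/-- The value of a letter encoded by `tailCode`. -/
def tailVal (dec : ℕ → ℝ) (e : ℕ) : ℝ := if e = 0 then 0 else dec (e - 1)

/-- An additive splitting into a finite-valued part and a tail is needed, because the measurements
are linear: the contribution of the tail can be subtracted. -/
lemma exists_truncation (dec : ℕ → ℝ) (M : ℕ) :
    ∃ (F : Finset ℝ) (t : ℕ → F), ∀ k, dec k = (t k : ℝ) + tailVal dec (tailCode M k) := by
  classical
  refine ⟨insert 0 ((Finset.range M).image dec), fun k => if h : k < M then ⟨dec k,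
    Finset.mem_insert_of_mem (Finset.mem_image_of_mem _ (Finset.mem_range.2 h))⟩ else
      ⟨0, Finset.mem_insert_self _ _⟩, fun k => ?_⟩
  by_cases h : k < M <;> simp [tailVal, tailCode, h]

/-- Pay for the tail `E` in full. Once it is known, subtracting its measurement from that of `V`
leaves the measurement of the finite-valued part. -/
lemma condEntropy_floorVec_le_of_split {κ : Type} [Fintype κ] [MeasurableSpace κ]
    [MeasurableSingletonClass κ] [Nonempty κ] (val : κ → ℝ) (dE : ℕ → ℝ) {n : ℕ}
    (R : Finset (Fin (2 ^ n))) (q : ℕ) {C : Ω → Fin (2 ^ n) → κ} (hC : Measurable C)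
    {E : Ω → Fin (2 ^ n) → ℕ} (hE : Measurable E) {V : Ω → Fin (2 ^ n) → ℝ} (hVm : Measurable V)
    (hV : ∀ ω, V ω = (fun i => val (C ω i)) + fun i => dE (E ω i)) :
    condEntropy P (fun ω => floorVec q (V ω)) (fun ω => maskedRows R (V ω)) ≤
      entropy P E + condEntropy P C (fun ω => rowsOut val R (C ω)) := by
  have hW : Measurable fun ω => maskedRows R (V ω) := (measurable_maskedRows R).comp hVm
  obtain ⟨g, hg⟩ : ∃ g : (Fin (2 ^ n) → ℕ) × (Fin (2 ^ n) → κ) → Fin (2 ^ n) → ℤ,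
      ∀ x, g x = floorVec q ((fun i => val (x.2 i)) + fun i => dE (x.1 i)) := ⟨_, fun _ => rfl⟩
  have h1 : (fun ω => floorVec q (V ω)) = fun ω => g (E ω, C ω) := by
    funext ω
    rw [hV, hg]
  rw [h1]
  refine (condEntropy_comp_le (hE.prodMk hC) hW g).trans ?_
  rw [condEntropy_prodMk hE hC hW]
  refine add_le_add (condEntropy_le_entropy hE hW) ?_
  have hφ : Measurable fun x : (Fin (2 ^ n) → ℝ) × (Fin (2 ^ n) → ℕ) =>
      x.1 - maskedRows R (fun i => dE (x.2 i)) :=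
    measurable_fst.sub ((measurable_of_countable fun e : Fin (2 ^ n) → ℕ =>
      maskedRows R fun i => dE (e i)).comp measurable_snd)
  refine (condEntropy_le_comp hC (hW.prodMk hE) hφ).trans (le_of_eq ?_)
  congr 1
  funext ω
  simp only
  rw [← maskedRows_sub, hV, add_sub_cancel_right]
  rfl

/-- The case of a variable encoded by natural numbers. -/
lemma exists_rows_encoded {K : ℕ → Ω → ℕ} (hK : ∀ i, Measurable (K i)) (hind : iIndepFun K P)
    (hid : ∀ i, IdentDistrib (K i) (K 0) P P) (dec : ℕ → ℝ) (hent : entropy P (K 0) ≠ ∞)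
    {ε : ℝ} (hε : 0 < ε) :
    ∃ R : ∀ n, Finset (Fin (2 ^ n)),
      Tendsto (fun n => ((R n).card : ℝ) / 2 ^ n) atTop (𝓝 0) ∧
      ∀ n q, condEntropy P (fun ω => floorVec q (fun i : Fin (2 ^ n) => dec (K i ω)))
        (fun ω => maskedRows (R n) (fun i : Fin (2 ^ n) => dec (K i ω))) ≤
          ENNReal.ofReal (ε * 2 ^ n) := by
  have hdecm : Measurable dec := measurable_of_countable _
  have hμ : IsProbabilityMeasure (P.map (K 0)) :=
    Measure.isProbabilityMeasure_map (hK 0).aemeasurable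
  -- The tail may use `ε/2` bits per letter; the other half is left to the finite alphabet.
  obtain ⟨M, hM⟩ := ((tendsto_atomEntropy_map_tailCode (μ := P.map (K 0)) hent).eventually_lt_const
    (ENNReal.ofReal_pos.2 (half_pos hε))).exists
  obtain ⟨F, t, ht⟩ := exists_truncation dec M
  have : Nonempty F := ⟨t 0⟩
  have htm : Measurable t := measurable_of_countable _
  have hC : ∀ i, Measurable fun ω => t (K i ω) := fun i => htm.comp (hK i)
  have hCind : iIndepFun (fun i ω => t (K i ω)) P := hind.comp (fun _ => t) fun _ => htm
  have hCid : ∀ i, IdentDistrib (fun ω => t (K i ω)) (fun ω => t (K 0 ω)) P P :=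
    fun i => (hid i).comp htm
  have hν : IsProbabilityMeasure (P.map fun ω => t (K 0 ω)) :=
    Measure.isProbabilityMeasure_map (hC 0).aemeasurable
  have hww : IsWeight fun a : F => (P.map fun ω => t (K 0 ω)).real {a} :=
    ⟨fun _ => measureReal_nonneg, by rw [sum_measureReal_singleton]; simp⟩
  -- The factor `log 2` converts bits into the nats of `finEntropy`.
  obtain ⟨R, hR, hRent⟩ := exists_rows_finEntropy hww (fun a : F => (a : ℝ))
    (mul_pos (half_pos hε) log_two_pos)
  refine ⟨R, hR, fun n q => ?_⟩
  have hCv : Measurable fun ω (i : Fin (2 ^ n)) => t (K i ω) :=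
    measurable_pi_lambda _ fun i => hC i
  have hEv : Measurable fun ω (i : Fin (2 ^ n)) => tailCode M (K i ω) :=
    measurable_pi_lambda _ fun i => (measurable_of_countable (tailCode M)).comp (hK i)
  have hVv : Measurable fun ω (i : Fin (2 ^ n)) => dec (K i ω) :=
    measurable_pi_lambda _ fun i => hdecm.comp (hK i)
  refine (condEntropy_floorVec_le_of_split (fun a : F => (a : ℝ)) (tailVal dec) (R n) q hCv hEv hVv
    fun ω => funext fun i => ht (K i ω)).trans ?_
  have h1 : entropy P (fun ω (i : Fin (2 ^ n)) => tailCode M (K i ω)) ≤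
      ENNReal.ofReal (ε / 2 * 2 ^ n) := by
    rw [entropy_tailCode_block hK hind hid, mul_comm, ENNReal.ofReal_mul (half_pos hε).le]
    refine mul_le_mul' hM.le (le_of_eq ?_)
    rw [ENNReal.ofReal_pow (by norm_num)]
    simp
  have h2 := condEntropy_comp_le_finEntropy (P := P) (κ := Fin (2 ^ n) → F) hCv
    (fun c => map_block_singleton hC hCind hCid c) (isWeight_wordWeight hww)
    (rowsOut (fun a : F => (a : ℝ)) (R n))
  have h3 : (finEntropy (fun c : Fin (2 ^ n) → F =>
      wordWeight (fun a : F => (P.map fun ω => t (K 0 ω)).real {a}) c) id -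
      finEntropy (fun c : Fin (2 ^ n) → F =>
        wordWeight (fun a : F => (P.map fun ω => t (K 0 ω)).real {a}) c)
        (rowsOut (fun a : F => (a : ℝ)) (R n))) / Real.log 2 ≤ ε / 2 * 2 ^ n := by
    rw [div_le_iff₀ log_two_pos, finEntropy_congr (g := id)
      (k := fun (c : Fin (2 ^ n) → F) j => (c j : ℝ))]
    · linarith [hRent n]
    · intro c c'
      simp only [id, funext_iff, Subtype.ext_iff]
  refine (add_le_add h1 (h2.trans (ENNReal.ofReal_le_ofReal h3))).trans (le_of_eq ?_)
  rw [← ENNReal.ofReal_add (by positivity) (by positivity)]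
  congr 1
  ring

/-- Asymptotically a vanishing fraction of the rows of a Hadamard matrix determines almost all of
the entropy of a block of independent discrete variables of finite entropy. -/
theorem exists_rows_discrete {X : ℕ → Ω → ℝ} (hX : ∀ i, Measurable (X i)) (hind : iIndepFun X P)
    (hid : ∀ i, IdentDistrib (X i) (X 0) P P) {enc : ℝ → ℕ} (henc : Measurable enc) {dec : ℕ → ℝ}
    (hdec : ∀ᵐ ω ∂P, dec (enc (X 0 ω)) = X 0 ω) (hent : entropy P (fun ω => enc (X 0 ω)) ≠ ∞)
    {ε : ℝ} (hε : 0 < ε) :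
    ∃ R : ∀ n, Finset (Fin (2 ^ n)),
      Tendsto (fun n => ((R n).card : ℝ) / 2 ^ n) atTop (𝓝 0) ∧
      ∀ n q, condEntropy P (fun ω => floorVec q (block X (2 ^ n) ω))
        (fun ω => maskedRows (R n) (block X (2 ^ n) ω)) ≤ ENNReal.ofReal (ε * 2 ^ n) := by
  have hdecm : Measurable dec := measurable_of_countable _
  have hdec' : ∀ i, ∀ᵐ ω ∂P, dec (enc (X i ω)) = X i ω := fun i =>
    (hid i).symm.ae_snd (p := fun x => dec (enc x) = x)
      (measurableSet_eq_fun (hdecm.comp henc) measurable_id) hdec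
  obtain ⟨R, hR, hRent⟩ := exists_rows_encoded (K := fun i ω => enc (X i ω))
    (fun i => henc.comp (hX i)) (hind.comp (fun _ => enc) fun _ => henc)
    (fun i => (hid i).comp henc) dec hent hε
  refine ⟨R, hR, fun n q => le_trans (le_of_eq ?_) (hRent n q)⟩
  have hBm : Measurable (block X (2 ^ n)) := measurable_pi_lambda _ fun i => hX i
  have hXvm : Measurable fun ω (i : Fin (2 ^ n)) => dec (enc (X i ω)) :=
    measurable_pi_lambda _ fun i => hdecm.comp (henc.comp (hX i))
  have hVm := measurable_floorVec (ι := Fin (2 ^ n)) q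
  refine condEntropy_congr_law (hVm.comp hBm).aemeasurable (hVm.comp hXvm).aemeasurable
    (Measure.map_congr ?_)
  filter_upwards [ae_all_iff.2 fun i : Fin (2 ^ n) => hdec' i] with ω hω
  have : block X (2 ^ n) ω = fun i : Fin (2 ^ n) => dec (enc (X i ω)) :=
    funext fun i => (hω i).symm
  rw [this]

end DiscreteBlock

end RenyiCompression

/-! ### The block source as a linear image of independent variables -/

namespace RenyiCompression

section LinearModel

variable {k N : ℕ}

lemma mem_residual {κ ι E : Type*} [DecidableEq κ] [AddCommGroup E] [Module ℝ E]
    {B : (κ → ℝ) →ₗ[ℝ] (ι → ℝ)} {F : (κ → ℝ) →ₗ[ℝ] E} {C : Finset κ} {u : ι → ℝ} :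
    u ∈ residual B F C ↔ ∃ z : κ → ℝ, (∀ j ∉ C, z j = 0) ∧ F z = 0 ∧ B z = u := by
  constructor
  · rintro ⟨x, hx, rfl⟩
    exact ⟨extendZero C x, fun j hj => dif_neg hj, hx, rfl⟩
  · rintro ⟨z, hz, hF, rfl⟩
    have h : extendZero C (fun j => z j) = z := by
      funext j
      by_cases hj : j ∈ C
      · exact dif_pos hj
      · exact (dif_neg hj).trans (hz j hj).symm
    refine ⟨fun j => z j, ?_, ?_⟩
    · rw [SetLike.mem_coe, LinearMap.mem_ker, LinearMap.comp_apply, h, hF]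
    · rw [LinearMap.comp_apply, h]

/-- The map `z ↦ A z` applied to each of `N` blocks. -/
def blockMap (A : Matrix (Fin 2) (Fin k) ℝ) (N : ℕ) :
    (Fin N × Fin k → ℝ) →ₗ[ℝ] (Fin N × Fin 2 → ℝ) where
  toFun z p := A.mulVec (fun j => z (p.1, j)) p.2
  map_add' x y := by
    funext p
    have : (fun j => (x + y) (p.1, j)) = (fun j => x (p.1, j)) + fun j => y (p.1, j) := rfl
    rw [this, Matrix.mulVec_add]
    rfl
  map_smul' a x := by
    funext p
    have : (fun j => (a • x) (p.1, j)) = a • fun j => x (p.1, j) := rfl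
    rw [this, Matrix.mulVec_smul]
    rfl

lemma maskedRows_add {n : ℕ} (R : Finset (Fin (2 ^ n))) (x y : Fin (2 ^ n) → ℝ) :
    maskedRows R (x + y) = maskedRows R x + maskedRows R y := by
  funext i
  by_cases h : i ∈ R <;> simp [maskedRows, h, Matrix.mulVec_add]

lemma maskedRows_smul {n : ℕ} (R : Finset (Fin (2 ^ n))) (a : ℝ) (x : Fin (2 ^ n) → ℝ) :
    maskedRows R (a • x) = a • maskedRows R x := by
  funext i
  by_cases h : i ∈ R <;> simp [maskedRows, h, Matrix.mulVec_smul]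

/-- The distributed measurement of a block of pairs with the rows `R 0` and `R 1`. -/
def measureMap {n : ℕ} (R : Fin 2 → Finset (Fin (2 ^ n))) :
    (Fin (2 ^ n) × Fin 2 → ℝ) →ₗ[ℝ] (Fin (2 ^ n) → ℝ) × (Fin (2 ^ n) → ℝ) where
  toFun u := (maskedRows (R 0) fun j => u (j, 0), maskedRows (R 1) fun j => u (j, 1))
  map_add' _ _ := Prod.ext (maskedRows_add _ _ _) (maskedRows_add _ _ _)
  map_smul' _ _ := Prod.ext (maskedRows_smul _ _ _) (maskedRows_smul _ _ _)

lemma maskedRows_eq_zero_iff {n : ℕ} {R : Finset (Fin (2 ^ n))} {x : Fin (2 ^ n) → ℝ} :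
    maskedRows R x = 0 ↔ ∀ i ∈ R, (hadamard n).mulVec x i = 0 := by
  constructor
  · intro h i hi
    have := congrFun h i
    simpa [maskedRows, hi] using this
  · intro h
    funext i
    by_cases hi : i ∈ R
    · simp [maskedRows, hi, h i hi]
    · simp [maskedRows, hi]

/-- The vectors `A z` with `z` supported in `C`. -/
def letterSpace (A : Matrix (Fin 2) (Fin k) ℝ) (C : Finset (Fin k)) : Submodule ℝ (Fin 2 → ℝ) :=
  residual A.mulVecLin (0 : (Fin k → ℝ) →ₗ[ℝ] ℝ) C

lemma mem_letterSpace {A : Matrix (Fin 2) (Fin k) ℝ} {C : Finset (Fin k)} {u : Fin 2 → ℝ} :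
    u ∈ letterSpace A C ↔ ∃ z : Fin k → ℝ, (∀ j ∉ C, z j = 0) ∧ A.mulVec z = u := by
  simp [letterSpace, mem_residual]

/-- The set of the coordinates of a letter in a block that lie in a given set of coordinates of the
block. -/
def slice (C : Finset (Fin N × Fin k)) (i : Fin N) : Finset (Fin k) :=
  Finset.univ.filter fun j => (i, j) ∈ C

/-- Currying identifies the two spaces. This is the bridge from information dimension to the rank
problem, with the free coordinates of each position as its letter. -/
lemma finrank_residual_block (A : Matrix (Fin 2) (Fin k) ℝ) {n : ℕ}
    (R : Fin 2 → Finset (Fin (2 ^ n))) (C : Finset (Fin (2 ^ n) × Fin k)) :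
    Module.finrank ℝ (residual (blockMap A (2 ^ n)) ((measureMap R).comp (blockMap A (2 ^ n))) C) =
      Module.finrank ℝ (unresolved (letterSpace A) R (slice C)) := by
  have h : (residual (blockMap A (2 ^ n)) ((measureMap R).comp (blockMap A (2 ^ n))) C).map
      (LinearEquiv.curry ℝ ℝ (Fin (2 ^ n)) (Fin 2) : (Fin (2 ^ n) × Fin 2 → ℝ) →ₗ[ℝ] _) =
      unresolved (letterSpace A) R (slice C) := by
    ext v
    rw [Submodule.mem_map, mem_unresolved]
    simp only [mem_letterSpace]
    have hker : ∀ u : Fin (2 ^ n) × Fin 2 → ℝ, measureMap R u = 0 ↔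
        ∀ t, ∀ i ∈ R t, rowVal (fun j t => u (j, t)) t i = 0 := fun u => by
      rw [Fin.forall_fin_two]
      change (maskedRows (R 0) _, maskedRows (R 1) _) = 0 ↔ _
      rw [Prod.mk_eq_zero, maskedRows_eq_zero_iff, maskedRows_eq_zero_iff]
      rfl
    constructor
    · rintro ⟨u, hu, rfl⟩
      obtain ⟨z, hz, hF, rfl⟩ := mem_residual.1 hu
      refine ⟨fun j => ⟨fun l => z (j, l), fun l hl => hz _ ?_, rfl⟩, (hker _).1 hF⟩
      simpa [slice] using hl
    · rintro ⟨h1, h2⟩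
      choose z hz hzv using h1
      have hB : blockMap A (2 ^ n) (fun p => z p.1 p.2) = fun p => v p.1 p.2 :=
        funext fun p => congrFun (hzv p.1) p.2
      refine ⟨fun p => v p.1 p.2, mem_residual.2 ⟨fun p => z p.1 p.2, fun p hp => hz _ _ ?_,
        ?_, hB⟩, rfl⟩
      · simpa [slice] using hp
      · rw [LinearMap.comp_apply, hB, hker]
        exact h2
  rw [← h]
  exact (LinearEquiv.finrank_map_eq _ _).symm

end LinearModel

section LabelledModel

variable {k : ℕ}

/-- Nonsingular laws with encodings of their atoms. -/
structure IsEncodedModel (ν : Fin k → Measure ℝ) (S : Fin k → Set ℝ) (enc : Fin k → ℝ → ℕ)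
    (dec : Fin k → ℕ → ℝ) : Prop where
  nonsingular : ∀ j, IsNonsingularLaw (ν j)
  ac : ∀ j, (ν j).restrict (S j)ᶜ ≪ volume
  measurable_enc : ∀ j, Measurable (enc j)
  enc_eq_zero : ∀ j x, enc j x = 0 ↔ x ∉ S j
  dec_enc : ∀ j, ∀ x ∈ S j, dec j (enc j x) = x

lemma exists_encodedModel {ν : Fin k → Measure ℝ} (hν : ∀ j, IsNonsingularLaw (ν j)) :
    ∃ S enc dec, IsEncodedModel ν S enc dec := by
  choose S hS hac using fun j => (hν j).nonsingular
  choose enc dec hm h0 hdec using fun j => exists_encoding (hS j)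
  exact ⟨S, enc, dec, hν, hac, hm, h0, hdec⟩

variable {ν : Fin k → Measure ℝ} {S : Fin k → Set ℝ} {enc : Fin k → ℝ → ℕ}
  {dec : Fin k → ℕ → ℝ} (hM : IsEncodedModel ν S enc dec)

include hM in
lemma IsEncodedModel.isProbabilityMeasure (j : Fin k) : IsProbabilityMeasure (ν j) :=
  (hM.nonsingular j).prob

include hM in
lemma IsEncodedModel.isMixedVector :
    IsMixedVector (Measure.pi ν) (fun z => z) (fun z j => enc j (z j)) dec :=
  isMixedVector_pi hM.nonsingular hM.ac hM.measurable_enc hM.enc_eq_zero hM.dec_enc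

include hM in
lemma IsEncodedModel.isMixedVector_block (N : ℕ) :
    IsMixedVector (Measure.pi fun p : Fin N × Fin k => ν p.2) (fun z => z)
      (fun z p => enc p.2 (z p)) (fun p => dec p.2) :=
  isMixedVector_pi (fun p : Fin N × Fin k => hM.nonsingular p.2) (fun p => hM.ac p.2)
    (fun p => hM.measurable_enc p.2) (fun p => hM.enc_eq_zero p.2) (fun p => hM.dec_enc p.2)

/-- The coordinates of `z` that are not atoms. -/
def letterOf (enc : Fin k → ℝ → ℕ) (z : Fin k → ℝ) : Finset (Fin k) :=
  zeroSet fun j => enc j (z j)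

include hM in
lemma IsEncodedModel.measurableSet_letterOf (C : Finset (Fin k)) :
    MeasurableSet {z | letterOf enc z = C} := by
  have hD : Measurable fun (z : Fin k → ℝ) j => enc j (z j) :=
    measurable_pi_lambda _ fun j => (hM.measurable_enc j).comp (measurable_pi_apply j)
  exact hD (Set.to_countable {d : Fin k → ℕ | zeroSet d = C}).measurableSet

/-- The probability of a letter. -/
def letterWeight (ν : Fin k → Measure ℝ) (enc : Fin k → ℝ → ℕ) (C : Finset (Fin k)) : ℝ :=
  (Measure.pi ν).real {z | letterOf enc z = C}

lemma lintegral_comp_finite {α κ : Type*} [MeasurableSpace α] [Fintype κ] (μ : Measure α)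
    [IsFiniteMeasure μ] {L : α → κ} (hL : ∀ c, MeasurableSet {x | L x = c}) (F : κ → ℕ) :
    ∫⁻ x, (F (L x) : ℝ≥0∞) ∂μ = ENNReal.ofReal (∑ c, μ.real {x | L x = c} * F c) := by
  classical
  have h : ∀ x, (F (L x) : ℝ≥0∞) = ∑ c, (F c : ℝ≥0∞) * {x | L x = c}.indicator 1 x := fun x => by
    rw [Finset.sum_eq_single (L x)]
    · simp
    · intro c _ hc
      rw [Set.indicator_of_notMem (fun h => hc h.symm), mul_zero]
    · exact fun h => absurd (Finset.mem_univ _) h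
  simp only [h]
  rw [lintegral_finsetSum _ fun c _ => (measurable_one.indicator (hL c)).const_mul _,
    ENNReal.ofReal_sum_of_nonneg fun c _ => mul_nonneg measureReal_nonneg (Nat.cast_nonneg _)]
  refine Finset.sum_congr rfl fun c _ => ?_
  rw [lintegral_const_mul _ (measurable_one.indicator (hL c)), lintegral_indicator_one (hL c),
    ENNReal.ofReal_mul measureReal_nonneg, ofReal_measureReal, ENNReal.ofReal_natCast, mul_comm]

include hM in
lemma IsEncodedModel.lintegral_letterOf (F : Finset (Fin k) → ℕ) :
    ∫⁻ z, (F (letterOf enc z) : ℝ≥0∞) ∂(Measure.pi ν) =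
      ENNReal.ofReal (∑ C, letterWeight ν enc C * F C) := by
  have := hM.isProbabilityMeasure
  exact lintegral_comp_finite _ hM.measurableSet_letterOf F

include hM in
lemma IsEncodedModel.letterWeight_nonneg (C : Finset (Fin k)) : 0 ≤ letterWeight ν enc C :=
  measureReal_nonneg

include hM in
lemma IsEncodedModel.sum_letterWeight : ∑ C, letterWeight ν enc C = 1 := by
  have := hM.isProbabilityMeasure
  have h := hM.lintegral_letterOf fun _ => 1
  simp only [Nat.cast_one, mul_one, lintegral_const, measure_univ] at h
  have h1 := congrArg ENNReal.toReal h
  rw [ENNReal.toReal_ofReal (Finset.sum_nonneg fun C _ => hM.letterWeight_nonneg C)] at h1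
  simpa using h1.symm

include hM in
lemma IsEncodedModel.pi_curry (N : ℕ) :
    (Measure.pi fun p : Fin N × Fin k => ν p.2).map (MeasurableEquiv.curry (Fin N) (Fin k) ℝ) =
      Measure.pi fun _ : Fin N => Measure.pi ν := by
  have := hM.isProbabilityMeasure
  have h := Measure.infinitePi_map_curry fun (_ : Fin N) (j : Fin k) => ν j
  simpa only [Measure.infinitePi_eq_pi] using h

include hM in
-- The letters of different positions are independent with the same law, so the random word has the
-- product weight.
lemma IsEncodedModel.lintegral_block {N : ℕ} (F : (Fin N → Finset (Fin k)) → ℕ) :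
    ∫⁻ z, (F (slice (zeroSet fun p => enc p.2 (z p))) : ℝ≥0∞)
        ∂(Measure.pi fun p : Fin N × Fin k => ν p.2) =
      ENNReal.ofReal (∑ c, wordWeight (letterWeight ν enc) c * F c) := by
  have := hM.isProbabilityMeasure
  have hset : ∀ c : Fin N → Finset (Fin k), {x : Fin N → Fin k → ℝ |
      (fun i => letterOf enc (x i)) = c} = Set.univ.pi fun i => {z | letterOf enc z = c i} :=
    fun c => by ext x; simp [funext_iff]
  have hmeas : ∀ c : Fin N → Finset (Fin k), MeasurableSet {x : Fin N → Fin k → ℝ |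
      (fun i => letterOf enc (x i)) = c} := fun c => by
    rw [hset]
    exact MeasurableSet.univ_pi fun i => hM.measurableSet_letterOf (c i)
  have h1 := lintegral_comp_finite (Measure.pi fun _ : Fin N => Measure.pi ν) hmeas F
  rw [← hM.pi_curry, lintegral_map_equiv] at h1
  have h2 : ∀ z : Fin N × Fin k → ℝ, (fun i => letterOf enc
      (MeasurableEquiv.curry (Fin N) (Fin k) ℝ z i)) = slice (zeroSet fun p => enc p.2 (z p)) :=
    fun z => by
      funext i
      ext j
      simp [letterOf, slice, zeroSet]
  simp only [h2] at h1
  rw [h1]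
  congr 1
  refine Finset.sum_congr rfl fun c _ => ?_
  congr 1
  rw [hM.pi_curry, hset, Measure.real, Measure.pi_pi, ENNReal.toReal_prod]
  rfl

end LabelledModel

section SourceModel

variable {Ω : Type*} [MeasurableSpace Ω] {P : Measure Ω} [IsProbabilityMeasure P]
  {X Y : ℕ → Ω → ℝ} (hs : IsMemorylessSource P X Y) {k : ℕ} {A : Matrix (Fin 2) (Fin k) ℝ}
  {ν : Fin k → Measure ℝ} {S : Fin k → Set ℝ} {enc : Fin k → ℝ → ℕ}
  {dec : Fin k → ℕ → ℝ} (hM : IsEncodedModel ν S enc dec)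
  (hlaw : P.map (fun ω => ![X 0 ω, Y 0 ω]) = (Measure.pi ν).map fun z => A.mulVec z)

/-- The block of the first `N` pairs. -/
def pairBlock (X Y : ℕ → Ω → ℝ) (N : ℕ) (ω : Ω) (p : Fin N × Fin 2) : ℝ :=
  ![X p.1 ω, Y p.1 ω] p.2

include hs in
lemma measurable_pair (i : ℕ) : Measurable fun ω => ![X i ω, Y i ω] := by
  refine measurable_pi_lambda _ (Fin.forall_fin_two.2 ⟨?_, ?_⟩)
  exacts [hs.measurable_fst i, hs.measurable_snd i]

include hs in
lemma measurable_pairBlock (N : ℕ) : Measurable (pairBlock X Y N) :=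
  measurable_pi_lambda _ fun p => (measurable_pi_apply p.2).comp (measurable_pair hs p.1)

lemma measurable_mulVec (A : Matrix (Fin 2) (Fin k) ℝ) :
    Measurable fun z : Fin k → ℝ => A.mulVec z := measurable_linearMap A.mulVecLin

lemma measurable_vecOfPair : Measurable fun x : ℝ × ℝ => ![x.1, x.2] := by
  refine measurable_pi_lambda _ (Fin.forall_fin_two.2 ⟨?_, ?_⟩)
  exacts [measurable_fst, measurable_snd]

include hs in
lemma iIndepFun_pair : iIndepFun (fun i ω => ![X i ω, Y i ω]) P :=
  hs.indep.comp (fun _ x => ![x.1, x.2]) fun _ => measurable_vecOfPair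

include hs in
lemma identDistrib_pair (i : ℕ) :
    IdentDistrib (fun ω => ![X i ω, Y i ω]) (fun ω => ![X 0 ω, Y 0 ω]) P P :=
  (hs.identDistrib i).comp measurable_vecOfPair

include hs hM hlaw in
/-- The law of a block of the source is that of a linear image of independent variables. -/
lemma map_pairBlock (N : ℕ) : P.map (pairBlock X Y N) =
    (Measure.pi fun p : Fin N × Fin k => ν p.2).map (blockMap A N) := by
  have := hM.isProbabilityMeasure
  have hA := measurable_mulVec A
  have hpr : IsProbabilityMeasure ((Measure.pi ν).map fun z => A.mulVec z) :=
    Measure.isProbabilityMeasure_map hA.aemeasurable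
  have h1 : P.map (fun ω (i : Fin N) => ![X i ω, Y i ω]) =
      Measure.pi fun _ : Fin N => (Measure.pi ν).map fun z => A.mulVec z := by
    rw [show P.map (fun ω (i : Fin N) => ![X i ω, Y i ω]) =
      Measure.pi fun i : Fin N => P.map fun ω => ![X i ω, Y i ω] from
      (iIndepFun_iff_map_fun_eq_pi_map fun i : Fin N => (measurable_pair hs i).aemeasurable).1
        ((iIndepFun_pair hs).precomp Fin.val_injective)]
    congr 1
    funext i
    rw [(identDistrib_pair hs i).map_eq, hlaw]
  have hun : Measurable fun (x : Fin N → Fin 2 → ℝ) (p : Fin N × Fin 2) => x p.1 p.2 :=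
    measurable_pi_lambda _ fun p => (measurable_pi_apply p.2).comp (measurable_pi_apply p.1)
  have hX : Measurable fun ω (i : Fin N) => ![X i ω, Y i ω] :=
    measurable_pi_lambda _ fun i => measurable_pair hs i
  have hAN : Measurable fun (x : Fin N → Fin k → ℝ) i => A.mulVec (x i) :=
    measurable_pi_lambda _ fun i => hA.comp (measurable_pi_apply i)
  calc P.map (pairBlock X Y N) = (P.map fun ω (i : Fin N) => ![X i ω, Y i ω]).map
        fun x p => x p.1 p.2 := (Measure.map_map hun hX).symm
    _ = ((Measure.pi fun _ : Fin N => Measure.pi ν).map fun x i => A.mulVec (x i)).map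
        fun x p => x p.1 p.2 := by
      rw [h1, Measure.pi_map_pi (f := fun _ z => A.mulVec z) fun _ => hA.aemeasurable]
    _ = _ := by
      rw [← hM.pi_curry, Measure.map_map hAN (MeasurableEquiv.measurable _),
        Measure.map_map hun (hAN.comp (MeasurableEquiv.measurable _))]
      rfl

include hs hM hlaw in
/-- The information dimension of a block given its measurements. -/
theorem tendsto_condEntropy_pairBlock {n : ℕ} (R : Fin 2 → Finset (Fin (2 ^ n))) :
    Tendsto (fun q : ℕ => condEntropy P (fun ω => floorVec q (pairBlock X Y (2 ^ n) ω))
        (fun ω => measureMap R (pairBlock X Y (2 ^ n) ω)) / ENNReal.ofReal (Real.logb 2 q)) atTop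
      (𝓝 (ENNReal.ofReal (∑ c, wordWeight (letterWeight ν enc) c *
        (Module.finrank ℝ (unresolved (letterSpace A) R c) : ℝ)))) := by
  have := hM.isProbabilityMeasure
  have h := tendsto_condEntropy_floorVec (hM.isMixedVector_block (2 ^ n)) (blockMap A (2 ^ n))
    ((measureMap R).comp (blockMap A (2 ^ n)))
  simp only [finrank_residual_block] at h
  rw [hM.lintegral_block fun c => Module.finrank ℝ (unresolved (letterSpace A) R c)] at h
  refine h.congr fun q => ?_
  congr 1
  have hB := measurable_linearMap (blockMap A (2 ^ n))
  have hR := measurable_linearMap (measureMap R)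
  have hU := measurable_pairBlock hs (2 ^ n)
  have hfl := measurable_floorVec (ι := Fin (2 ^ n) × Fin 2) q
  refine condEntropy_congr_law (hfl.comp hB).aemeasurable (hfl.comp hU).aemeasurable ?_
  have hpair : Measurable fun u : Fin (2 ^ n) × Fin 2 → ℝ => (measureMap R u, floorVec q u) :=
    hR.prodMk hfl
  have e1 := Measure.map_map (μ := P) hpair hU
  have e2 := Measure.map_map (μ := Measure.pi fun p : Fin (2 ^ n) × Fin k => ν p.2) hpair hB
  rw [map_pairBlock hs hM hlaw] at e1
  exact e2.symm.trans e1

end SourceModel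

end RenyiCompression

/-! ### Quantized sources and the single-letter dimensions -/

namespace RenyiCompression

section Quantization

variable {Ω : Type*} [MeasurableSpace Ω] {P : Measure Ω} [IsProbabilityMeasure P]

/-- The quantized vector with integer numerators `v`. -/
def scaleInt {ι : Type*} (q : ℕ) (v : ι → ℤ) : ι → ℝ := fun i => (v i : ℝ) / q

lemma quant_eq_scaleInt {ι : Type*} (q : ℕ) (x : ι → ℝ) :
    quant q x = scaleInt q (floorVec q x) := rfl

lemma scaleInt_injective {ι : Type*} {q : ℕ} (hq : 1 ≤ q) :
    Function.Injective (scaleInt (ι := ι) q) := by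
  intro v w h
  have hq' : (q : ℝ) ≠ 0 := by positivity
  funext i
  have h1 : (v i : ℝ) / q = w i / q := congrFun h i
  exact_mod_cast (div_left_inj' hq').1 h1

lemma condEntropy_quant {ι β : Type*} [Finite ι] [MeasurableSpace β] {V : Ω → ι → ℝ}
    (hV : Measurable V) (W : Ω → β) {q : ℕ} (hq : 1 ≤ q) :
    condEntropy P (fun ω => quant q (V ω)) W = condEntropy P (fun ω => floorVec q (V ω)) W := by
  have h : Measurable fun ω => floorVec q (V ω) := (measurable_floorVec q).comp hV
  simp only [quant_eq_scaleInt]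
  exact condEntropy_comp_injective h (g := scaleInt q) (scaleInt_injective hq)

lemma entropy_quant {ι : Type*} [Finite ι] {V : Ω → ι → ℝ} (hV : Measurable V) {q : ℕ}
    (hq : 1 ≤ q) :
    entropy P (fun ω => quant q (V ω)) = entropy P fun ω => floorVec q (V ω) := by
  have h : Measurable fun ω => floorVec q (V ω) := (measurable_floorVec q).comp hV
  simp only [quant_eq_scaleInt]
  exact entropy_comp_injective h (g := scaleInt q) (scaleInt_injective hq)

/-- The quantized blocks with the given integer numerators. -/
def scaleBlocks {N : ℕ} (q : ℕ) (u : Fin N × Fin 2 → ℤ) : (Fin N → ℝ) × (Fin N → ℝ) :=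
  (scaleInt q fun j => u (j, 0), scaleInt q fun j => u (j, 1))

lemma scaleBlocks_injective {N q : ℕ} (hq : 1 ≤ q) :
    Function.Injective (scaleBlocks (N := N) q) := by
  intro u v h
  have h0 := scaleInt_injective hq (congrArg Prod.fst h)
  have h1 := scaleInt_injective hq (congrArg Prod.snd h)
  funext ⟨j, t⟩
  fin_cases t
  exacts [congrFun h0 j, congrFun h1 j]

variable {X Y : ℕ → Ω → ℝ} (hs : IsMemorylessSource P X Y)

lemma quant_blocks (q N : ℕ) (ω : Ω) : (quant q (block X N ω), quant q (block Y N ω)) =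
    scaleBlocks q (floorVec q (pairBlock X Y N ω)) := rfl

include hs in
lemma measurable_floorVec_pairBlock (q N : ℕ) :
    Measurable fun ω => floorVec q (pairBlock X Y N ω) :=
  (measurable_floorVec q).comp (measurable_pairBlock hs N)

include hs in
lemma condEntropy_quant_blocks {β : Type*} [MeasurableSpace β] (N : ℕ) (W : Ω → β) {q : ℕ}
    (hq : 1 ≤ q) :
    condEntropy P (fun ω => (quant q (block X N ω), quant q (block Y N ω))) W =
      condEntropy P (fun ω => floorVec q (pairBlock X Y N ω)) W := by
  have h := measurable_floorVec_pairBlock hs q N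
  simp only [quant_blocks]
  exact condEntropy_comp_injective h (g := scaleBlocks q) (scaleBlocks_injective hq)

include hs in
lemma entropy_quant_blocks (N : ℕ) {q : ℕ} (hq : 1 ≤ q) :
    entropy P (fun ω => (quant q (block X N ω), quant q (block Y N ω))) =
      entropy P fun ω => floorVec q (pairBlock X Y N ω) := by
  have h := measurable_floorVec_pairBlock hs q N
  simp only [quant_blocks]
  exact entropy_comp_injective h (g := scaleBlocks q) (scaleBlocks_injective hq)

end Quantization

section SingleLetter

/-- The coordinate `t` as a vector of length one. -/
def coordMap (t : Fin 2) : (Fin 2 → ℝ) →ₗ[ℝ] (Fin 1 → ℝ) := LinearMap.funLeft ℝ ℝ fun _ => t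

lemma rowVal_single {T : Type*} (v : Fin (2 ^ 0) → T → ℝ) (t : T) : rowVal v t 0 = v 0 t := by
  change ∑ j : Fin 1, (hadamard 0) 0 j * v j t = _
  simp [hadamard]

lemma residual_coordMap {k : ℕ} (A : Matrix (Fin 2) (Fin k) ℝ) (C : Finset (Fin k)) (s t : Fin 2) :
    residual ((coordMap t).comp A.mulVecLin) ((coordMap s).comp A.mulVecLin) C =
      (letterSpace A C ⊓ LinearMap.ker (coordMap s)).map (coordMap t) := by
  ext u
  simp only [mem_residual, Submodule.mem_map, Submodule.mem_inf, LinearMap.mem_ker,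
    mem_letterSpace, LinearMap.comp_apply, Matrix.mulVecLin_apply]
  constructor
  · rintro ⟨z, hz, h1, h2⟩
    exact ⟨_, ⟨⟨z, hz, rfl⟩, h1⟩, h2⟩
  · rintro ⟨_, ⟨⟨z, hz, rfl⟩, h1⟩, h2⟩
    exact ⟨z, hz, h1, h2⟩

open Classical in
lemma finrank_map_coordMap (Q : Submodule ℝ (Fin 2 → ℝ)) (s t : Fin 2) :
    Module.finrank ℝ ((Q ⊓ LinearMap.ker (coordMap s)).map (coordMap t)) =
      if ∃ u ∈ Q, u s = 0 ∧ u t ≠ 0 then 1 else 0 := by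
  set M := (Q ⊓ LinearMap.ker (coordMap s)).map (coordMap t)
  have hmem : ∀ w, w ∈ M ↔ ∃ u ∈ Q, u s = 0 ∧ ∀ i, u t = w i := fun w => by
    simp [M, coordMap, Submodule.mem_map, funext_iff, and_assoc, LinearMap.funLeft_apply]
  have hle : Module.finrank ℝ M ≤ 1 := by
    simpa using Submodule.finrank_le M
  split_ifs with h
  · obtain ⟨u, hu, hs, ht⟩ := h
    have hne : M ≠ ⊥ := fun hM => by
      have : (fun _ => u t) ∈ M := (hmem _).2 ⟨u, hu, hs, fun _ => rfl⟩
      rw [hM, Submodule.mem_bot] at this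
      exact ht (congrFun this 0)
    have := Submodule.one_le_finrank_iff.2 hne
    omega
  · rw [Submodule.finrank_eq_zero, Submodule.eq_bot_iff]
    intro w hw
    obtain ⟨u, hu, hs, ht⟩ := (hmem w).1 hw
    funext i
    rw [← ht i]
    by_contra hne
    exact h ⟨u, hu, hs, hne⟩

variable {A : Type*} [Fintype A] {w : A → ℝ} {S : A → Submodule ℝ (Fin 2 → ℝ)}

/-- At block length one the Hadamard matrix is trivial: the later terminal `t` is innovative iff the
letter space has a vector vanishing at `s` but not at `t`. This identifies the corner rates with
conditional information dimensions. -/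
lemma innovation_single {τ : Fin 2 × Fin (2 ^ 0) → ℕ} {s t : Fin 2} (h : τ (s, 0) < τ (t, 0)) :
    innovation w S τ (t, 0) = ∑ a, w a * (Module.finrank ℝ
      ((S a ⊓ LinearMap.ker (coordMap s)).map (coordMap t)) : ℝ) := by
  classical
  have hst : s ≠ t := fun h' => by simp [h'] at h
  have hinn : ∀ c : Fin (2 ^ 0) → A, Innovative S τ c (t, 0) ↔
      ∃ u ∈ S (c 0), u s = 0 ∧ u t ≠ 0 := fun c => by
    have h0 : ∀ j : Fin (2 ^ 0), j = 0 := fun j => Subsingleton.elim (α := Fin 1) j 0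
    constructor
    · rintro ⟨v, hv, hp, hne⟩
      rw [rowVal_single] at hne
      have hps := hp (s, 0) h
      rw [rowVal_single] at hps
      exact ⟨v 0, hv 0, hps, hne⟩
    · rintro ⟨u, hu, hus, hut⟩
      refine ⟨fun _ => u, fun j => by rw [h0 j]; exact hu, ?_, by rwa [rowVal_single]⟩
      rintro ⟨r, j⟩ hr
      rw [h0 j] at hr ⊢
      rw [rowVal_single]
      have hrt : r ≠ t := fun h' => by simp [h'] at hr
      have : r = s := by omega
      rw [this, hus]
  unfold innovation
  refine Fintype.sum_equiv (Equiv.funUnique (Fin 1) A) _ _ fun c => ?_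
  rw [finrank_map_coordMap, wordWeight]
  congr 1
  · exact Fintype.prod_unique (ι := Fin 1) fun i => w (c i)
  · rw [if_congr (hinn c) rfl rfl]
    simp only [Equiv.funUnique_apply]
    push_cast
    rfl

end SingleLetter

section Dimensions

variable {Ω : Type*} [MeasurableSpace Ω] {P : Measure Ω} [IsProbabilityMeasure P]
  {X Y : ℕ → Ω → ℝ} (hs : IsMemorylessSource P X Y) {k : ℕ} {A : Matrix (Fin 2) (Fin k) ℝ}
  {ν : Fin k → Measure ℝ} {S : Fin k → Set ℝ} {enc : Fin k → ℝ → ℕ}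
  {dec : Fin k → ℕ → ℝ} (hM : IsEncodedModel ν S enc dec)
  (hlaw : P.map (fun ω => ![X 0 ω, Y 0 ω]) = (Measure.pi ν).map fun z => A.mulVec z)

include hs hM hlaw in
lemma tendsto_condEntropy_coord {τ : Fin 2 × Fin (2 ^ 0) → ℕ} {s t : Fin 2}
    (h : τ (s, 0) < τ (t, 0)) :
    Tendsto (fun q : ℕ => condEntropy P (fun ω => quant q (coordMap t ![X 0 ω, Y 0 ω]))
        (fun ω => coordMap s ![X 0 ω, Y 0 ω]) / ENNReal.ofReal (Real.logb 2 q)) atTop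
      (𝓝 (ENNReal.ofReal (innovation (letterWeight ν enc) (letterSpace A) τ (t, 0)))) := by
  have := hM.isProbabilityMeasure
  have hlim := tendsto_condEntropy_floorVec hM.isMixedVector ((coordMap t).comp A.mulVecLin)
    ((coordMap s).comp A.mulVecLin)
  have e := hM.lintegral_letterOf fun C => Module.finrank ℝ
    ((letterSpace A C ⊓ LinearMap.ker (coordMap s)).map (coordMap t))
  rw [← innovation_single h] at e
  have e' : ∫⁻ z, (Module.finrank ℝ (residual ((coordMap t).comp A.mulVecLin)
      ((coordMap s).comp A.mulVecLin) (zeroSet fun j => enc j (z j))) : ℝ≥0∞) ∂(Measure.pi ν) =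
      ENNReal.ofReal (innovation (letterWeight ν enc) (letterSpace A) τ (t, 0)) := by
    rw [← e]
    refine lintegral_congr fun z => ?_
    rw [residual_coordMap]
    rfl
  rw [← e']
  refine hlim.congr' ?_
  filter_upwards [eventually_ge_atTop 1] with q hq
  congr 1
  have hA := measurable_mulVec A
  have ht := measurable_linearMap (coordMap t)
  have hs' := measurable_linearMap (coordMap s)
  have hU := measurable_pair hs 0
  have hfl := measurable_floorVec (ι := Fin 1) q
  have hV : Measurable fun ω => coordMap t ![X 0 ω, Y 0 ω] := ht.comp hU
  rw [condEntropy_quant hV _ hq]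
  refine condEntropy_congr_law (hfl.comp (ht.comp hA)).aemeasurable
    (hfl.comp (ht.comp hU)).aemeasurable ?_
  have hpair : Measurable fun u : Fin 2 → ℝ => (coordMap s u, floorVec q (coordMap t u)) :=
    hs'.prodMk (hfl.comp ht)
  have e1 := Measure.map_map (μ := P) hpair hU
  have e2 := Measure.map_map (μ := Measure.pi ν) hpair hA
  rw [hlaw] at e1
  exact e2.symm.trans e1

include hs hM hlaw in
/-- The information dimension of a block. -/
lemma tendsto_entropy_pairBlock (n : ℕ) :
    Tendsto (fun q : ℕ => entropy P (fun ω => floorVec q (pairBlock X Y (2 ^ n) ω)) /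
        ENNReal.ofReal (Real.logb 2 q)) atTop
      (𝓝 (ENNReal.ofReal (2 ^ n *
        (innovation (letterWeight ν enc) (letterSpace A) (pathOrder 0 0) (0, 0) +
          innovation (letterWeight ν enc) (letterSpace A) (pathOrder 0 0) (1, 0))))) := by
  -- With no rows selected the measurement is constant, and the conditional entropy is the entropy.
  have h := tendsto_condEntropy_pairBlock hs hM hlaw (n := n) fun _ => ∅
  have h1 : ∀ u, measureMap (n := n) (fun _ => ∅) u = 0 := fun u =>
    Prod.ext (funext fun i => by simp [measureMap, maskedRows])
      (funext fun i => by simp [measureMap, maskedRows])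
  simp only [h1] at h
  rw [← sum_innovation_pathOrder hM.sum_letterWeight n 0, ← Fin.sum_univ_two
    (fun t => ∑ i, innovation (letterWeight ν enc) (letterSpace A) (pathOrder n 0) (t, i)),
    sum_innovation (pathOrder_injective _ _)]
  refine h.congr fun q => ?_
  rw [condEntropy_const_right (measurable_floorVec_pairBlock hs q (2 ^ n))]

include hs in
lemma entropy_pairBlock_single (q : ℕ) :
    entropy P (fun ω => floorVec q (pairBlock X Y (2 ^ 0) ω)) =
      entropy P fun ω => floorVec q ![X 0 ω, Y 0 ω] := by
  have hinj : Function.Injective fun (v : Fin 2 → ℤ) (p : Fin (2 ^ 0) × Fin 2) => v p.2 :=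
    fun v w h => funext fun t => congrFun h (0, t)
  have hm : Measurable fun ω => floorVec q ![X 0 ω, Y 0 ω] :=
    (measurable_floorVec q).comp (measurable_pair hs 0)
  rw [← entropy_comp_injective hm hinj]
  congr 1
  funext ω p
  obtain ⟨i, t⟩ := p
  obtain rfl : i = 0 := Subsingleton.elim (α := Fin 1) i 0
  rfl

include hs hM hlaw in
lemma hasCondRID_fst : HasCondRID P (fun ω => ![X 0 ω]) (fun ω => ![Y 0 ω])
    (innovation (letterWeight ν enc) (letterSpace A) (pathOrder 0 0) (0, 0)).toNNReal := by
  have h : pathOrder 0 0 (1, 0) < pathOrder 0 0 (0, 0) := by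
    rw [pathOrder_one, pathOrder_zero]
    simp
  have e := tendsto_condEntropy_coord hs hM hlaw h
  have e0 : ∀ ω, coordMap 0 ![X 0 ω, Y 0 ω] = ![X 0 ω] := fun ω => by
    funext i; fin_cases i; rfl
  have e1 : ∀ ω, coordMap 1 ![X 0 ω, Y 0 ω] = ![Y 0 ω] := fun ω => by
    funext i; fin_cases i; rfl
  simp only [e0, e1] at e
  exact e

include hs hM hlaw in
lemma hasCondRID_snd : HasCondRID P (fun ω => ![Y 0 ω]) (fun ω => ![X 0 ω])
    (innovation (letterWeight ν enc) (letterSpace A) (pathOrder 0 1) (1, 0)).toNNReal := by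
  have h : pathOrder 0 1 (0, 0) < pathOrder 0 1 (1, 0) := by
    have := rowPos_lt (n := 0) 0
    rw [pathOrder_one, pathOrder_zero, if_pos (by simpa using this)]
    simp
  have e := tendsto_condEntropy_coord hs hM hlaw h
  have e0 : ∀ ω, coordMap 0 ![X 0 ω, Y 0 ω] = ![X 0 ω] := fun ω => by
    funext i; fin_cases i; rfl
  have e1 : ∀ ω, coordMap 1 ![X 0 ω, Y 0 ω] = ![Y 0 ω] := fun ω => by
    funext i; fin_cases i; rfl
  simp only [e0, e1] at e
  exact e

include hs hM hlaw in
lemma hasRID_pair : HasRID P (fun ω => ![X 0 ω, Y 0 ω])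
    (innovation (letterWeight ν enc) (letterSpace A) (pathOrder 0 0) (0, 0) +
      innovation (letterWeight ν enc) (letterSpace A) (pathOrder 0 0) (1, 0)).toNNReal := by
  have h := tendsto_entropy_pairBlock hs hM hlaw 0
  rw [pow_zero (2 : ℝ), one_mul] at h
  refine h.congr' ?_
  filter_upwards [eventually_ge_atTop 1] with q hq
  rw [entropy_pairBlock_single hs, entropy_quant (measurable_pair hs 0) hq]

end Dimensions

end RenyiCompression

/-! ### Partial Hadamard measurements at positive dimension -/

namespace RenyiCompression

section PartialHadamard

variable {n : ℕ}

/-- The rows in `R` of the Hadamard matrix. -/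
def partialHadamard (R : Finset (Fin (2 ^ n))) : Matrix (Fin R.card) (Fin (2 ^ n)) ℝ :=
  (hadamard n).submatrix (R.orderEmbOfFin rfl) id

lemma isPartialHadamard_partialHadamard (R : Finset (Fin (2 ^ n))) :
    IsPartialHadamard (partialHadamard R) := ⟨R.orderEmbOfFin rfl, rfl⟩

/-- Passes from the matrix of selected rows to the zero-padded form, whose index type does not
depend on `R`. Only this direction is needed, since conditioning on a function of the measurement
gives an upper bound. -/
lemma exists_maskedRows_eq (R : Finset (Fin (2 ^ n))) :
    ∃ φ : (Fin R.card → ℝ) → Fin (2 ^ n) → ℝ, Measurable φ ∧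
      ∀ x, φ ((partialHadamard R).mulVec x) = maskedRows R x := by
  refine ⟨fun y i => if h : i ∈ R then y ((R.orderIsoOfFin rfl).symm ⟨i, h⟩) else 0, ?_, ?_⟩
  · refine measurable_pi_lambda _ fun i => ?_
    by_cases h : i ∈ R
    · simp only [h, dif_pos]
      exact measurable_pi_apply _
    · simp only [h, dif_neg, not_false_eq_true]
      exact measurable_const
  · intro x
    funext i
    by_cases h : i ∈ R
    · have hi : R.orderEmbOfFin rfl ((R.orderIsoOfFin rfl).symm ⟨i, h⟩) = i := by
        rw [← Finset.coe_orderIsoOfFin_apply, OrderIso.apply_symm_apply]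
      simp only [h, dif_pos, maskedRows, if_true]
      change (hadamard n).mulVec x (R.orderEmbOfFin rfl _) = _
      rw [hi]
    · simp [h, maskedRows]

lemma measurable_matrix_mulVec {m N : ℕ} (M : Matrix (Fin m) (Fin N) ℝ) :
    Measurable fun x : Fin N → ℝ => M.mulVec x := measurable_linearMap M.mulVecLin

lemma finrank_unresolved_univ {A T : Type*} [Fintype T] (S : A → Submodule ℝ (T → ℝ)) (c : Fin (2 ^ n) → A) :
    Module.finrank ℝ (unresolved S (fun _ => Finset.univ) c) = 0 := by
  rw [Submodule.finrank_eq_zero, Submodule.eq_bot_iff]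
  exact fun v hv => eq_zero_of_rowVal fun t i => (mem_unresolved.1 hv).2 t i (Finset.mem_univ i)

end PartialHadamard

section Measurement

variable {Ω : Type*} [MeasurableSpace Ω] {P : Measure Ω} [IsProbabilityMeasure P]
  {X Y : ℕ → Ω → ℝ} (hs : IsMemorylessSource P X Y)

/-- The pair of the measurements of two blocks with the rows in `R 0` and in `R 1`. -/
def measurements (X Y : ℕ → Ω → ℝ) {n : ℕ} (R : Fin 2 → Finset (Fin (2 ^ n))) (ω : Ω) :
    (Fin (R 0).card → ℝ) × (Fin (R 1).card → ℝ) :=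
  ((partialHadamard (R 0)).mulVec (block X (2 ^ n) ω),
    (partialHadamard (R 1)).mulVec (block Y (2 ^ n) ω))

lemma measurable_block {X : ℕ → Ω → ℝ} (hX : ∀ i, Measurable (X i)) (N : ℕ) :
    Measurable (block X N) := measurable_pi_lambda _ fun i => hX i

include hs in
lemma measurable_measurements {n : ℕ} (R : Fin 2 → Finset (Fin (2 ^ n))) :
    Measurable (measurements X Y R) :=
  ((measurable_matrix_mulVec _).comp (measurable_block hs.measurable_fst _)).prodMk
    ((measurable_matrix_mulVec _).comp (measurable_block hs.measurable_snd _))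

/-- The part of the entropy of the quantized blocks that is left by the measurements. -/
def entropyRatio (P : Measure Ω) [IsProbabilityMeasure P] (X Y : ℕ → Ω → ℝ) {n : ℕ}
    (R : Fin 2 → Finset (Fin (2 ^ n))) (q : ℕ) : ℝ≥0∞ :=
  condEntropy P (fun ω => (quant q (block X (2 ^ n) ω), quant q (block Y (2 ^ n) ω)))
      (measurements X Y R) /
    entropy P (fun ω => (quant q (block X (2 ^ n) ω), quant q (block Y (2 ^ n) ω)))

/-- Rows that meet the requirements on a family of measurements. -/
structure AreREPRows (P : Measure Ω) [IsProbabilityMeasure P] (X Y : ℕ → Ω → ℝ) (ε : ℝ)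
    (ρ : Fin 2 → ℝ≥0) (R : ∀ n, Fin 2 → Finset (Fin (2 ^ n))) : Prop where
  ratio : ∀ n, limsup (entropyRatio P X Y (R n)) atTop ≤ ENNReal.ofReal ε
  rate : ∀ t, limsup (fun n => ((R n t).card : ℝ≥0∞) / ((2 ^ n : ℕ) : ℝ≥0∞)) atTop ≤ ρ t

lemma AreREPRows.isREP {ε : ℝ} {ρ : Fin 2 → ℝ≥0} {R : ∀ n, Fin 2 → Finset (Fin (2 ^ n))}
    (h : AreREPRows P X Y ε ρ R) :
    IsREP P X Y ε (ρ 0) (ρ 1) (fun n => 2 ^ n) (fun n => (R n 0).card) (fun n => (R n 1).card)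
      (fun n => partialHadamard (R n 0)) (fun n => partialHadamard (R n 1)) where
  strictMono := pow_right_strictMono₀ one_lt_two
  entropy_ratio := h.ratio
  rate_fst := h.rate 0
  rate_snd := h.rate 1

include hs in
lemma condEntropy_measurements_le {n : ℕ} (R : Fin 2 → Finset (Fin (2 ^ n))) {q : ℕ}
    (hq : 1 ≤ q) :
    condEntropy P (fun ω => (quant q (block X (2 ^ n) ω), quant q (block Y (2 ^ n) ω)))
        (measurements X Y R) ≤
      condEntropy P (fun ω => floorVec q (pairBlock X Y (2 ^ n) ω))
        (fun ω => measureMap R (pairBlock X Y (2 ^ n) ω)) := by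
  rw [condEntropy_quant_blocks hs _ _ hq]
  obtain ⟨φ, hφ, hφx⟩ := exists_maskedRows_eq (R 0)
  obtain ⟨ψ, hψ, hψx⟩ := exists_maskedRows_eq (R 1)
  have h := condEntropy_le_comp (P := P) (measurable_floorVec_pairBlock hs q (2 ^ n))
    (measurable_measurements hs R)
    (φ := fun y => (φ y.1, ψ y.2)) ((hφ.comp measurable_fst).prodMk (hψ.comp measurable_snd))
  refine h.trans_eq ?_
  congr 1
  funext ω
  exact Prod.ext (hφx _) (hψx _)

variable {k : ℕ} {A : Matrix (Fin 2) (Fin k) ℝ}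
  {ν : Fin k → Measure ℝ} {S : Fin k → Set ℝ} {enc : Fin k → ℝ → ℕ}
  {dec : Fin k → ℕ → ℝ} (hM : IsEncodedModel ν S enc dec)
  (hlaw : P.map (fun ω => ![X 0 ω, Y 0 ω]) = (Measure.pi ν).map fun z => A.mulVec z)

include hs hM hlaw in
-- Divided by `log₂ q`, numerator and denominator converge to the expected unresolved dimension and
-- to `2 ^ n * d`. Positivity of `d` makes the quotient of the limits meaningful.
lemma limsup_entropyRatio_le {n : ℕ} (R : Fin 2 → Finset (Fin (2 ^ n))) {d : ℝ} (hd : 0 < d)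
    (hdim : innovation (letterWeight ν enc) (letterSpace A) (pathOrder 0 0) (0, 0) +
      innovation (letterWeight ν enc) (letterSpace A) (pathOrder 0 0) (1, 0) = d) {ε : ℝ}
    (hR : ∑ c, wordWeight (letterWeight ν enc) c *
      (Module.finrank ℝ (unresolved (letterSpace A) R c) : ℝ) ≤ ε * d * 2 ^ n) :
    limsup (entropyRatio P X Y R) atTop ≤ ENNReal.ofReal ε := by
  have hnum := tendsto_condEntropy_pairBlock hs hM hlaw R
  have hden := tendsto_entropy_pairBlock hs hM hlaw n
  rw [hdim] at hden
  have hpos : (0 : ℝ) < 2 ^ n * d := by positivity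
  have hne : ENNReal.ofReal (2 ^ n * d) ≠ 0 := (ENNReal.ofReal_pos.2 hpos).ne'
  have hlim := ENNReal.Tendsto.div hnum (Or.inr hne) hden (Or.inl ENNReal.ofReal_ne_top)
  have hle : limsup (entropyRatio P X Y R) atTop ≤ _ :=
    (Filter.limsup_le_limsup ?_).trans_eq hlim.limsup_eq
  · refine hle.trans ((ENNReal.div_le_iff_le_mul (Or.inl hne) (Or.inl ENNReal.ofReal_ne_top)).2 ?_)
    rw [← ENNReal.ofReal_mul' hpos.le]
    exact ENNReal.ofReal_le_ofReal (by linarith)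
  · filter_upwards [eventually_ge_atTop 2] with q hq
    have hlog : 0 < Real.logb 2 q := Real.logb_pos one_lt_two (by exact_mod_cast hq)
    have hl0 : (ENNReal.ofReal (Real.logb 2 q))⁻¹ ≠ ∞ :=
      ENNReal.inv_ne_top.2 (ENNReal.ofReal_pos.2 hlog).ne'
    have hl1 : (ENNReal.ofReal (Real.logb 2 q))⁻¹ ≠ 0 :=
      ENNReal.inv_ne_zero.2 ENNReal.ofReal_ne_top
    rw [div_eq_mul_inv (condEntropy P _ _), div_eq_mul_inv (entropy P _),
      ENNReal.mul_div_mul_right _ _ hl1 hl0, entropyRatio, entropy_quant_blocks hs _ (by omega)]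
    gcongr
    exact condEntropy_measurements_le hs R (by omega)

include hs hM hlaw in
lemma exists_areREPRows_of_pos
    (hd : 0 < innovation (letterWeight ν enc) (letterSpace A) (pathOrder 0 0) (0, 0) +
      innovation (letterWeight ν enc) (letterSpace A) (pathOrder 0 0) (1, 0)) {ρ : Fin 2 → ℝ≥0}
    (h0 : innovation (letterWeight ν enc) (letterSpace A) (pathOrder 0 0) (0, 0) ≤ ρ 0)
    (h1 : innovation (letterWeight ν enc) (letterSpace A) (pathOrder 0 1) (1, 0) ≤ ρ 1)
    (hsum : innovation (letterWeight ν enc) (letterSpace A) (pathOrder 0 0) (0, 0) +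
      innovation (letterWeight ν enc) (letterSpace A) (pathOrder 0 0) (1, 0) ≤ ρ 0 + ρ 1)
    {ε : ℝ} (hε : 0 < ε) : ∃ R, AreREPRows P X Y ε ρ R := by
  obtain ⟨d, hdim⟩ : ∃ d, innovation (letterWeight ν enc) (letterSpace A) (pathOrder 0 0) (0, 0) +
    innovation (letterWeight ν enc) (letterSpace A) (pathOrder 0 0) (1, 0) = d := ⟨_, rfl⟩
  rw [hdim] at hd
  obtain ⟨n₁, hn₁⟩ := exists_rows (ρ := fun t => (ρ t : ℝ)) hM.letterWeight_nonneg
    hM.sum_letterWeight h0 h1 hsum (fun t => (ρ t).2) (mul_pos hε hd)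
  have hall : ∀ n, ∃ R : Fin 2 → Finset (Fin (2 ^ n)),
      (n₁ ≤ n → ∀ t, ((R t).card : ℝ) ≤ ρ t * 2 ^ n) ∧
      ∑ c, wordWeight (letterWeight ν enc) c *
        (Module.finrank ℝ (unresolved (letterSpace A) R c) : ℝ) ≤ ε * d * 2 ^ n := fun n => by
    by_cases hn : n₁ ≤ n
    · obtain ⟨R, hR, hR'⟩ := hn₁ n hn
      exact ⟨R, fun _ => hR, hR'⟩
    -- For short blocks all rows are taken: the ratio must be small for every `n`, but the rates are
    -- only constrained in the limit.
    · refine ⟨fun _ => Finset.univ, fun h => absurd h hn, ?_⟩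
      simp only [finrank_unresolved_univ, Nat.cast_zero, mul_zero, Finset.sum_const_zero]
      positivity
  choose R hR hR' using hall
  refine ⟨R, fun n => limsup_entropyRatio_le hs hM hlaw (R n) hd hdim (hR' n), fun t => ?_⟩
  refine limsup_le_of_le (by isBoundedDefault) ?_
  filter_upwards [eventually_ge_atTop n₁] with n hn
  refine ENNReal.div_le_of_le_mul ?_
  have h := hR n hn t
  exact_mod_cast h

end Measurement

end RenyiCompression

/-! ### Information dimension zero -/

namespace RenyiCompression

section LowerBound

variable {Ω : Type*} [MeasurableSpace Ω] {P : Measure Ω} [IsProbabilityMeasure P]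

lemma one_sub_le_infoContent {p : ℝ≥0∞} (hp : p ≤ 1) :
    (1 - p) * ENNReal.ofReal (1 / Real.log 2) ≤ infoContent p := by
  unfold infoContent
  split_ifs with h
  · exact le_top
  · have hf : p ≠ ∞ := ne_top_of_le_ne_top ENNReal.one_ne_top hp
    have hpos : 0 < p.toReal := ENNReal.toReal_pos h hf
    have h1 : 1 - p = ENNReal.ofReal (1 - p.toReal) := by
      rw [ENNReal.ofReal_sub _ ENNReal.toReal_nonneg, ENNReal.ofReal_one, ENNReal.ofReal_toReal hf]
    have h2 : p.toReal ≤ 1 := by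
      simpa using ENNReal.toReal_mono ENNReal.one_ne_top hp
    rw [h1, ← ENNReal.ofReal_mul (by linarith), mul_one_div]
    refine ENNReal.ofReal_le_ofReal (div_le_div_of_nonneg_right ?_ log_two_pos.le)
    linarith [Real.log_le_sub_one_of_pos hpos]

/-- The entropy of a discrete variable is at least the probability that two independent copies
differ, up to a factor. -/
lemma lintegral_ne_le_entropy {α : Type*} [MeasurableSpace α] [Countable α]
    [MeasurableSingletonClass α] [Nonempty α] {V : Ω → α} (hV : Measurable V) :
    (∫⁻ ω, P {ω' | V ω' ≠ V ω} ∂P) * ENNReal.ofReal (1 / Real.log 2) ≤ entropy P V := by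
  rw [entropy_eq_lintegral_infoContent hV, ← lintegral_mul_const' _ _ ENNReal.ofReal_ne_top]
  refine lintegral_mono fun ω => ?_
  have h : P {ω' | V ω' ≠ V ω} = 1 - P.map V {V ω} := by
    rw [Measure.map_apply hV (measurableSet_singleton _),
      ← prob_compl_eq_one_sub (hV (measurableSet_singleton _))]
    rfl
  have : IsProbabilityMeasure (P.map V) := Measure.isProbabilityMeasure_map hV.aemeasurable
  simp only [h]
  exact one_sub_le_infoContent prob_le_one

/-- Two independent copies of a nonconstant vector are at distance at least `1/(m+1)` with positive
probability for some `m`, and for `q ≥ m + 1` such points fall into different cells. This bounds the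
denominator of the REP quotient from below uniformly in `q`. -/
lemma exists_le_entropy_floorVec {ι : Type*} [Fintype ι] {ξ : Ω → ι → ℝ} (hξ : Measurable ξ)
    (hne : ¬ ∃ x, ∀ᵐ ω ∂P, ξ ω = x) :
    ∃ c : ℝ, 0 < c ∧ ∀ᶠ q : ℕ in atTop, ENNReal.ofReal c ≤ entropy P fun ω => floorVec q (ξ ω) := by
  let T : ℕ → Ω → Set Ω := fun m ω => {ω' | (1 : ℝ) / (m + 1) ≤ dist (ξ ω') (ξ ω)}
  have hTm : ∀ m, Measurable fun ω => P (T m ω) := fun m =>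
    measurable_measure_prodMk_left (s := {x : Ω × Ω | (1 : ℝ) / (m + 1) ≤ dist (ξ x.2) (ξ x.1)})
      (measurableSet_le measurable_const ((hξ.comp measurable_snd).dist (hξ.comp measurable_fst)))
  have hex : ∃ m, ∫⁻ ω, P (T m ω) ∂P ≠ 0 := by
    by_contra! h
    have h1 : ∀ᵐ ω ∂P, ∀ m, P (T m ω) = 0 :=
      ae_all_iff.2 fun m => (lintegral_eq_zero_iff (hTm m)).1 (h m)
    obtain ⟨ω, hω⟩ := h1.exists
    refine hne ⟨ξ ω, ?_⟩
    have h2 : ∀ᵐ ω' ∂P, ∀ m, ω' ∉ T m ω := ae_all_iff.2 fun m => measure_eq_zero_iff_ae_notMem.1 (hω m)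
    filter_upwards [h2] with ω' h'
    by_contra hd
    obtain ⟨m, hm⟩ := exists_nat_one_div_lt (dist_pos.2 hd)
    exact h' m hm.le
  obtain ⟨m, hm⟩ := hex
  have hlog : ENNReal.ofReal (1 / Real.log 2) ≠ 0 :=
    (ENNReal.ofReal_pos.2 (one_div_pos.2 log_two_pos)).ne'
  set c := (∫⁻ ω, P (T m ω) ∂P) * ENNReal.ofReal (1 / Real.log 2) with hc
  have hcI : ∫⁻ ω, P (T m ω) ∂P ≤ 1 := by
    calc ∫⁻ ω, P (T m ω) ∂P ≤ ∫⁻ _, 1 ∂P := lintegral_mono fun _ => prob_le_one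
      _ = 1 := by simp
  have hctop : c ≠ ∞ := ENNReal.mul_ne_top (ne_top_of_le_ne_top ENNReal.one_ne_top hcI)
    ENNReal.ofReal_ne_top
  refine ⟨c.toReal, ENNReal.toReal_pos (mul_ne_zero hm hlog) hctop, ?_⟩
  filter_upwards [eventually_ge_atTop (m + 1)] with q hq
  rw [ENNReal.ofReal_toReal hctop]
  refine le_trans ?_ (lintegral_ne_le_entropy ((measurable_floorVec q).comp hξ))
  rw [hc]
  gcongr with ω
  intro ω' hω' heq
  have hq0 : (0 : ℝ) < q := by exact_mod_cast (by omega : 0 < q)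
  have hlt : dist (ξ ω') (ξ ω) < 1 / (m + 1) := by
    refine (dist_pi_lt_iff (by positivity)).2 fun i => ?_
    have h1 : ⌊(q : ℝ) * ξ ω' i⌋ = ⌊(q : ℝ) * ξ ω i⌋ := congrFun heq i
    have h2 := Int.abs_sub_lt_one_of_floor_eq_floor h1
    rw [← mul_sub, abs_mul, abs_of_pos hq0] at h2
    rw [Real.dist_eq, lt_div_iff₀ (by positivity)]
    have h3 : ((m : ℝ) + 1) ≤ q := by exact_mod_cast hq
    calc |ξ ω' i - ξ ω i| * (m + 1) ≤ |ξ ω' i - ξ ω i| * q := by gcongr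
      _ < 1 := by rwa [mul_comm]
  exact absurd hω' (not_le.2 hlt)

lemma entropy_eq_zero_of_ae_const {α : Type*} [MeasurableSpace α] [Countable α]
    [MeasurableSingletonClass α] [Nonempty α] {V : Ω → α} (hV : Measurable V) {a : α}
    (h : ∀ᵐ ω ∂P, V ω = a) : entropy P V = 0 := by
  rw [entropy_eq_lintegral_infoContent hV]
  refine lintegral_eq_zero_of_ae_eq_zero ?_
  filter_upwards [h] with ω hω
  have h1 : P.map V {V ω} = 1 := by
    rw [Measure.map_apply hV (measurableSet_singleton _), hω]
    exact (mem_ae_iff_prob_eq_one (hV (measurableSet_singleton a))).1 h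
  rw [h1, infoContent_one]
  rfl

variable {X Y : ℕ → Ω → ℝ} (hs : IsMemorylessSource P X Y)

include hs in
lemma entropy_floorVec_pairBlock (q N : ℕ) :
    entropy P (fun ω => floorVec q (pairBlock X Y N ω)) =
      N * entropy P fun ω => floorVec q ![X 0 ω, Y 0 ω] := by
  have hfl := measurable_floorVec (ι := Fin 2) q
  obtain ⟨g, hg⟩ : ∃ g : (Fin N → Fin 2 → ℤ) → Fin N × Fin 2 → ℤ, ∀ v p, g v p = v p.1 p.2 :=
    ⟨_, fun _ _ => rfl⟩
  have hinj : Function.Injective g := fun v w h => funext fun i => funext fun t => by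
    rw [← hg v (i, t), ← hg w (i, t), h]
  have hgU : (fun ω => floorVec q (pairBlock X Y N ω)) =
      fun ω => g fun i => floorVec q ![X i ω, Y i ω] := funext fun ω => funext fun p => by
    rw [hg]
    rfl
  have hV : Measurable fun ω (i : Fin N) => floorVec q ![X i ω, Y i ω] :=
    measurable_pi_lambda _ fun i => hfl.comp (measurable_pair hs i)
  calc entropy P (fun ω => floorVec q (pairBlock X Y N ω))
      = entropy P (fun ω (i : Fin N) => floorVec q ![X i ω, Y i ω]) := by
        rw [hgU]
        exact entropy_comp_injective hV hinj
    _ = ∑ i : Fin N, entropy P fun ω => floorVec q ![X i ω, Y i ω] :=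
      entropy_pi_of_iIndepFun hV
        (((iIndepFun_pair hs).comp (fun _ => floorVec q) fun _ => hfl).precomp Fin.val_injective)
    _ = ∑ i : Fin N, entropy P fun ω => floorVec q ![X 0 ω, Y 0 ω] := by
      refine Finset.sum_congr rfl fun i _ => ?_
      exact congrArg atomEntropy ((identDistrib_pair hs i).comp hfl).map_eq
    _ = _ := by simp

end LowerBound

section DimensionZero

variable {Ω : Type*} [MeasurableSpace Ω] {P : Measure Ω} [IsProbabilityMeasure P]
  {X Y : ℕ → Ω → ℝ} (hs : IsMemorylessSource P X Y) {k : ℕ} {A : Matrix (Fin 2) (Fin k) ℝ}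
  {ν : Fin k → Measure ℝ} {S : Fin k → Set ℝ} {enc : Fin k → ℝ → ℕ}
  {dec : Fin k → ℕ → ℝ} (hM : IsEncodedModel ν S enc dec)
  (hlaw : P.map (fun ω => ![X 0 ω, Y 0 ω]) = (Measure.pi ν).map fun z => A.mulVec z)
  (hd : innovation (letterWeight ν enc) (letterSpace A) (pathOrder 0 0) (0, 0) +
      innovation (letterWeight ν enc) (letterSpace A) (pathOrder 0 0) (1, 0) = 0)

include hM hd in
-- A vanishing expected dimension forces dimension zero for every letter of positive probability;
-- the constant word exhibits the letter.
lemma letterSpace_eq_bot {C : Finset (Fin k)} (hC : letterWeight ν enc C ≠ 0) :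
    letterSpace A C = ⊥ := by
  have h := sum_innovation_pathOrder (S := letterSpace A) hM.sum_letterWeight 0 0
  rw [hd, mul_zero, ← Fin.sum_univ_two
    (fun t => ∑ i, innovation (letterWeight ν enc) (letterSpace A) (pathOrder 0 0) (t, i)),
    sum_innovation (pathOrder_injective _ _), Finset.sum_eq_zero_iff_of_nonneg fun c _ =>
      mul_nonneg (wordWeight_nonneg hM.letterWeight_nonneg c) (Nat.cast_nonneg _)] at h
  have h1 := h (fun _ => C) (Finset.mem_univ _)
  have hC' : wordWeight (letterWeight ν enc) (fun _ : Fin (2 ^ 0) => C) ≠ 0 :=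
    Finset.prod_ne_zero_iff.2 fun _ _ => hC
  rw [mul_eq_zero, or_iff_right hC', Nat.cast_eq_zero,
    Submodule.finrank_eq_zero] at h1
  rw [Submodule.eq_bot_iff]
  intro u hu
  have hmem : (fun _ => u) ∈ unresolved (n := 0) (letterSpace A) (fun _ => ∅) fun _ => C :=
    mem_unresolved.2 ⟨fun _ => hu, fun t i hi => absurd hi (Finset.notMem_empty i)⟩
  rw [h1, Submodule.mem_bot] at hmem
  exact congrFun hmem 0

include hM hd in
-- The free coordinates contribute a vector of the letter space, which is almost surely zero, so `A
-- z` is a function of the label.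
lemma ae_mulVec_eq_discretePart : ∀ᵐ z ∂(Measure.pi ν),
    A.mulVec z = A.mulVec (discretePart dec fun j => enc j (z j)) := by
  have := hM.isProbabilityMeasure
  have hae : ∀ᵐ z ∂(Measure.pi ν), letterSpace A (letterOf enc z) = ⊥ := by
    have h : ∀ᵐ z ∂(Measure.pi ν), ∀ C, letterSpace A C ≠ ⊥ → letterOf enc z ≠ C := by
      refine ae_all_iff.2 fun C => ?_
      by_cases hC : letterSpace A C = ⊥
      · exact ae_of_all _ fun z h => absurd hC h
      · have h0 : letterWeight ν enc C = 0 := by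
          by_contra h
          exact hC (letterSpace_eq_bot hM hd h)
        have h1 := (measureReal_eq_zero_iff).1 h0
        filter_upwards [measure_eq_zero_iff_ae_notMem.1 h1] with z hz _
        exact hz
    filter_upwards [h] with z hz
    by_contra hne
    exact hz _ hne rfl
  filter_upwards [hae, hM.isMixedVector.decode] with z hz hdec
  have h1 : z - discretePart dec (fun j => enc j (z j)) = extendZero (letterOf enc z) fun j => z j :=
    sub_eq_of_eq_add' (eq_discretePart_add hdec)
  have hmem : A.mulVec (z - discretePart dec fun j => enc j (z j)) ∈
      letterSpace A (letterOf enc z) := by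
    rw [h1]
    exact mem_letterSpace.2 ⟨_, fun j hj => dif_neg hj, rfl⟩
  rw [hz, Submodule.mem_bot, Matrix.mulVec_sub, sub_eq_zero] at hmem
  exact hmem

include hs hM hlaw hd in
/-- At dimension zero, each source is discrete with finite entropy. -/
lemma exists_encoding_of_dimension_zero (t : Fin 2) :
    ∃ (e : ℝ → ℕ) (f : ℕ → ℝ), Measurable e ∧
      (∀ᵐ ω ∂P, f (e (![X 0 ω, Y 0 ω] t)) = ![X 0 ω, Y 0 ω] t) ∧
      entropy P (fun ω => e (![X 0 ω, Y 0 ω] t)) ≠ ∞ := by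
  have := hM.isProbabilityMeasure
  obtain ⟨g, hg⟩ : ∃ g : (Fin k → ℕ) → ℝ, ∀ l, g l = A.mulVec (discretePart dec l) t :=
    ⟨_, fun _ => rfl⟩
  -- `g` has countable range because there are countably many labels. The resulting code is a
  -- function of the label, hence of finite entropy.
  obtain ⟨e, f, he, -, hf⟩ := exists_encoding (Set.countable_range g)
  have hU := measurable_pair hs 0
  have hA := measurable_mulVec A
  have hmix := hM.isMixedVector
  have hD := hmix.measurable_label
  have hae : ∀ᵐ z ∂(Measure.pi ν), A.mulVec z t = g fun j => enc j (z j) := by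
    filter_upwards [ae_mulVec_eq_discretePart hM hd] with z hz
    rw [hg, hz]
  have ht : Measurable fun u : Fin 2 → ℝ => u t := measurable_pi_apply t
  refine ⟨e, f, he, ?_, ?_⟩
  · have hset : MeasurableSet {u : Fin 2 → ℝ | f (e (u t)) = u t} :=
      measurableSet_eq_fun (((measurable_of_countable f).comp he).comp ht) ht
    refine ae_of_ae_map (p := fun u : Fin 2 → ℝ => f (e (u t)) = u t) hU.aemeasurable ?_
    rw [hlaw, ae_map_iff hA.aemeasurable hset]
    filter_upwards [hae] with z hz
    rw [hz]
    exact hf _ ⟨_, rfl⟩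
  · have h1 : entropy P (fun ω => e (![X 0 ω, Y 0 ω] t)) =
        entropy (Measure.pi ν) fun z => e (g fun j => enc j (z j)) := by
      have e1 := Measure.map_map (μ := P) (he.comp ht) hU
      have e2 := Measure.map_map (μ := Measure.pi ν) (he.comp ht) hA
      rw [hlaw] at e1
      refine congrArg atomEntropy ((e1.symm.trans e2).trans (Measure.map_congr ?_))
      filter_upwards [hae] with z hz
      exact congrArg e hz
    rw [h1]
    refine ne_top_of_le_ne_top hmix.entropy_label ?_
    rw [← condEntropy_const_right hD (), ← condEntropy_const_right
      (V := fun z : Fin k → ℝ => e (g fun j => enc j (z j)))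
      (((measurable_of_countable fun l => e (g l))).comp hD) ()]
    exact condEntropy_comp_le hD measurable_const fun l => e (g l)

include hs in
-- At dimension zero each terminal is decoded separately: both rates vanish anyway, so the
-- correlation need not be exploited.
lemma condEntropy_measurements_le_add {n : ℕ} (R : Fin 2 → Finset (Fin (2 ^ n))) {q : ℕ}
    (hq : 1 ≤ q) :
    condEntropy P (fun ω => (quant q (block X (2 ^ n) ω), quant q (block Y (2 ^ n) ω)))
        (measurements X Y R) ≤
      condEntropy P (fun ω => floorVec q (block X (2 ^ n) ω))
        (fun ω => maskedRows (R 0) (block X (2 ^ n) ω)) +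
      condEntropy P (fun ω => floorVec q (block Y (2 ^ n) ω))
        (fun ω => maskedRows (R 1) (block Y (2 ^ n) ω)) := by
  have hX : Measurable fun ω => floorVec q (block X (2 ^ n) ω) :=
    (measurable_floorVec q).comp (measurable_block hs.measurable_fst _)
  have hY : Measurable fun ω => floorVec q (block Y (2 ^ n) ω) :=
    (measurable_floorVec q).comp (measurable_block hs.measurable_snd _)
  have hW := measurable_measurements hs R
  have hinj : Function.Injective fun v : (Fin (2 ^ n) → ℤ) × (Fin (2 ^ n) → ℤ) =>
      (scaleInt q v.1, scaleInt q v.2) :=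
    (scaleInt_injective hq).prodMap (scaleInt_injective hq)
  simp only [quant_eq_scaleInt]
  rw [condEntropy_comp_injective (hX.prodMk hY) hinj]
  refine (condEntropy_prodMk_le hX hY hW).trans (add_le_add ?_ ?_)
  · obtain ⟨φ, hφ, hφx⟩ := exists_maskedRows_eq (R 0)
    refine (condEntropy_le_comp hX hW (hφ.comp measurable_fst)).trans_eq ?_
    congr 1
    exact funext fun ω => hφx _
  · obtain ⟨φ, hφ, hφx⟩ := exists_maskedRows_eq (R 1)
    refine (condEntropy_le_comp hY hW (hφ.comp measurable_snd)).trans_eq ?_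
    congr 1
    exact funext fun ω => hφx _

lemma limsup_card_div_le {R : ∀ n, Finset (Fin (2 ^ n))}
    (h : Tendsto (fun n => ((R n).card : ℝ) / 2 ^ n) atTop (𝓝 0)) (ρ : ℝ≥0) :
    limsup (fun n => ((R n).card : ℝ≥0∞) / ((2 ^ n : ℕ) : ℝ≥0∞)) atTop ≤ ρ := by
  have h1 := ENNReal.tendsto_ofReal h
  rw [ENNReal.ofReal_zero] at h1
  have h2 : ∀ n, ENNReal.ofReal (((R n).card : ℝ) / 2 ^ n) =
      ((R n).card : ℝ≥0∞) / ((2 ^ n : ℕ) : ℝ≥0∞) := fun n => by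
    rw [ENNReal.ofReal_div_of_pos (by positivity), ENNReal.ofReal_natCast]
    congr 1
    rw [← ENNReal.ofReal_natCast]
    push_cast
    rfl
  simp only [h2] at h1
  rw [h1.limsup_eq]
  exact zero_le

include hs hM hlaw hd in
-- A constant source needs no rows, its quotient being `0/0 = 0`. Otherwise the block entropy is at
-- least `c` per letter, and rows of vanishing rate bring the numerator below `ε c` per letter.
lemma exists_areREPRows_of_eq_zero (ρ : Fin 2 → ℝ≥0) {ε : ℝ} (hε : 0 < ε) :
    ∃ R, AreREPRows P X Y ε ρ R := by
  by_cases hc : ∃ x, ∀ᵐ ω ∂P, ![X 0 ω, Y 0 ω] = x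
  · obtain ⟨x, hx⟩ := hc
    refine ⟨fun _ _ => ∅, fun n => ?_, fun t => limsup_card_div_le (by simp) _⟩
    refine limsup_le_of_le (by isBoundedDefault) ?_
    filter_upwards [eventually_ge_atTop 1] with q hq
    have hm : Measurable fun ω => floorVec q ![X 0 ω, Y 0 ω] :=
      (measurable_floorVec q).comp (measurable_pair hs 0)
    have h0 : entropy P (fun ω => floorVec q (pairBlock X Y (2 ^ n) ω)) = 0 := by
      rw [entropy_floorVec_pairBlock hs, entropy_eq_zero_of_ae_const hm (a := floorVec q x),
        mul_zero]
      filter_upwards [hx] with ω hω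
      rw [hω]
    have h1 := condEntropy_le_entropy (P := P) (measurable_floorVec_pairBlock hs q (2 ^ n))
      (measurable_measurements hs (n := n) fun _ => ∅)
    rw [h0] at h1
    rw [entropyRatio, condEntropy_quant_blocks hs _ _ hq, le_antisymm h1 zero_le,
      ENNReal.zero_div]
    exact zero_le
  · obtain ⟨c, hc0, hc⟩ := exists_le_entropy_floorVec (measurable_pair hs 0) hc
    -- Half of the admissible remainder `ε * c` for each terminal.
    have hεc : 0 < ε * c / 2 := by positivity
    obtain ⟨e₀, f₀, he₀, hf₀, hent₀⟩ := exists_encoding_of_dimension_zero hs hM hlaw hd 0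
    obtain ⟨e₁, f₁, he₁, hf₁, hent₁⟩ := exists_encoding_of_dimension_zero hs hM hlaw hd 1
    obtain ⟨R₀, hR₀, hle₀⟩ := exists_rows_discrete hs.measurable_fst
      (hs.indep.comp (fun _ x => x.1) fun _ => measurable_fst)
      (fun i => (hs.identDistrib i).comp measurable_fst) he₀ hf₀ hent₀ hεc
    obtain ⟨R₁, hR₁, hle₁⟩ := exists_rows_discrete hs.measurable_snd
      (hs.indep.comp (fun _ x => x.2) fun _ => measurable_snd)
      (fun i => (hs.identDistrib i).comp measurable_snd) he₁ hf₁ hent₁ hεc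
    refine ⟨fun n => ![R₀ n, R₁ n], fun n => ?_, Fin.forall_fin_two.2
      ⟨limsup_card_div_le hR₀ _, limsup_card_div_le hR₁ _⟩⟩
    refine limsup_le_of_le (by isBoundedDefault) ?_
    filter_upwards [eventually_ge_atTop 1, hc] with q hq hcq
    refine ENNReal.div_le_of_le_mul ?_
    refine (condEntropy_measurements_le_add hs _ hq).trans
      ((add_le_add (hle₀ n q) (hle₁ n q)).trans ?_)
    rw [entropy_quant_blocks hs _ hq, entropy_floorVec_pairBlock hs,
      ← ENNReal.ofReal_add (by positivity) (by positivity)]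
    calc ENNReal.ofReal (ε * c / 2 * 2 ^ n + ε * c / 2 * 2 ^ n)
        = ENNReal.ofReal ε * (((2 ^ n : ℕ) : ℝ≥0∞) * ENNReal.ofReal c) := by
          rw [← ENNReal.ofReal_natCast, ← ENNReal.ofReal_mul (by positivity),
            ← ENNReal.ofReal_mul hε.le]
          congr 1
          push_cast
          ring
      _ ≤ _ := by gcongr

end DimensionZero

end RenyiCompression

end

/-! ### Conclusion -/

theorem mainTheorem8 {Ω : Type*} [MeasurableSpace Ω] (P : Measure Ω) [IsProbabilityMeasure P]
    (X Y : ℕ → Ω → ℝ)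
    (hsource : RenyiCompression.IsMemorylessSource P X Y)
    (hL : RenyiCompression.MemL P (fun ω => ![X 0 ω, Y 0 ω])) :
    ∃ dX_Y dY_X dXY : ℝ≥0,
      RenyiCompression.HasCondRID P (fun ω => ![X 0 ω]) (fun ω => ![Y 0 ω]) dX_Y ∧
      RenyiCompression.HasCondRID P (fun ω => ![Y 0 ω]) (fun ω => ![X 0 ω]) dY_X ∧
      RenyiCompression.HasRID P (fun ω => ![X 0 ω, Y 0 ω]) dXY ∧
      ∀ ρx ρy : ℝ≥0, dX_Y ≤ ρx → dY_X ≤ ρy → dXY ≤ ρx + ρy →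
        ∀ ε : ℝ, 0 < ε →
          ∃ (mx my : ℕ → ℕ)
            (Φx : ∀ n, Matrix (Fin (mx n)) (Fin (2 ^ n)) ℝ)
            (Φy : ∀ n, Matrix (Fin (my n)) (Fin (2 ^ n)) ℝ),
            (∀ n, RenyiCompression.IsPartialHadamard (Φx n)) ∧
            (∀ n, RenyiCompression.IsPartialHadamard (Φy n)) ∧
            RenyiCompression.IsREP P X Y ε ρx ρy (fun n => 2 ^ n) mx my Φx Φy := by
  obtain ⟨k, A, ν, hν, hlaw⟩ := hL
  obtain ⟨S, enc, dec, hM⟩ := RenyiCompression.exists_encodedModel hν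
  refine ⟨_, _, _, RenyiCompression.hasCondRID_fst hsource hM hlaw,
    RenyiCompression.hasCondRID_snd hsource hM hlaw, RenyiCompression.hasRID_pair hsource hM hlaw,
    fun ρx ρy h0 h1 hsum ε hε => ?_⟩
  rw [Real.toNNReal_le_iff_le_coe] at h0 h1 hsum
  rw [NNReal.coe_add] at hsum
  obtain ⟨R, hR⟩ : ∃ R, RenyiCompression.AreREPRows P X Y ε ![ρx, ρy] R := by
    have hnn := fun t => RenyiCompression.innovation_nonneg hM.letterWeight_nonneg
      (S := RenyiCompression.letterSpace A) (τ := RenyiCompression.pathOrder 0 0) (t, 0)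
    -- The compared quantity is `d(X, Y)`. When it vanishes, the entropy in the denominator is
    -- `o(log q)`, and the comparison of dimensions no longer controls the quotient.
    rcases (add_nonneg (hnn 0) (hnn 1)).eq_or_lt with hd | hd
    · exact RenyiCompression.exists_areREPRows_of_eq_zero hsource hM hlaw hd.symm _ hε
    · exact RenyiCompression.exists_areREPRows_of_pos hsource hM hlaw hd h0 h1 hsum hε
  exact ⟨_, _, _, _, fun n => RenyiCompression.isPartialHadamard_partialHadamard (R n 0),
    fun n => RenyiCompression.isPartialHadamard_partialHadamard (R n 1), hR.isREP⟩
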